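/- Let $f(x)=a+bx+\int_0^\infty(1-e^{-xs})\,\bar\nu(ds)$ be a Bernstein function, where $a,b\ge 0$ and $\bar\nu$ is a measure on $(0,\infty)$ with $\int_0^\infty (s\wedge 1)\,\bar\nu(ds)<\infty$. Let $\nu(s)=a+\bar\nu(s,\infty)$, $s>0$, and assume that $\bar\nu(0,\infty)=\infty$ and that $\nu$ is absolutely continuous on compact subintervals of $(0,\infty)$. The convolution-type derivative of $u$ with respect to $f$ is $$\mathcal D^f_t u(t)=b\,u'(t)+\int_0^t \frac{\partial}{\partial t}u(t-s)\,\nu(s)\,ds .$$ Let $\lambda_1,\lambda,\alpha,\beta>0$. On a probability space, let the following processes be mutually independent: a Poisson process $N_1$ with intensity $\lambda_1$; a Poisson process $N$ with intensity $\lambda$; a Gamma subordinator $G$, whose increment over $(s,t]$ has the Gamma law with shape $\alpha(t-s)$ and rate $\beta$; and a (possibly killed, if $a>0$) subordinator $H^f$ with $\mathbb E e^{-uH^f(t)}=e^{-tf(u)}$ for $u>0$, $t\ge 0$. Let $G_N(t)=G(N(t))$ be the compound Poisson–Gamma subordinator, with Laplace exponent $$\psi_{GN}(u)=\lambda\beta^\alpha\left(\beta^{-\alpha}-(\beta+u)^{-\alpha}\right),$$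 let $Y^f(t)=\inf\{s\ge 0: H^f(s)>t\}$, $\tilde\ell_f(t,\theta)=\mathbb E e^{-\theta Y^f(t)}$, $N^{GN,f}(t)=N_1(G_N(Y^f(t)))$ and $p_k^{GN,f}(t)=\mathbb P\{N^{GN,f}(t)=k\}$, $k=0,1,2,\dots$ (0) For every $t>0$ the law of $Y^f(t)$ has a density $\ell_f(t,\cdot)$ with respect to Lebesgue measure, and $\tilde\ell_f(t,\theta)=\int_0^\infty e^{-\theta x}\ell_f(t,x)\,dx$ for all $\theta\ge 0$. (1) For all $k\ge 0$ and $t\ge 0$, the function $v\mapsto\tilde\ell_f(t,\psi_{GN}(v))$ is smooth near $v=\lambda_1$ and $$p_k^{GN,f}(t)=\frac{(-\lambda_1\partial_{\lambda_1})^k}{k!}\,\tilde\ell_f(t,\psi_{GN}(\lambda_1)),\qquad\text{where } (-\lambda_1\partial_{\lambda_1})^k \text{ denotes } (-\lambda_1)^k\,\frac{\partial^k}{\partial\lambda_1^k}.$$ (2) For all $k\ge 0$ and $t>0$, the function $p_k^{GN,f}$ is absolutely continuous on $[0,t]$, $\mathcal D^f_t p_k^{GN,f}(t)$ is well defined (the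 convolution integral converges absolutely and, if $b\neq 0$, $p_k^{GN,f}$ is differentiable at $t$), and $$\mathcal D^f_t p_k^{GN,f}(t)=\left(\frac{\lambda\beta^\alpha}{(\lambda_1+\beta)^\alpha}-\lambda\right)p_k^{GN,f}(t)+\frac{\lambda\beta^\alpha}{(\lambda_1+\beta)^\alpha}\sum_{m=1}^k\frac{\lambda_1^m}{(\lambda_1+\beta)^m}\,\frac{\Gamma(m+\alpha)}{m!\,\Gamma(\alpha)}\,p_{k-m}^{GN,f}(t).$$ (3) If $\alpha=1$, so that $G_N=E_N$ is the compound Poisson–exponential subordinator with Laplace exponent $\psi_E(u)=\frac{\lambda u}{\beta+u}$, then the probabilities $p_k^{E,f}(t)=\mathbb P\{N_1(E_N(Y^f(t)))=k\}$ satisfy, for all $k\ge 0$: the function $v\mapsto\tilde\ell_f(t,\psi_E(v))$ is smooth near $v=\lambda_1$ and $$p_k^{E,f}(t)=\frac{(-\lambda_1\partial_{\lambda_1})^k}{k!}\,\tilde\ell_f(t,\psi_E(\lambda_1))\quad (t\ge 0),$$ $$\mathcal D^f_t p_k^{E,f}(t)=-\lambda\frac{\lambda_1}{\lambda_1+\beta}\,p_k^{E,f}(t)+\frac{\lambda\beta}{\lambda_1+\beta}\sum_{m=1}^k\left(\frac{\lambda_1}{\lambda_1+\beta}\right)^m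 p_{k-m}^{E,f}(t)\quad (t>0).$$ -/

import Mathlib

open MeasureTheory ProbabilityTheory Set
open scoped NNReal ENNReal

noncomputable section

namespace ConvCounting

/-- The characteristics `(a, b, ν̄)` of a Bernstein function: `a, b ≥ 0` and a measure `ν̄` carried
by `(0, ∞)` with `∫ (s ∧ 1) ν̄(ds) < ∞`. -/
structure BernsteinTriplet where
  a : ℝ
  b : ℝ
  levy : Measure ℝ
  a_nonneg : 0 ≤ a
  b_nonneg : 0 ≤ b
  levy_Iic : levy (Iic 0) = 0
  lintegral_min_lt_top : ∫⁻ s, ENNReal.ofReal (min s 1) ∂levy < ∞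

namespace BernsteinTriplet

/-- The Bernstein function `f(x) = a + b x + ∫_(0,∞) (1 - e^{-xs}) ν̄(ds)`. -/
def fn (f : BernsteinTriplet) (x : ℝ) : ℝ :=
  f.a + f.b * x + ∫ s in Ioi 0, (1 - Real.exp (-(x * s))) ∂f.levy

/-- The tail `ν(s) = a + ν̄(s, ∞)`, for `s > 0`. -/
def tail (f : BernsteinTriplet) (s : ℝ) : ℝ :=
  f.a + (f.levy (Ioi s)).toReal

/-- Condition I: `ν̄(0, ∞) = ∞` and the tail is absolutely continuous on `(0, ∞)`, that is, on
its compact subintervals (at `0+` the tail is infinite). -/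
def ConditionI (f : BernsteinTriplet) : Prop :=
  f.levy (Ioi 0) = ∞ ∧
    ∀ x y : ℝ, 0 < x → x ≤ y → AbsolutelyContinuousOnInterval f.tail x y

/-- The convolution-type (generalized Caputo-Djrbashian) derivative
`𝒟^f_t u(t) = b u'(t) + ∫_0^t ∂_t u(t - s) ν(s) ds`. -/
def convDeriv (f : BernsteinTriplet) (u : ℝ → ℝ) (t : ℝ) : ℝ :=
  f.b * deriv u t + ∫ s in (0 : ℝ)..t, deriv u (t - s) * f.tail s

/-- The expression defining `𝒟^f_t u(t)` is meaningful at `t`: `u` is absolutely continuous on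
`[0, t]`, the convolution integral converges absolutely, and `u'(t)` exists if `b ≠ 0`. -/
structure ConvDifferentiableAt (f : BernsteinTriplet) (u : ℝ → ℝ) (t : ℝ) : Prop where
  absolutelyContinuous : AbsolutelyContinuousOnInterval u 0 t
  differentiableAt : f.b ≠ 0 → DifferentiableAt ℝ u t
  integrable : IntervalIntegrable (fun s => deriv u (t - s) * f.tail s) volume 0 t

end BernsteinTriplet

variable {Ω : Type*} [MeasurableSpace Ω]

/-- The σ-algebra generated by a whole process. -/
abbrev pathSigma {E : Type*} [MeasurableSpace E] (X : ℝ≥0 → Ω → E) : MeasurableSpace Ω :=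
  MeasurableSpace.comap (fun ω t => X t ω) MeasurableSpace.pi

/-- The path of `X` at `ω` is nondecreasing and right-continuous. -/
def RegularPath {E : Type*} [Preorder E] [TopologicalSpace E] (X : ℝ≥0 → Ω → E) (ω : Ω) : Prop :=
  Monotone (fun t => X t ω) ∧ ∀ t, ContinuousWithinAt (fun s => X s ω) (Ici t) t

/-- The homogeneous Poisson process with intensity `rate`. -/
structure IsPoissonProcess (N : ℝ≥0 → Ω → ℕ) (rate : ℝ) (μ : Measure Ω) : Prop where
  measurable : ∀ t, Measurable (N t)
  zero : ∀ᵐ ω ∂μ, N 0 ω = 0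
  regular : ∀ᵐ ω ∂μ, RegularPath N ω
  indep : HasIndepIncrements (fun t ω => (N t ω : ℝ)) μ
  law : ∀ s t : ℝ≥0, s ≤ t →
    μ.map (fun ω => N t ω - N s ω) = poissonMeasure (rate.toNNReal * (t - s))

/-- The Gamma subordinator: independent increments, the increment over `(s, t]` having the
Gamma law with shape `α (t - s)` and rate `β`. -/
structure IsGammaSubordinator (G : ℝ≥0 → Ω → ℝ≥0) (α β : ℝ) (μ : Measure Ω) : Prop where
  measurable : ∀ t, Measurable (G t)
  zero : ∀ᵐ ω ∂μ, G 0 ω = 0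
  regular : ∀ᵐ ω ∂μ, RegularPath G ω
  indep : HasIndepIncrements (fun t ω => (G t ω : ℝ)) μ
  law : ∀ s t : ℝ≥0, s < t →
    μ.map (fun ω => (G t ω : ℝ) - (G s ω : ℝ)) = gammaMeasure (α * ((t : ℝ) - s)) β

/-- `H` is a subordinator with Laplace exponent `φ`. As `φ(0+) = a` may be positive, `H` takes
values in `[0, ∞]` and is sent to the absorbing state `∞` at rate `a`: given `H s < ∞`, the
increment `H (s + t) - H s` is independent of the past up to `s` and distributed as `H t`. The
Laplace transform uses `e^{-u ∞} = 0`. -/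
structure IsSubordinator (H : ℝ≥0 → Ω → ℝ≥0∞) (φ : ℝ → ℝ) (μ : Measure Ω) : Prop where
  measurable : ∀ t, Measurable (H t)
  zero : ∀ᵐ ω ∂μ, H 0 ω = 0
  regular : ∀ᵐ ω ∂μ, RegularPath H ω
  increments : ∀ (s t : ℝ≥0) (A : Set Ω) (B : Set ℝ≥0∞),
    MeasurableSet[⨆ r ≤ s, MeasurableSpace.comap (H r) inferInstance] A → MeasurableSet B →
    μ (A ∩ {ω | H s ω < ∞} ∩ {ω | H (s + t) ω - H s ω ∈ B}) =
      μ (A ∩ {ω | H s ω < ∞}) * μ {ω | H t ω ∈ B}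
  laplace : ∀ (t : ℝ≥0) (u : ℝ), 0 < u →
    ∫ ω, (if H t ω = ∞ then 0 else Real.exp (-(u * (H t ω).toReal))) ∂μ =
      Real.exp (-((t : ℝ) * φ u))

/-- The inverse process `Y(t) = inf {s ≥ 0 : H(s) > t}`. -/
def inverse (H : ℝ≥0 → Ω → ℝ≥0∞) (t : ℝ≥0) (ω : Ω) : ℝ≥0 :=
  sInf {s : ℝ≥0 | (t : ℝ≥0∞) < H s ω}

/-- The law of `Y(t)` on the real line. -/
def inverseLaw (H : ℝ≥0 → Ω → ℝ≥0∞) (μ : Measure Ω) (t : ℝ≥0) : Measure ℝ :=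
  μ.map (fun ω => (inverse H t ω : ℝ))

/-- The density `ℓ_f(t, ·)` of `Y(t)`. -/
def inverseDensity (H : ℝ≥0 → Ω → ℝ≥0∞) (μ : Measure Ω) (t : ℝ≥0) (x : ℝ) : ℝ :=
  ((inverseLaw H μ t).rnDeriv volume x).toReal

/-- The space Laplace transform `ℓ̃_f(t, θ) = E e^{-θ Y(t)}`. -/
def inverseLaplace (H : ℝ≥0 → Ω → ℝ≥0∞) (μ : Measure Ω) (t : ℝ≥0) (θ : ℝ) : ℝ :=
  ∫ ω, Real.exp (-(θ * (inverse H t ω : ℝ))) ∂μ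

/-- `p_k(t) = P {N₁(G(N(Y(t)))) = k}`, with `Y` the inverse of `H`. -/
def stateProb (N₁ : ℝ≥0 → Ω → ℕ) (G : ℝ≥0 → Ω → ℝ≥0) (N : ℝ≥0 → Ω → ℕ) (H : ℝ≥0 → Ω → ℝ≥0∞)
    (μ : Measure Ω) (k : ℕ) (t : ℝ≥0) : ℝ :=
  μ.real {ω | N₁ (G (N (inverse H t ω) ω : ℝ≥0) ω) ω = k}

/-- `ψ_GN(u) = λ β^α (β^{-α} - (β + u)^{-α})`. -/
def psiGN (lam α β u : ℝ) : ℝ :=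
  lam * β ^ α * (β ^ (-α) - (β + u) ^ (-α))

/-- `ψ_E(u) = λ u / (β + u)`. -/
def psiE (lam β u : ℝ) : ℝ :=
  lam * u / (β + u)

/-- `(-v ∂_v)^k g (v) / k!`, read as `(-v)^k g^{(k)}(v) / k!`. -/
def scaledDeriv (k : ℕ) (g : ℝ → ℝ) (v : ℝ) : ℝ :=
  (-v) ^ k * iteratedDeriv k g v / (k.factorial : ℝ)

end ConvCounting

end

/-! Let w_k(y) = P(N₁(G(N(y))) = k). Conditioning on N(y) makes w_k a Poisson mixture of the numbers
E e^{-λ₁G(n)}(λ₁G(n))^k/k!. The independent Gamma increments of G turn this into a triangular linear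
system w_k' = Σ_{j≤k} c_{kj} w_j whose coefficients come from negative binomial weights
(`hasDerivAt_compoundProb`). Independence gives p_k(t) = E w_k(Y(t)) (`exists_composite`), so the
task is to show that the time change by Y replaces d/dy by 𝒟^f.

For 0 ≤ κ ≤ 1 let V_κ = ∫_0^∞ κ(x) P(H(x) ∈ ·, H(x) < ∞) dx. Since {Y(t) > x} and {H(x) ≤ t} agree
up to null sets for x > 0, E ∫_0^{Y(t)} κ = V_κ[0, t]. If V_κ has a density g with b g + ν ∗ g = E
κ(Y(·)), then 𝒟^f sends t ↦ E ∫_0^{Y(t)} κ to E κ(Y(t)). Applied to κ = w_j and combined linearly,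
this is the governing equation (`convDeriv_integral_right`). The equation for g comes from Laplace
transforms in time: b plus the transform of ν is f(s)/s, the transform of V_κ is ∫ κ(x) e^{-x f(s)}
dx, and their product is the transform of E κ(Y(·)) (`potential_add_tailConv`).

Laplace transforms only give this for almost every t, while every t > 0 is claimed. The remedy is
that H(x) has an absolutely continuous law for x > 0 (`absolutelyContinuous_of_lap`): an infinite,
absolutely continuous Lévy measure leaves no singular part. Then Fatou's lemma gives ν ∗ V_κ ≤ E
κ(Y(t)) at every t. Without drift, the Markov property at a small operational time ε gives the
converse, because averaging over the law of H(ε) ignores null sets of times. With drift, the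
equation itself is solved for a continuous version of g (`exists_density`).

For the formula with derivatives in λ₁, p_k(t) = E e^{-λ₁S}(λ₁S)^k/k! with S = G(N(Y(t))) almost
surely. This is a scaled k-th derivative of v ↦ E e^{-vS} = ℓ̃_f(t, ψ(v)), which is analytic on v >
0. -/

noncomputable section

namespace ConvCounting

open Filter Topology

/-! ### Laplace transforms of measures on the half line: uniqueness and vague convergence. -/

/-- The Laplace transform of a measure on the line, as an extended nonnegative number. -/
def lap (μ : Measure ℝ) (s : ℝ) : ℝ≥0∞ :=
  ∫⁻ y, ENNReal.ofReal (Real.exp (-(s * y))) ∂μ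

theorem integral_exp_eq_lap (μ : Measure ℝ) (s : ℝ) :
    ∫ y, Real.exp (-(s * y)) ∂μ = (lap μ s).toReal := by
  rw [integral_eq_lintegral_of_nonneg_ae (ae_of_all _ fun y => (Real.exp_pos _).le)
    (by fun_prop)]
  rfl

theorem ae_nonneg_of_Iio {μ : Measure ℝ} (h : μ (Iio 0) = 0) : ∀ᵐ y ∂μ, 0 ≤ y := by
  rw [ae_iff]; simpa [Iio] using h

theorem lap_le_univ {μ : Measure ℝ} (h : μ (Iio 0) = 0) {s : ℝ} (hs : 0 ≤ s) :
    lap μ s ≤ μ univ := by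
  rw [← lintegral_one]
  refine lintegral_mono_ae ?_
  filter_upwards [ae_nonneg_of_Iio h] with y hy
  rw [ENNReal.ofReal_le_one, Real.exp_le_one_iff]
  have := mul_nonneg hs hy
  linarith

theorem integrable_exp_of_Iio {μ : Measure ℝ} [IsFiniteMeasure μ] (h : μ (Iio 0) = 0) {s : ℝ}
    (hs : 0 ≤ s) : Integrable (fun y => Real.exp (-(s * y))) μ := by
  refine ⟨by fun_prop, ?_⟩
  rw [hasFiniteIntegral_iff_ofReal (ae_of_all _ fun y => (Real.exp_pos _).le)]
  exact (lap_le_univ h hs).trans_lt (measure_lt_top _ _)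

/-- A compactly supported function, as a function of `z = e^{-y}`, after division by `z`. -/
theorem exists_continuousOn_exp_neg {φ : ℝ → ℝ} (hφ : Continuous φ) (hc : HasCompactSupport φ) :
    ∃ ψ : ℝ → ℝ, ContinuousOn ψ (Icc 0 1) ∧
      ∀ y, φ y = Real.exp (-y) * ψ (Real.exp (-y)) := by
  obtain ⟨R, hR⟩ := hc.isCompact.isBounded.subset_closedBall 0
  have hzero : ∀ y, R < y → φ y = 0 := by
    intro y hy
    by_contra hne
    have := hR (subset_tsupport _ hne)
    rw [mem_closedBall_zero_iff, Real.norm_eq_abs] at this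
    exact absurd (le_abs_self y) (by linarith)
  -- Near z = 0 the argument -log z has left the support of φ, so the division by z is harmless. The
  -- extracted factor z = e^{-y} means that only transforms at integers ≥ 1, never at 0, will be
  -- needed.
  refine ⟨fun z => if z ≤ 0 then 0 else φ (-Real.log z) / z, ?_, ?_⟩
  · intro z hz
    refine ContinuousAt.continuousWithinAt ?_
    rcases hz.1.eq_or_lt with rfl | hpos
    · have : (fun z => if z ≤ 0 then 0 else φ (-Real.log z) / z) =ᶠ[𝓝 0] fun _ => (0 : ℝ) := by
        filter_upwards [Iio_mem_nhds (Real.exp_pos (-R))] with z hz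
        by_cases h : z ≤ 0
        · simp [h]
        · push Not at h
          have : R < -Real.log z := by
            have := (Real.log_lt_iff_lt_exp h).2 hz
            linarith
          simp [hzero _ this]
      exact (continuousAt_const (y := (0 : ℝ))).congr this.symm
    · have : (fun z => if z ≤ 0 then 0 else φ (-Real.log z) / z) =ᶠ[𝓝 z]
          fun z => φ (-Real.log z) / z := by
        filter_upwards [Ioi_mem_nhds hpos] with w hw
        rw [if_neg (not_le.2 (mem_Ioi.1 hw))]
      refine ContinuousAt.congr ?_ this.symm
      exact (hφ.continuousAt.comp (Real.continuousAt_log hpos.ne').neg).div continuousAt_id hpos.ne'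
  · intro y
    have := Real.exp_pos (-y)
    simp only [not_le.2 this, if_false, Real.log_exp, neg_neg]
    field_simp

theorem integral_exp_mul_eval_eq {μ : Measure ℝ} [IsFiniteMeasure μ] (h : μ (Iio 0) = 0)
    (p : Polynomial ℝ) :
    Integrable (fun y => Real.exp (-y) * p.eval (Real.exp (-y))) μ ∧
    ∫ y, Real.exp (-y) * p.eval (Real.exp (-y)) ∂μ =
      ∑ i ∈ Finset.range (p.natDegree + 1), p.coeff i * (lap μ (i + 1)).toReal := by
  have key : ∀ y : ℝ, Real.exp (-y) * p.eval (Real.exp (-y)) =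
      ∑ i ∈ Finset.range (p.natDegree + 1), p.coeff i * Real.exp (-((i + 1 : ℝ) * y)) := by
    intro y
    rw [Polynomial.eval_eq_sum_range, Finset.mul_sum]
    refine Finset.sum_congr rfl fun i _ => ?_
    rw [← Real.exp_nat_mul]
    rw [mul_left_comm, ← Real.exp_add]
    congr 2; ring
  have hint : ∀ i ∈ Finset.range (p.natDegree + 1),
      Integrable (fun y : ℝ => p.coeff i * Real.exp (-((i + 1 : ℝ) * y))) μ := fun i _ =>
    (integrable_exp_of_Iio h (by positivity)).const_mul _
  simp_rw [key]
  refine ⟨integrable_finsetSum _ hint, ?_⟩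
  rw [integral_finsetSum _ hint]
  refine Finset.sum_congr rfl fun i _ => ?_
  rw [integral_const_mul, integral_exp_eq_lap]

theorem abs_integral_sub_le {μ : Measure ℝ} [IsFiniteMeasure μ] (h : μ (Iio 0) = 0) {C : ℝ}
    (hC : μ.real univ ≤ C) {φ ψ : ℝ → ℝ} (hφ : Integrable φ μ) (hψ : Integrable ψ μ) {η : ℝ}
    (hη : 0 ≤ η) (hle : ∀ y, 0 ≤ y → |φ y - ψ y| ≤ η) :
    |∫ y, φ y ∂μ - ∫ y, ψ y ∂μ| ≤ η * C := by
  rw [← integral_sub hφ hψ]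
  have hae : ∀ᵐ y ∂μ, ‖φ y - ψ y‖ ≤ η := by
    filter_upwards [ae_nonneg_of_Iio h] with y hy using hle y hy
  exact (norm_integral_le_of_norm_le_const hae).trans (by gcongr)

/-- Convergence of Laplace transforms at the positive integers implies vague convergence. -/
theorem tendsto_integral_of_tendsto_lap {Pm : ℕ → Measure ℝ} {P : Measure ℝ}
    [∀ m, IsFiniteMeasure (Pm m)] [IsFiniteMeasure P] (hPm : ∀ m, Pm m (Iio 0) = 0)
    (hP : P (Iio 0) = 0) {C : ℝ} (hCm : ∀ m, (Pm m).real univ ≤ C) (hC : P.real univ ≤ C)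
    (hlap : ∀ k : ℕ, Tendsto (fun m => lap (Pm m) (k + 1)) atTop (𝓝 (lap P (k + 1))))
    {φ : ℝ → ℝ} (hφ : Continuous φ) (hc : HasCompactSupport φ) :
    Tendsto (fun m => ∫ y, φ y ∂(Pm m)) atTop (𝓝 (∫ y, φ y ∂P)) := by
  obtain ⟨ψ, hψc, hψ⟩ := exists_continuousOn_exp_neg hφ hc
  have hC0 : 0 ≤ C := measureReal_nonneg.trans hC
  rw [Metric.tendsto_atTop]
  intro ε hε
  -- The polynomial approximation is made under both measures, costing η C ≤ ε/4 each time; the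
  -- remaining ε/2 is for the polynomial integrals.
  set η : ℝ := ε / (4 * (C + 1)) with hηdef
  have hη : 0 < η := by positivity
  obtain ⟨p, hp⟩ := exists_polynomial_near_of_continuousOn 0 1 ψ hψc η hη
  have happ : ∀ y, 0 ≤ y → |φ y - Real.exp (-y) * p.eval (Real.exp (-y))| ≤ η := by
    intro y hy
    have h1 : Real.exp (-y) ≤ 1 := Real.exp_le_one_iff.2 (by linarith)
    have h2 := hp (Real.exp (-y)) ⟨(Real.exp_pos _).le, h1⟩
    rw [hψ y, ← mul_sub, abs_mul, abs_of_pos (Real.exp_pos _), abs_sub_comm]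
    calc _ ≤ 1 * η := by gcongr
      _ = η := one_mul _
  have hlim : Tendsto (fun m => ∫ y, Real.exp (-y) * p.eval (Real.exp (-y)) ∂(Pm m)) atTop
      (𝓝 (∫ y, Real.exp (-y) * p.eval (Real.exp (-y)) ∂P)) := by
    simp_rw [(integral_exp_mul_eval_eq hP p).2, fun m => (integral_exp_mul_eval_eq (hPm m) p).2]
    refine tendsto_finsetSum _ fun i _ => Tendsto.const_mul _ ?_
    refine (ENNReal.tendsto_toReal ?_).comp (hlap i)
    exact ((lap_le_univ hP (by positivity)).trans_lt (measure_lt_top _ _)).ne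
  obtain ⟨M, hM⟩ := Metric.tendsto_atTop.1 hlim (ε / 2) (by positivity)
  refine ⟨M, fun m hm => ?_⟩
  have hb : η * C ≤ ε / 4 := by
    rw [hηdef, div_mul_eq_mul_div, div_le_div_iff₀ (by positivity) (by positivity)]
    nlinarith
  have e1 := abs_integral_sub_le (hPm m) (hCm m) (hφ.integrable_of_hasCompactSupport hc)
    (integral_exp_mul_eval_eq (hPm m) p).1 hη.le happ
  have e2 := abs_integral_sub_le hP hC (hφ.integrable_of_hasCompactSupport hc)
    (integral_exp_mul_eval_eq hP p).1 hη.le happ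
  have e3 := hM m hm
  rw [Real.dist_eq] at e3 ⊢
  rw [abs_le] at e1 e2
  rw [abs_lt] at e3 ⊢
  constructor <;> linarith [e1.1, e1.2, e2.1, e2.2, e3.1, e3.2]

/-- Portmanteau bound for vague convergence obtained from Laplace transforms. -/
theorem measure_isCompact_le_of_tendsto_lap {Pm : ℕ → Measure ℝ} {P : Measure ℝ}
    [∀ m, IsFiniteMeasure (Pm m)] [IsFiniteMeasure P] (hPm : ∀ m, Pm m (Iio 0) = 0)
    (hP : P (Iio 0) = 0) {C : ℝ} (hCm : ∀ m, (Pm m).real univ ≤ C) (hC : P.real univ ≤ C)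
    (hlap : ∀ k : ℕ, Tendsto (fun m => lap (Pm m) (k + 1)) atTop (𝓝 (lap P (k + 1))))
    {K U : Set ℝ} (hK : IsCompact K) (hU : IsOpen U) (hKU : K ⊆ U) {ε : ℝ}
    (hε : ∀ m, (Pm m).real U ≤ ε) : P.real K ≤ ε := by
  obtain ⟨φ, h1, h0, hcs, hI⟩ := exists_continuous_one_zero_of_isCompact hK hU.isClosed_compl
    (disjoint_compl_right_iff_subset.2 hKU)
  have hlim := tendsto_integral_of_tendsto_lap hPm hP hCm hC hlap φ.continuous hcs
  have hlow : P.real K ≤ ∫ y, φ y ∂P := by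
    rw [← integral_indicator_one hK.measurableSet]
    refine integral_mono ((integrable_const 1).indicator hK.measurableSet)
      (φ.continuous.integrable_of_hasCompactSupport hcs) fun y => ?_
    by_cases hy : y ∈ K
    · simp [hy, h1 hy]
    · simp [hy, (hI y).1]
  refine hlow.trans (le_of_tendsto hlim (Eventually.of_forall fun m => ?_))
  refine le_trans ?_ (hε m)
  rw [← integral_indicator_one hU.measurableSet]
  refine integral_mono (φ.continuous.integrable_of_hasCompactSupport hcs)
    ((integrable_const 1).indicator hU.measurableSet) fun y => ?_
  by_cases hy : y ∈ U
  · simp [hy, (hI y).2]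
  · simp [hy, h0 hy]

/-- Vague convergence applied to the constant sequence μ: the limit of a constant is unique. -/
theorem ext_of_lap_of_isFiniteMeasure {μ ν : Measure ℝ} [IsFiniteMeasure μ] [IsFiniteMeasure ν]
    (hμ : μ (Iio 0) = 0) (hν : ν (Iio 0) = 0) (h : ∀ k : ℕ, lap μ (k + 1) = lap ν (k + 1)) :
    μ = ν := by
  refine Measure.ext_of_integral_eq_on_compactlySupported fun φ => ?_
  have := tendsto_integral_of_tendsto_lap (Pm := fun _ => μ) (P := ν) (fun _ => hμ) hν
    (C := max (μ.real univ) (ν.real univ)) (fun _ => le_max_left _ _) (le_max_right _ _)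
    (fun k => by rw [h k]; exact tendsto_const_nhds) φ.continuous φ.hasCompactSupport
  exact tendsto_nhds_unique tendsto_const_nhds this

/-- Measures on the half line are determined by their Laplace transforms. -/
theorem ext_of_lap {μ ν : Measure ℝ} (hμ : μ (Iio 0) = 0) (hν : ν (Iio 0) = 0)
    (hfin : ∀ s, 0 < s → lap μ s ≠ ∞) (h : ∀ s, 0 < s → lap μ s = lap ν s) : μ = ν := by
  -- The weight e^{-y} makes both measures finite and shifts the transform by 1; being positive and
  -- finite, it can be divided out again.
  set e : ℝ → ℝ≥0∞ := fun y => ENNReal.ofReal (Real.exp (-(1 * y))) with he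
  have hem : Measurable e := by fun_prop
  have hfinite : ∀ ρ : Measure ℝ, lap ρ 1 ≠ ∞ → IsFiniteMeasure (ρ.withDensity e) := fun ρ hρ =>
    ⟨by rw [withDensity_apply _ MeasurableSet.univ, Measure.restrict_univ]; exact hρ.lt_top⟩
  have := hfinite μ (hfin 1 one_pos)
  have := hfinite ν (by rw [← h 1 one_pos]; exact hfin 1 one_pos)
  have hlap : ∀ (ρ : Measure ℝ) (s : ℝ), lap (ρ.withDensity e) s = lap ρ (s + 1) := by
    intro ρ s
    rw [lap, lintegral_withDensity_eq_lintegral_mul _ hem (by fun_prop), lap]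
    refine lintegral_congr fun y => ?_
    rw [Pi.mul_apply, he, ← ENNReal.ofReal_mul (Real.exp_pos _).le, ← Real.exp_add]
    congr 2; ring
  have key : μ.withDensity e = ν.withDensity e :=
    ext_of_lap_of_isFiniteMeasure (withDensity_absolutelyContinuous _ _ hμ)
      (withDensity_absolutelyContinuous _ _ hν)
      fun k => by rw [hlap, hlap, h _ (by positivity)]
  have hne0 : ∀ ρ : Measure ℝ, ∀ᵐ y ∂ρ, e y ≠ 0 := fun ρ => ae_of_all _ fun y => by
    simp [he, Real.exp_pos]
  have hnet : ∀ ρ : Measure ℝ, ∀ᵐ y ∂ρ, e y ≠ ∞ := fun ρ => ae_of_all _ fun y =>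
    ENNReal.ofReal_ne_top
  rw [← withDensity_inv_same hem (hne0 μ) (hnet μ), key, withDensity_inv_same hem (hne0 ν) (hnet ν)]

/-! ### Convolution exponentials, the unnormalised compound Poisson laws. -/

section ExpMeasure

theorem lap_zero (μ : Measure ℝ) : lap μ 0 = μ univ := by simp [lap]

theorem lap_add (μ ν : Measure ℝ) (s : ℝ) : lap (μ + ν) s = lap μ s + lap ν s :=
  lintegral_add_measure _ _ _

theorem lap_smul (c : ℝ≥0∞) (μ : Measure ℝ) (s : ℝ) : lap (c • μ) s = c * lap μ s := by
  rw [lap, lintegral_smul_measure]; rfl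

theorem lap_dirac (x s : ℝ) : lap (Measure.dirac x) s = ENNReal.ofReal (Real.exp (-(s * x))) := by
  rw [lap, lintegral_dirac]

theorem lap_conv (μ ν : Measure ℝ) [SFinite ν] (s : ℝ) :
    lap (μ ∗ ν) s = lap μ s * lap ν s := by
  rw [lap, Measure.lintegral_conv (by fun_prop)]
  have : ∀ x, ∫⁻ y, ENNReal.ofReal (Real.exp (-(s * (x + y)))) ∂ν =
      ENNReal.ofReal (Real.exp (-(s * x))) * lap ν s := by
    intro x
    rw [lap, ← lintegral_const_mul _ (by fun_prop)]
    refine lintegral_congr fun y => ?_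
    rw [← ENNReal.ofReal_mul (Real.exp_pos _).le, ← Real.exp_add]
    congr 2; ring
  simp_rw [this]
  rw [lintegral_mul_const _ (by fun_prop), lap, lap]

theorem conv_Iio {μ ν : Measure ℝ} [SFinite ν] (hμ : μ (Iio 0) = 0) (hν : ν (Iio 0) = 0) :
    (μ ∗ ν) (Iio 0) = 0 := by
  rw [← lintegral_indicator_one measurableSet_Iio,
    Measure.lintegral_conv (measurable_one.indicator measurableSet_Iio)]
  refine (lintegral_congr_ae (g := fun _ => 0) ?_).trans lintegral_zero
  filter_upwards [ae_nonneg_of_Iio hμ] with x hx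
  refine (lintegral_congr_ae (g := fun _ => 0) ?_).trans lintegral_zero
  filter_upwards [ae_nonneg_of_Iio hν] with y hy
  simp [hx, hy, add_nonneg]

/-- Convolution powers of a measure. -/
def convPow (ν : Measure ℝ) : ℕ → Measure ℝ
  | 0 => Measure.dirac 0
  | k + 1 => convPow ν k ∗ ν

theorem lap_convPow (ν : Measure ℝ) [SFinite ν] (k : ℕ) (s : ℝ) :
    lap (convPow ν k) s = lap ν s ^ k := by
  induction k with
  | zero => simp [convPow, lap_dirac]
  | succ k ih => rw [convPow, lap_conv, ih, pow_succ]

theorem convPow_Iio {ν : Measure ℝ} [SFinite ν] (hν : ν (Iio 0) = 0) (k : ℕ) :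
    convPow ν k (Iio 0) = 0 := by
  induction k with
  | zero => simp [convPow]
  | succ k ih => exact conv_Iio ih hν

/-- The convolution exponential `∑ ν^{*k} / k!`. -/
def expMeasure (ν : Measure ℝ) : Measure ℝ :=
  Measure.sum fun k => ENNReal.ofReal ((k.factorial : ℝ)⁻¹) • convPow ν k

/-- The convolution exponential without its atom at the origin. -/
def expMeasureTail (ν : Measure ℝ) : Measure ℝ :=
  Measure.sum fun k => ENNReal.ofReal (((k + 1).factorial : ℝ)⁻¹) • convPow ν (k + 1)

theorem lap_expMeasure {ν : Measure ℝ} [SFinite ν] {s L : ℝ} (hL : 0 ≤ L)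
    (h : lap ν s = ENNReal.ofReal L) :
    lap (expMeasure ν) s = ENNReal.ofReal (Real.exp L) := by
  have hs : HasSum (fun k : ℕ => (k.factorial : ℝ)⁻¹ * L ^ k) (Real.exp L) := by
    have := NormedSpace.expSeries_div_hasSum_exp L
    rw [← Real.exp_eq_exp_ℝ] at this
    simpa [div_eq_inv_mul] using this
  rw [lap, expMeasure, lintegral_sum_measure, ← hs.tsum_eq,
    ENNReal.ofReal_tsum_of_nonneg (fun k => by positivity) hs.summable]
  refine tsum_congr fun k => ?_
  change lap _ s = _
  rw [lap_smul, lap_convPow, h, ENNReal.ofReal_mul (by positivity), ENNReal.ofReal_pow hL]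

theorem expMeasure_apply (ν : Measure ℝ) (A : Set ℝ) (hA : MeasurableSet A) :
    expMeasure ν A = Measure.dirac 0 A + expMeasureTail ν A := by
  rw [expMeasure, expMeasureTail, Measure.sum_apply _ hA, Measure.sum_apply _ hA,
    tsum_eq_zero_add' ENNReal.summable]
  simp [convPow]

theorem isFiniteMeasure_expMeasure (ν : Measure ℝ) [IsFiniteMeasure ν] :
    IsFiniteMeasure (expMeasure ν) := by
  constructor
  rw [← lap_zero, lap_expMeasure (L := (ν univ).toReal) ENNReal.toReal_nonneg]
  · exact ENNReal.ofReal_lt_top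
  · rw [lap_zero, ENNReal.ofReal_toReal (measure_ne_top _ _)]

theorem expMeasure_Iio {ν : Measure ℝ} [SFinite ν] (hν : ν (Iio 0) = 0) :
    expMeasure ν (Iio 0) = 0 := by
  rw [expMeasure, Measure.sum_apply _ measurableSet_Iio]
  simp [convPow_Iio hν]

theorem expMeasureTail_absolutelyContinuous {ν : Measure ℝ} [SFinite ν] (h : ν ≪ volume) :
    expMeasureTail ν ≪ volume := by
  refine Measure.absolutelyContinuous_sum_left fun k => ?_
  exact (Measure.conv_absolutelyContinuous h).smul_left _

/-- Away from its unit atom at 0, `expMeasure ν` is finite and absolutely continuous, so a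
neighbourhood of K of small enough Lebesgue measure gets mass at most 1 from it. By translation
invariance the same holds for all translates, hence after convolution with any R: one `R univ` pays
for the atom, the other for the rest. That U does not depend on R is what allows a limit later. -/
theorem exists_isOpen_conv_expMeasure_le {ν : Measure ℝ} [IsFiniteMeasure ν] (h : ν ≪ volume)
    {K : Set ℝ} (hK : volume K = 0) :
    ∃ U, IsOpen U ∧ K ⊆ U ∧ ∀ R : Measure ℝ, (R ∗ expMeasure ν) U ≤ 2 * R univ := by
  have := isFiniteMeasure_expMeasure ν
  have hfin : expMeasureTail ν univ ≠ ∞ := by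
    have h1 := expMeasure_apply ν univ MeasurableSet.univ
    intro h2
    rw [h2, add_top] at h1
    exact measure_ne_top _ _ h1
  have : IsFiniteMeasure (expMeasureTail ν) := ⟨hfin.lt_top⟩
  have hac := expMeasureTail_absolutelyContinuous h
  obtain ⟨δ, hδ, hlt⟩ := exists_pos_setLIntegral_lt_of_measure_lt
    (μ := volume) (f := (expMeasureTail ν).rnDeriv volume)
    (Measure.lintegral_rnDeriv_lt_top _ _).ne one_ne_zero
  obtain ⟨U, hKU, hU, hUδ⟩ := K.exists_isOpen_lt_of_lt (μ := volume) δ (by rwa [hK])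
  refine ⟨U, hU, hKU, fun R => ?_⟩
  rw [← lintegral_indicator_one hU.measurableSet,
    Measure.lintegral_conv (measurable_one.indicator hU.measurableSet), ← lintegral_const]
  refine lintegral_mono fun x => ?_
  have hm : MeasurableSet ((fun y => x + y) ⁻¹' U) := (measurable_const_add x) hU.measurableSet
  have e : ∫⁻ y, U.indicator 1 (x + y) ∂(expMeasure ν) =
      expMeasure ν ((fun y => x + y) ⁻¹' U) := by
    rw [← lintegral_indicator_one hm]; rfl
  rw [e, expMeasure_apply _ _ hm, ← one_add_one_eq_two]
  refine add_le_add prob_le_one ?_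
  rw [← Measure.setLIntegral_rnDeriv hac]
  exact (hlt _ (by rwa [measure_preimage_add])).le

end ExpMeasure

/-! ### The Lévy measure and its tail. -/

namespace BernsteinTriplet

variable (f : BernsteinTriplet)

theorem levy_Ioi_lt_top {s : ℝ} (hs : 0 < s) : f.levy (Ioi s) < ∞ := by
  have hm : 0 < min s 1 := lt_min hs one_pos
  have h1 : ENNReal.ofReal (min s 1) * f.levy (Ioi s) ≤
      ∫⁻ s, ENNReal.ofReal (min s 1) ∂f.levy := by
    refine le_trans ?_ (mul_meas_ge_le_lintegral (by fun_prop) (ENNReal.ofReal (min s 1)))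
    gcongr
    intro y hy
    exact ENNReal.ofReal_le_ofReal (min_le_min_right _ (le_of_lt hy))
  have h2 := h1.trans_lt f.lintegral_min_lt_top
  by_contra hne
  rw [not_lt, top_le_iff] at hne
  rw [hne, ENNReal.mul_top (by simpa using hm)] at h2
  exact lt_irrefl _ h2

theorem ae_levy_pos : ∀ᵐ s ∂f.levy, 0 < s := by
  rw [ae_iff]; simpa [Iic] using f.levy_Iic

instance sigmaFinite_levy : SigmaFinite f.levy := by
  refine Measure.sigmaFinite_of_countable
    (S := insert (Iic 0) (range fun n : ℕ => Ioi (1 / ((n : ℝ) + 1))))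
    ((countable_range _).insert _) ?_ ?_
  · rintro s (rfl | ⟨n, rfl⟩)
    · rw [f.levy_Iic]; exact ENNReal.zero_lt_top
    · exact f.levy_Ioi_lt_top (by positivity)
  · refine eq_univ_of_forall fun x => ?_
    rcases le_or_gt x 0 with hx | hx
    · exact ⟨Iic 0, mem_insert _ _, hx⟩
    · obtain ⟨n, hn⟩ := exists_nat_one_div_lt hx
      exact ⟨_, mem_insert_of_mem _ ⟨n, rfl⟩, hn⟩

theorem tail_nonneg (s : ℝ) : 0 ≤ f.tail s := add_nonneg f.a_nonneg ENNReal.toReal_nonneg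

theorem tail_anti {s t : ℝ} (hs : 0 < s) (hst : s ≤ t) : f.tail t ≤ f.tail s := by
  unfold tail
  gcongr
  exact (f.levy_Ioi_lt_top hs).ne

theorem measurable_tail : Measurable f.tail := by
  have : Antitone fun s : ℝ => f.levy (Ioi s) := fun s t h => measure_mono (Ioi_subset_Ioi h)
  exact measurable_const.add this.measurable.ennreal_toReal

theorem levy_Ioc {c d : ℝ} (hc : 0 < c) (hcd : c ≤ d) :
    f.levy (Ioc c d) = ENNReal.ofReal (f.tail c - f.tail d) := by
  have h1 : f.levy (Ioi c) = f.levy (Ioc c d) + f.levy (Ioi d) := by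
    rw [← measure_union (by
      rw [Set.disjoint_left]; exact fun x hx hx' => not_lt.2 hx.2 hx') measurableSet_Ioi,
      Ioc_union_Ioi_eq_Ioi hcd]
  have hf : f.levy (Ioc c d) ≠ ∞ :=
    ((measure_mono Ioc_subset_Ioi_self).trans_lt (f.levy_Ioi_lt_top hc)).ne
  have h2 : f.tail c - f.tail d = (f.levy (Ioc c d)).toReal := by
    unfold tail
    rw [h1, ENNReal.toReal_add hf (f.levy_Ioi_lt_top (hc.trans_le hcd)).ne]
    ring
  rw [h2, ENNReal.ofReal_toReal hf]

variable {f}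

theorem ConditionI.continuousOn_tail (hf : f.ConditionI) : ContinuousOn f.tail (Ioi 0) := by
  intro x hx
  rw [mem_Ioi] at hx
  have h := (hf.2 (x / 2) (2 * x) (by positivity) (by linarith)).continuousOn
  rw [uIcc_of_le (by linarith)] at h
  exact (h.continuousAt (Icc_mem_nhds (by linarith) (by linarith))).continuousWithinAt

/-- On half-open intervals the Lévy measure is the drop of the tail, which is the integral of -tail'
by the fundamental theorem for absolutely continuous functions. Such intervals determine a finite
measure, so -tail' is a density. -/
theorem ConditionI.levy_restrict_absolutelyContinuous (hf : f.ConditionI) {x y : ℝ} (hx : 0 < x)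
    (hxy : x ≤ y) : f.levy.restrict (Ioc x y) ≪ volume := by
  have hac := hf.2 x y hx hxy
  have hII := hac.intervalIntegrable_deriv
  rw [intervalIntegrable_iff_integrableOn_Ioc_of_le hxy] at hII
  set D : ℝ → ℝ≥0∞ := fun z => ENNReal.ofReal (-deriv f.tail z) with hD
  have hDfin : ∫⁻ z in Ioc x y, D z ≠ ∞ := hII.neg.lintegral_lt_top.ne
  have : IsFiniteMeasure ((volume.restrict (Ioc x y)).withDensity D) :=
    isFiniteMeasure_withDensity hDfin
  have : IsFiniteMeasure (f.levy.restrict (Ioc x y)) := ⟨by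
    rw [Measure.restrict_apply_univ]
    exact (measure_mono Ioc_subset_Ioi_self).trans_lt (f.levy_Ioi_lt_top hx)⟩
  have key : f.levy.restrict (Ioc x y) = (volume.restrict (Ioc x y)).withDensity D := by
    refine Measure.ext_of_Ioc _ _ fun a b hab => ?_
    rw [Measure.restrict_apply measurableSet_Ioc, withDensity_apply _ measurableSet_Ioc,
      Measure.restrict_restrict measurableSet_Ioc, Ioc_inter_Ioc]
    rcases le_or_gt (max a x) (min b y) with h | h
    · have hc : 0 < max a x := lt_max_of_lt_right hx
      rw [f.levy_Ioc hc h]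
      have hsub : uIcc (max a x) (min b y) ⊆ uIcc x y := by
        rw [uIcc_of_le h, uIcc_of_le hxy]
        exact Icc_subset_Icc (le_max_right _ _) (min_le_right _ _)
      have hac' := hac.mono hsub
      have hI := hac'.intervalIntegrable_deriv
      rw [intervalIntegrable_iff_integrableOn_Ioc_of_le h] at hI
      refine Eq.trans ?_ (ofReal_integral_eq_lintegral_ofReal hI.neg ?_)
      · congr 1
        rw [← intervalIntegral.integral_of_le h, intervalIntegral.integral_neg,
          hac'.integral_deriv_eq_sub]
        ring
      · filter_upwards [ae_restrict_mem measurableSet_Ioc] with z hz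
        have hz0 : z ∈ Ioi (0 : ℝ) := hc.trans hz.1
        have hanti : AntitoneOn f.tail (Ioi 0) := fun s hs t _ hst => f.tail_anti hs hst
        have := hanti.derivWithin_nonpos (x := z)
        rw [derivWithin_of_isOpen isOpen_Ioi hz0] at this
        simpa using this
    · rw [Ioc_eq_empty (not_lt.2 h.le)]; simp
  rw [key]
  exact (withDensity_absolutelyContinuous _ _).trans Measure.restrict_le_self.absolutelyContinuous

theorem ConditionI.levy_absolutelyContinuous (hf : f.ConditionI) : f.levy ≪ volume := by
  have hcover : (univ : Set ℝ) ⊆ Iic 0 ∪ ⋃ n : ℕ, Ioc (1 / ((n : ℝ) + 1)) ((n : ℝ) + 1) := by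
    intro x _
    rcases le_or_gt x 0 with hx | hx
    · exact Or.inl hx
    · right
      obtain ⟨n, hn⟩ := exists_nat_one_div_lt hx
      obtain ⟨m, hm⟩ := exists_nat_ge x
      refine mem_iUnion.2 ⟨max n m, lt_of_le_of_lt ?_ hn, hm.trans ?_⟩
      · gcongr; exact_mod_cast le_max_left n m
      · have : (m : ℝ) ≤ (max n m : ℕ) := by exact_mod_cast le_max_right n m
        linarith
  refine Measure.AbsolutelyContinuous.mk fun A hA hA0 => ?_
  refine measure_mono_null (t := Iic 0 ∪ ⋃ n : ℕ, A ∩ Ioc (1 / ((n : ℝ) + 1)) ((n : ℝ) + 1))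
    (fun x hx => ?_) (measure_union_null f.levy_Iic (measure_iUnion_null fun n => ?_))
  · rcases hcover (mem_univ x) with h | h
    · exact Or.inl h
    · rw [← inter_iUnion]; exact Or.inr ⟨hx, h⟩
  · rw [← Measure.restrict_apply hA]
    refine hf.levy_restrict_absolutelyContinuous (by positivity) ?_ hA0
    rw [div_le_iff₀ (by positivity)]
    have : (0 : ℝ) ≤ n := by positivity
    nlinarith

variable (f)

theorem one_sub_exp_le {s y : ℝ} (hy : 0 ≤ y) :
    1 - Real.exp (-(s * y)) ≤ max s 1 * min y 1 := by
  have h1 : 1 - Real.exp (-(s * y)) ≤ s * y := by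
    have := Real.add_one_le_exp (-(s * y)); linarith
  have h2 : 1 - Real.exp (-(s * y)) ≤ 1 := by linarith [Real.exp_pos (-(s * y))]
  rcases le_total y 1 with h | h
  · rw [min_eq_left h]; exact h1.trans (by gcongr; exact le_max_left _ _)
  · rw [min_eq_right h, mul_one]; exact h2.trans (le_max_right _ _)

theorem one_sub_exp_nonneg {s y : ℝ} (hs : 0 ≤ s) (hy : 0 ≤ y) :
    0 ≤ 1 - Real.exp (-(s * y)) := by
  have := Real.exp_le_one_iff.2 (neg_nonpos.2 (mul_nonneg hs hy)); linarith

theorem integrable_min : Integrable (fun y => min y 1) f.levy := by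
  refine ⟨by fun_prop, ?_⟩
  rw [hasFiniteIntegral_iff_ofReal]
  · exact f.lintegral_min_lt_top
  · filter_upwards [f.ae_levy_pos] with y hy using (lt_min hy one_pos).le

theorem integrable_one_sub_exp {s : ℝ} (hs : 0 ≤ s) :
    Integrable (fun y => 1 - Real.exp (-(s * y))) f.levy := by
  refine (f.integrable_min.const_mul (max s 1)).mono' (by fun_prop) ?_
  filter_upwards [f.ae_levy_pos] with y hy
  rw [Real.norm_eq_abs, abs_of_nonneg (one_sub_exp_nonneg hs hy.le)]
  exact one_sub_exp_le hy.le

theorem fn_eq (s : ℝ) : f.fn s = f.a + f.b * s + ∫ y, (1 - Real.exp (-(s * y))) ∂f.levy := by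
  unfold fn
  congr 1
  rw [Measure.restrict_eq_self_of_ae_mem]
  exact f.ae_levy_pos

variable {f}

theorem ConditionI.fn_pos (hf : f.ConditionI) {s : ℝ} (hs : 0 < s) : 0 < f.fn s := by
  rw [f.fn_eq]
  refine add_pos_of_nonneg_of_pos (add_nonneg f.a_nonneg (mul_nonneg f.b_nonneg hs.le)) ?_
  rw [integral_pos_iff_support_of_nonneg_ae ?_ (f.integrable_one_sub_exp hs.le)]
  · have : f.levy (Ioi 0) ≤ f.levy (Function.support fun y => 1 - Real.exp (-(s * y))) := by
      refine measure_mono fun y hy => ?_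
      have : Real.exp (-(s * y)) < 1 := Real.exp_lt_one_iff.2 (neg_neg_of_pos (mul_pos hs hy))
      exact (sub_pos.2 this).ne'
    rw [hf.1] at this
    exact lt_of_lt_of_le ENNReal.zero_lt_top this
  · filter_upwards [f.ae_levy_pos] with y hy using one_sub_exp_nonneg hs.le hy.le

theorem lintegral_exp_Ioi {s : ℝ} (hs : 0 < s) (c : ℝ) :
    ∫⁻ y in Ioi c, ENNReal.ofReal (Real.exp (-(s * y))) =
      ENNReal.ofReal (Real.exp (-(s * c)) / s) := by
  have h := integral_exp_mul_Ioi (neg_neg_of_pos hs) c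
  have hi := integrableOn_exp_mul_Ioi (neg_neg_of_pos hs) c
  simp_rw [neg_mul] at h hi
  rw [← ofReal_integral_eq_lintegral_ofReal hi (ae_of_all _ fun y => (Real.exp_pos _).le), h]
  congr 1
  ring

variable (f)

/-- The Laplace transform of the tail. -/
theorem lintegral_exp_mul_tail {s : ℝ} (hs : 0 < s) :
    ENNReal.ofReal f.b + ∫⁻ y in Ioi 0, ENNReal.ofReal (Real.exp (-(s * y))) *
      ENNReal.ofReal (f.tail y) = ENNReal.ofReal (f.fn s / s) := by
  have h0 : ∀ y ∈ Ioi (0 : ℝ), ENNReal.ofReal (Real.exp (-(s * y))) * ENNReal.ofReal (f.tail y) =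
      ENNReal.ofReal (Real.exp (-(s * y))) * ENNReal.ofReal f.a +
      ∫⁻ z, (Ioi y).indicator (fun _ => ENNReal.ofReal (Real.exp (-(s * y)))) z ∂f.levy := by
    intro y hy
    rw [lintegral_indicator measurableSet_Ioi, setLIntegral_const, ← mul_add, tail,
      ENNReal.ofReal_add f.a_nonneg ENNReal.toReal_nonneg,
      ENNReal.ofReal_toReal (f.levy_Ioi_lt_top hy).ne]
  have hjm : Measurable (Function.uncurry fun (y z : ℝ) =>
      (Ioi y).indicator (fun _ => ENNReal.ofReal (Real.exp (-(s * y)))) z) := by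
    have : (Function.uncurry fun (y z : ℝ) =>
      (Ioi y).indicator (fun _ => ENNReal.ofReal (Real.exp (-(s * y)))) z) =
      {p : ℝ × ℝ | p.1 < p.2}.indicator (fun p => ENNReal.ofReal (Real.exp (-(s * p.1)))) := by
      ext ⟨y, z⟩; simp [indicator]
    rw [this]
    exact Measurable.indicator (by fun_prop) (measurableSet_lt measurable_fst measurable_snd)
  -- Tonelli, with ∫_0^z e^{-sy} dy = (1 - e^{-sz})/s for each jump size z.
  have h1 : ∫⁻ y in Ioi 0,
      ∫⁻ z, (Ioi y).indicator (fun _ => ENNReal.ofReal (Real.exp (-(s * y)))) z ∂f.levy =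
      ENNReal.ofReal ((∫ y, (1 - Real.exp (-(s * y))) ∂f.levy) / s) := by
    rw [lintegral_lintegral_swap hjm.aemeasurable, ← integral_div,
      ofReal_integral_eq_lintegral_ofReal ((f.integrable_one_sub_exp hs.le).div_const s)]
    · refine lintegral_congr_ae ?_
      filter_upwards [f.ae_levy_pos] with z hz
      have e1 : ∀ y, (Ioi y).indicator (fun _ => ENNReal.ofReal (Real.exp (-(s * y)))) z =
          (Iio z).indicator (fun y => ENNReal.ofReal (Real.exp (-(s * y)))) y := by
        intro y; simp [indicator]
      simp_rw [e1]
      rw [lintegral_indicator measurableSet_Iio, Measure.restrict_restrict measurableSet_Iio]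
      have e2 : Iio z ∩ Ioi 0 = Ioo 0 z := by ext; simp [and_comm]
      rw [e2, ← ofReal_integral_eq_lintegral_ofReal]
      · congr 1
        rw [← integral_Ioc_eq_integral_Ioo, ← intervalIntegral.integral_of_le hz.le]
        have h3 : ∀ y ∈ uIcc 0 z, HasDerivAt (fun y => -Real.exp (-(s * y)) / s)
            (Real.exp (-(s * y))) y := by
          intro y _
          have := (((hasDerivAt_id' y).const_mul s).fun_neg.exp.fun_neg).div_const s
          refine this.congr_deriv ?_
          field_simp
        rw [intervalIntegral.integral_eq_sub_of_hasDerivAt h3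
          (Continuous.intervalIntegrable (by fun_prop) _ _)]
        simp; ring
      · exact (Continuous.integrableOn_Icc (by fun_prop)).mono_set Ioo_subset_Icc_self
      · exact ae_of_all _ fun y => (Real.exp_pos _).le
    · filter_upwards [f.ae_levy_pos] with y hy
      exact div_nonneg (one_sub_exp_nonneg hs.le hy.le) hs.le
  rw [setLIntegral_congr_fun measurableSet_Ioi h0, lintegral_add_left (by fun_prop), h1,
    lintegral_mul_const _ (by fun_prop), lintegral_exp_Ioi hs,
    ← ENNReal.ofReal_mul (by positivity), ← ENNReal.ofReal_add, ← ENNReal.ofReal_add]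
  · congr 1
    rw [f.fn_eq]
    simp
    field_simp
    ring
  · exact f.b_nonneg
  · have := f.a_nonneg
    refine add_nonneg (by positivity) (div_nonneg (integral_nonneg_of_ae ?_) hs.le)
    filter_upwards [f.ae_levy_pos] with y hy using one_sub_exp_nonneg hs.le hy.le
  · have := f.a_nonneg
    positivity
  · refine div_nonneg (integral_nonneg_of_ae ?_) hs.le
    filter_upwards [f.ae_levy_pos] with y hy using one_sub_exp_nonneg hs.le hy.le

end BernsteinTriplet

/-! ### Absolute continuity of the laws of the subordinator. -/

section Regularity

variable {f : BernsteinTriplet}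

/-- The exponent of the compound Poisson law with jumps in A, run for time x. The second half
supplies the sign required by `lap_expMeasure`. -/
theorem lap_smul_restrict_levy (f : BernsteinTriplet) {x s : ℝ} (hx : 0 ≤ x) (hs : 0 ≤ s)
    {A : Set ℝ} (hA : f.levy A < ∞) :
    lap (ENNReal.ofReal x • f.levy.restrict A) s =
      ENNReal.ofReal (x * (f.levy.real A - ∫ y in A, (1 - Real.exp (-(s * y))) ∂f.levy)) ∧
    0 ≤ f.levy.real A - ∫ y in A, (1 - Real.exp (-(s * y))) ∂f.levy := by
  have : IsFiniteMeasure (f.levy.restrict A) := ⟨by rwa [Measure.restrict_apply_univ]⟩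
  have h0 : f.levy.restrict A (Iio 0) = 0 :=
    measure_mono_null Iio_subset_Iic_self (Measure.absolutelyContinuous_of_le
      Measure.restrict_le_self f.levy_Iic)
  have hi := integrable_exp_of_Iio h0 hs
  have e : f.levy.real A - ∫ y in A, (1 - Real.exp (-(s * y))) ∂f.levy =
      (lap (f.levy.restrict A) s).toReal := by
    rw [integral_sub (integrable_const _) hi, integral_exp_eq_lap]
    simp
  rw [e, lap_smul]
  refine ⟨?_, ENNReal.toReal_nonneg⟩
  rw [ENNReal.ofReal_mul hx, ENNReal.ofReal_toReal]
  exact ((lap_le_univ h0 hs).trans_lt (measure_lt_top _ _)).ne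

theorem BernsteinTriplet.levy_Ioc_lt_top (f : BernsteinTriplet) {c d : ℝ} (hc : 0 < c) :
    f.levy (Ioc c d) < ∞ :=
  (measure_mono Ioc_subset_Ioi_self).trans_lt (f.levy_Ioi_lt_top hc)

/-- The truncated Laplace exponents converge. -/
theorem tendsto_truncated_exponent (f : BernsteinTriplet) {s δ : ℝ} (hs : 0 < s) (hδ : 0 < δ) :
    Tendsto (fun m : ℕ => f.a + f.b * s +
      ((∫ y in Ioc (1 / ((m : ℝ) + 1)) δ, (1 - Real.exp (-(s * y))) ∂f.levy) +
        ∫ y in Ioi δ, (1 - Real.exp (-(s * y))) ∂f.levy)) atTop (𝓝 (f.fn s)) := by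
  have hi := f.integrable_one_sub_exp hs.le
  have hU : (⋃ m : ℕ, Ioc (1 / ((m : ℝ) + 1)) δ) = Ioc 0 δ := by
    ext y
    simp only [mem_iUnion, mem_Ioc]
    constructor
    · rintro ⟨m, h1, h2⟩
      exact ⟨lt_trans (by positivity) h1, h2⟩
    · rintro ⟨h1, h2⟩
      obtain ⟨m, hm⟩ := exists_nat_one_div_lt h1
      exact ⟨m, hm, h2⟩
  have hmono : Monotone fun m : ℕ => Ioc (1 / ((m : ℝ) + 1)) δ := by
    intro m n hmn
    refine Ioc_subset_Ioc_left ?_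
    have : (m : ℝ) ≤ n := by exact_mod_cast hmn
    gcongr
  have h1 := tendsto_setIntegral_of_monotone (μ := f.levy)
    (f := fun y => 1 - Real.exp (-(s * y))) (fun m : ℕ => measurableSet_Ioc) hmono
    (by rw [hU]; exact hi.integrableOn)
  rw [hU] at h1
  have e : f.fn s = f.a + f.b * s + ((∫ y in Ioc 0 δ, (1 - Real.exp (-(s * y))) ∂f.levy) +
        ∫ y in Ioi δ, (1 - Real.exp (-(s * y))) ∂f.levy) := by
    rw [BernsteinTriplet.fn, ← setIntegral_union (by
      rw [Set.disjoint_left]; exact fun x hx hx' => not_lt.2 hx.2 hx') measurableSet_Ioi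
      hi.integrableOn hi.integrableOn, Ioc_union_Ioi_eq_Ioi hδ.le]
  rw [e]
  exact (h1.add_const _).const_add _

/-- P is the vague limit of `R m ∗ expMeasure ν`, where ν carries the jumps larger than δ and `R m`
carries the drift, the killing, the jumps in (1/(m+1), δ] and the normalisation of the large jumps.
The mass of `R m` is at most the probability of no jump larger than δ, and
`exists_isOpen_conv_expMeasure_le` bounds a neighbourhood of K by twice that, uniformly in m. The
bound tends to 0 with δ because the Lévy measure is infinite. -/
theorem measureReal_isCompact_le_of_lap (hf : f.ConditionI) {x : ℝ} (hx : 0 < x) {P : Measure ℝ}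
    (hP : P (Iio 0) = 0) (hP1 : P univ ≤ 1)
    (hlap : ∀ s, 0 < s → lap P s = ENNReal.ofReal (Real.exp (-(x * f.fn s))))
    {K : Set ℝ} (hK : IsCompact K) (hK0 : volume K = 0) {δ : ℝ} (hδ : 0 < δ) :
    P.real K ≤ 2 * Real.exp (-(x * f.levy.real (Ioi δ))) := by
  have : IsFiniteMeasure P := ⟨hP1.trans_lt ENNReal.one_lt_top⟩
  have hIio : ∀ A, (ENNReal.ofReal x • f.levy.restrict A) (Iio 0) = 0 := fun A => by
    rw [Measure.smul_apply, measure_mono_null Iio_subset_Iic_self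
      (Measure.absolutelyContinuous_of_le Measure.restrict_le_self f.levy_Iic), smul_zero]
  have hfinA : ∀ A, f.levy A < ∞ → IsFiniteMeasure (ENNReal.ofReal x • f.levy.restrict A) :=
    fun A hA => ⟨by
      rw [Measure.smul_apply, Measure.restrict_apply_univ, smul_eq_mul]
      exact ENNReal.mul_lt_top ENNReal.ofReal_lt_top hA⟩
  set ν : Measure ℝ := ENNReal.ofReal x • f.levy.restrict (Ioi δ) with hν
  set ρ : ℕ → Measure ℝ := fun m =>
    ENNReal.ofReal x • f.levy.restrict (Ioc (1 / ((m : ℝ) + 1)) δ) with hρ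
  have hνf : IsFiniteMeasure ν := hfinA _ (f.levy_Ioi_lt_top hδ)
  have hρf : ∀ m, IsFiniteMeasure (ρ m) := fun m => hfinA _ (f.levy_Ioc_lt_top (by positivity))
  have := isFiniteMeasure_expMeasure ν
  have := fun m => isFiniteMeasure_expMeasure (ρ m)
  set c : ℝ := f.levy.real (Ioi δ) with hc
  set d : ℕ → ℝ := fun m => f.levy.real (Ioc (1 / ((m : ℝ) + 1)) δ) with hd
  set R : ℕ → Measure ℝ := fun m => ENNReal.ofReal (Real.exp (-(x * (f.a + c + d m)))) •
    (Measure.dirac (f.b * x) ∗ expMeasure (ρ m)) with hR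
  have hbx : 0 ≤ f.b * x := mul_nonneg f.b_nonneg hx.le
  have hRlap : ∀ m s, 0 ≤ s → lap (R m) s = ENNReal.ofReal (Real.exp (-(x * (f.a + f.b * s + c +
      ∫ y in Ioc (1 / ((m : ℝ) + 1)) δ, (1 - Real.exp (-(s * y))) ∂f.levy)))) := by
    intro m s hs
    have h1 := lap_smul_restrict_levy f hx.le hs (A := Ioc (1 / ((m : ℝ) + 1)) δ)
      (f.levy_Ioc_lt_top (by positivity))
    rw [hR, lap_smul, lap_conv, lap_dirac, lap_expMeasure (mul_nonneg hx.le h1.2) h1.1,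
      ← ENNReal.ofReal_mul (Real.exp_pos _).le, ← ENNReal.ofReal_mul (Real.exp_pos _).le,
      ← Real.exp_add, ← Real.exp_add]
    congr 2
    ring
  have hRuniv : ∀ m, R m univ ≤ ENNReal.ofReal (Real.exp (-(x * c))) := by
    intro m
    rw [← lap_zero, hRlap m 0 le_rfl]
    refine ENNReal.ofReal_le_ofReal (Real.exp_le_exp.2 ?_)
    simp only [mul_zero, zero_mul, neg_zero, Real.exp_zero, sub_self, integral_zero, add_zero]
    have := mul_nonneg hx.le f.a_nonneg
    nlinarith
  have hRfin : ∀ m, IsFiniteMeasure (R m) := fun m => ⟨(hRuniv m).trans_lt ENNReal.ofReal_lt_top⟩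
  obtain ⟨U, hU, hKU, hle⟩ := exists_isOpen_conv_expMeasure_le (ν := ν)
    ((Measure.absolutelyContinuous_of_le Measure.restrict_le_self).trans
      hf.levy_absolutelyContinuous |>.smul_left _) hK0
  have hcν : 0 ≤ c := measureReal_nonneg
  have hlapP : ∀ m s, 0 ≤ s → lap (R m ∗ expMeasure ν) s =
      ENNReal.ofReal (Real.exp (-(x * (f.a + f.b * s +
      ((∫ y in Ioc (1 / ((m : ℝ) + 1)) δ, (1 - Real.exp (-(s * y))) ∂f.levy) +
        ∫ y in Ioi δ, (1 - Real.exp (-(s * y))) ∂f.levy))))) := by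
    intro m s hs
    have h1 := lap_smul_restrict_levy f hx.le hs (f.levy_Ioi_lt_top hδ)
    rw [lap_conv, hRlap m s hs, lap_expMeasure (mul_nonneg hx.le h1.2) h1.1,
      ← ENNReal.ofReal_mul (Real.exp_pos _).le, ← Real.exp_add]
    congr 2
    ring
  have htot : ∀ m, (R m ∗ expMeasure ν).real univ ≤ 1 := by
    intro m
    rw [measureReal_def, ← lap_zero, hlapP m 0 le_rfl, ENNReal.toReal_ofReal (Real.exp_pos _).le,
      Real.exp_le_one_iff]
    simp only [mul_zero, zero_mul, neg_zero, Real.exp_zero, sub_self, integral_zero, add_zero]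
    have := mul_nonneg hx.le f.a_nonneg
    linarith
  refine measure_isCompact_le_of_tendsto_lap (Pm := fun m => R m ∗ expMeasure ν) (C := 1)
    (fun m => conv_Iio ?_ (expMeasure_Iio (hIio _))) hP htot ?_ ?_ hK hU hKU ?_
  · rw [hR]
    simp only [Measure.smul_apply]
    rw [conv_Iio (by simp [hbx]) (expMeasure_Iio (hIio _)), smul_zero]
  · rw [measureReal_def]; exact ENNReal.toReal_mono ENNReal.one_ne_top hP1
  · intro k
    have hk : (0 : ℝ) < k + 1 := by positivity
    simp_rw [hlapP _ _ hk.le, hlap _ hk]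
    refine ENNReal.tendsto_ofReal ((Real.continuous_exp.tendsto _).comp ?_)
    exact ((tendsto_truncated_exponent f hk hδ).const_mul x).neg
  · intro m
    have h2 := (hle (R m)).trans (mul_le_mul_right (hRuniv m) 2)
    have e2 : (2 : ℝ≥0∞) * ENNReal.ofReal (Real.exp (-(x * c))) =
        ENNReal.ofReal (2 * Real.exp (-(x * c))) := by
      rw [ENNReal.ofReal_mul (by norm_num)]; simp
    rw [e2] at h2
    exact ENNReal.toReal_le_of_le_ofReal (by positivity) h2

/-- The one-dimensional laws of a subordinator with infinite, absolutely continuous Lévy measure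
are absolutely continuous. -/
theorem absolutelyContinuous_of_lap (hf : f.ConditionI) {x : ℝ} (hx : 0 < x) {P : Measure ℝ}
    (hP : P (Iio 0) = 0) (hP1 : P univ ≤ 1)
    (hlap : ∀ s, 0 < s → lap P s = ENNReal.ofReal (Real.exp (-(x * f.fn s)))) :
    P ≪ volume := by
  have : IsFiniteMeasure P := ⟨hP1.trans_lt ENNReal.one_lt_top⟩
  have htop : Tendsto (fun n : ℕ => f.levy (Ioi (1 / ((n : ℝ) + 1)))) atTop (𝓝 ∞) := by
    have hU : (⋃ m : ℕ, Ioi (1 / ((m : ℝ) + 1))) = Ioi 0 := by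
      ext y
      simp only [mem_iUnion, mem_Ioi]
      exact ⟨fun ⟨m, h1⟩ => lt_trans (by positivity) h1, exists_nat_one_div_lt⟩
    rw [← hf.1, ← hU]
    refine tendsto_measure_iUnion_atTop fun m n hmn => Ioi_subset_Ioi ?_
    have : (m : ℝ) ≤ n := by exact_mod_cast hmn
    gcongr
  have htop' : Tendsto (fun n : ℕ => f.levy.real (Ioi (1 / ((n : ℝ) + 1)))) atTop atTop := by
    rw [← ENNReal.tendsto_ofReal_nhds_top]
    refine htop.congr fun n => ?_
    rw [measureReal_def, ENNReal.ofReal_toReal (f.levy_Ioi_lt_top (by positivity)).ne]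
  have hlim : Tendsto (fun n : ℕ => 2 * Real.exp (-(x * f.levy.real (Ioi (1 / ((n : ℝ) + 1))))))
      atTop (𝓝 0) := by
    have := (Real.tendsto_exp_atBot.comp
      (tendsto_neg_atTop_atBot.comp (htop'.const_mul_atTop hx))).const_mul 2
    simpa using this
  refine Measure.AbsolutelyContinuous.mk fun A hA hA0 => ?_
  rw [hA.measure_eq_iSup_isCompact]
  simp only [ENNReal.iSup_eq_zero]
  intro K hKA hK
  have h0 : P.real K ≤ 0 := ge_of_tendsto' hlim fun n =>
    measureReal_isCompact_le_of_lap hf hx hP hP1 hlap hK (measure_mono_null hKA hA0) (by positivity)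
  exact (measureReal_eq_zero_iff).1 (le_antisymm h0 measureReal_nonneg)

end Regularity

/-! ### Duality between the laws of the subordinator and of its inverse. -/

/-- The one-dimensional laws `P x` of a (killed) subordinator with exponent `f`, and the laws
`Q t` of its inverse. -/
structure IsInversePair (f : BernsteinTriplet) (P Q : Kernel ℝ ℝ) : Prop where
  left_Iio : ∀ x, P x (Iio 0) = 0
  left_univ : ∀ x, P x univ ≤ 1
  lap_left : ∀ x s, 0 ≤ x → 0 < s → lap (P x) s = ENNReal.ofReal (Real.exp (-(x * f.fn s)))
  right_Iio : ∀ t, Q t (Iio 0) = 0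
  right_Ioi_le : ∀ t x, 0 ≤ t → 0 ≤ x → Q t (Ioi x) ≤ P x (Iic t)
  left_Iio_le : ∀ t x, 0 ≤ t → 0 ≤ x → P x (Iio t) ≤ Q t (Ioi x)

/-- The indicator of y ≤ t is at most e^{t-y}. -/
theorem measure_Iic_le_lap (μ : Measure ℝ) (t : ℝ) :
    μ (Iic t) ≤ ENNReal.ofReal (Real.exp t) * lap μ 1 := by
  rw [lap, ← lintegral_const_mul _ (by fun_prop), ← lintegral_indicator_one measurableSet_Iic]
  refine lintegral_mono fun y => ?_
  by_cases hy : y ∈ Iic t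
  · rw [indicator_of_mem hy, ← ENNReal.ofReal_mul (Real.exp_pos _).le, ← Real.exp_add,
      Pi.one_apply, ENNReal.one_le_ofReal, Real.one_le_exp_iff]
    have : y ≤ t := hy
    linarith
  · rw [indicator_of_notMem hy]; exact zero_le

namespace IsInversePair

variable {f : BernsteinTriplet} {P Q : Kernel ℝ ℝ}

theorem absolutelyContinuous_left (h : IsInversePair f P Q) (hf : f.ConditionI) {x : ℝ}
    (hx : 0 < x) : P x ≪ volume :=
  absolutelyContinuous_of_lap hf hx (h.left_Iio x) (h.left_univ x) fun s hs =>
    h.lap_left x s hx.le hs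

theorem left_Iio_eq_Iic (h : IsInversePair f P Q) (hf : f.ConditionI) {x : ℝ} (hx : 0 < x)
    (t : ℝ) : P x (Iio t) = P x (Iic t) :=
  measure_congr ((h.absolutelyContinuous_left hf hx).ae_le Iio_ae_eq_Iic)

/-- The two inequalities in `IsInversePair` differ only by the mass of `P x` at t, and there is
none. -/
theorem right_Ioi (h : IsInversePair f P Q) (hf : f.ConditionI) {x t : ℝ} (hx : 0 < x)
    (ht : 0 ≤ t) : Q t (Ioi x) = P x (Iic t) :=
  le_antisymm (h.right_Ioi_le t x ht hx.le)
    (h.left_Iio_eq_Iic hf hx t ▸ h.left_Iio_le t x ht hx.le)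

theorem isFiniteMeasure_left (h : IsInversePair f P Q) (x : ℝ) : IsFiniteMeasure (P x) :=
  ⟨(h.left_univ x).trans_lt ENNReal.one_lt_top⟩

theorem isFiniteKernel_left (h : IsInversePair f P Q) : IsFiniteKernel P :=
  ⟨1, ENNReal.one_lt_top, h.left_univ⟩

/-- The subordinator does not leave `[0, t]` immediately. -/
theorem right_Iic_le (h : IsInversePair f P Q) (hf : f.ConditionI) [IsMarkovKernel Q] {x t : ℝ}
    (hx : 0 < x) (ht : 0 < t) :
    (Q t).real (Iic x) ≤ (1 - Real.exp (-(x * f.fn 1))) / (1 - Real.exp (-t)) := by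
  have := h.isFiniteMeasure_left x
  -- The transform is split at t, with e^{-y} ≤ 1 below and e^{-y} ≤ e^{-t} above. Since the total
  -- mass is at most 1, this bounds the mass missing from [0, t], killing included.
  have h1 : lap (P x) 1 ≤ P x (Iic t) + ENNReal.ofReal (Real.exp (-t)) * P x (Ioi t) := by
    rw [lap, ← lintegral_add_compl _ measurableSet_Iic (A := Iic t), compl_Iic]
    gcongr
    · rw [← setLIntegral_one]
      refine lintegral_mono_ae ?_
      filter_upwards [ae_restrict_of_ae (ae_nonneg_of_Iio (h.left_Iio x))] with y hy
      simpa using hy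
    · rw [← setLIntegral_const]
      refine setLIntegral_mono measurable_const fun y hy => ?_
      gcongr
      rw [one_mul]
      exact le_of_lt hy
  have h2 := ENNReal.toReal_mono (by finiteness) h1
  rw [h.lap_left x 1 hx.le one_pos, ENNReal.toReal_ofReal (Real.exp_pos _).le,
    ENNReal.toReal_add (by finiteness) (by finiteness), ENNReal.toReal_mul,
    ENNReal.toReal_ofReal (Real.exp_pos _).le] at h2
  change _ ≤ (P x).real (Iic t) + _ * (P x).real (Ioi t) at h2
  have h3 : (P x).real (Iic t) + (P x).real (Ioi t) ≤ 1 := by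
    rw [← compl_Iic, measureReal_add_measureReal_compl measurableSet_Iic]
    exact ENNReal.toReal_mono ENNReal.one_ne_top (h.left_univ x)
  have h4 : (Q t).real (Iic x) = 1 - (P x).real (Iic t) := by
    rw [← compl_Ioi, probReal_compl_eq_one_sub measurableSet_Ioi, measureReal_def,
      h.right_Ioi hf hx ht.le]
    rfl
  have h5 : Real.exp (-t) < 1 := Real.exp_lt_one_iff.2 (by linarith)
  rw [h4, le_div_iff₀ (by linarith)]
  have := Real.exp_pos (-t)
  have := measureReal_nonneg (μ := P x) (s := Ioi t)
  nlinarith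

theorem tendsto_right_Iic (h : IsInversePair f P Q) (hf : f.ConditionI) [IsMarkovKernel Q]
    {t : ℝ} (ht : 0 < t) : Tendsto (fun x => (Q t).real (Iic x)) (𝓝[>] 0) (𝓝 0) := by
  have hlim : Tendsto (fun x => (1 - Real.exp (-(x * f.fn 1))) / (1 - Real.exp (-t))) (𝓝[>] 0)
      (𝓝 0) := by
    have : Continuous fun x => (1 - Real.exp (-(x * f.fn 1))) / (1 - Real.exp (-t)) := by fun_prop
    have := this.tendsto 0
    simp only [zero_mul, neg_zero, Real.exp_zero, sub_self, zero_div] at this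
    exact this.mono_left nhdsWithin_le_nhds
  refine tendsto_of_tendsto_of_tendsto_of_le_of_le' tendsto_const_nhds hlim
    (Eventually.of_forall fun x => measureReal_nonneg) ?_
  filter_upwards [self_mem_nhdsWithin] with x hx using h.right_Iic_le hf hx ht

theorem right_Iic_zero (h : IsInversePair f P Q) (hf : f.ConditionI) [IsMarkovKernel Q]
    {t : ℝ} (ht : 0 < t) : Q t (Iic 0) = 0 := by
  rw [← measureReal_eq_zero_iff]
  refine le_antisymm (ge_of_tendsto (h.tendsto_right_Iic hf ht) ?_) measureReal_nonneg
  filter_upwards [self_mem_nhdsWithin] with x hx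
  exact measureReal_mono (Iic_subset_Iic.2 (le_of_lt hx))

theorem right_Ioi_of_nonpos (h : IsInversePair f P Q) (hf : f.ConditionI) [IsMarkovKernel Q]
    {x t : ℝ} (hx : x ≤ 0) (ht : 0 < t) : Q t (Ioi x) = 1 := by
  rw [← compl_Iic, prob_compl_eq_one_iff measurableSet_Iic]
  exact measure_mono_null (Iic_subset_Iic.2 hx) (h.right_Iic_zero hf ht)

/-- Exponential decay in x, which makes the potential measures locally finite. -/
theorem left_Iic_le (h : IsInversePair f P Q) {x : ℝ} (hx : 0 ≤ x) (t : ℝ) :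
    P x (Iic t) ≤ ENNReal.ofReal (Real.exp t * Real.exp (-(x * f.fn 1))) := by
  rw [ENNReal.ofReal_mul (Real.exp_pos _).le, ← h.lap_left x 1 hx one_pos]
  exact measure_Iic_le_lap _ _

/-- The semigroup property, recovered from e^{-xf(s)} e^{-zf(s)} = e^{-(x+z)f(s)} and uniqueness;
the Markov property of the inverse rests on it. -/
theorem left_add (h : IsInversePair f P Q) {x z : ℝ} (hx : 0 ≤ x) (hz : 0 ≤ z) :
    P (x + z) = P x ∗ P z := by
  have := h.isFiniteMeasure_left z
  refine ext_of_lap (h.left_Iio _) (conv_Iio (h.left_Iio _) (h.left_Iio _)) (fun s hs => ?_)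
    fun s hs => ?_
  · rw [h.lap_left _ _ (add_nonneg hx hz) hs]; exact ENNReal.ofReal_ne_top
  · rw [lap_conv, h.lap_left _ _ (add_nonneg hx hz) hs, h.lap_left _ _ hx hs,
      h.lap_left _ _ hz hs, ← ENNReal.ofReal_mul (Real.exp_pos _).le, ← Real.exp_add]
    congr 2; ring

/-- Finite measures on the line which agree on all right half lines are equal. -/
theorem ext_of_Ioi {μ ν : Measure ℝ} [IsFiniteMeasure μ] (huniv : μ univ = ν univ)
    (h : ∀ x, μ (Ioi x) = ν (Ioi x)) : μ = ν := by
  refine ext_of_generate_finite (range Ioi) (borel_eq_generateFrom_Ioi ℝ ▸ BorelSpace.measurable_eq)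
    isPiSystem_Ioi ?_ huniv
  rintro _ ⟨x, rfl⟩
  exact h x

/-- Fubini for the time integral of a distribution function. -/
theorem lintegral_exp_mul_left_Iic (h : IsInversePair f P Q) {x s : ℝ} (hx : 0 ≤ x) (hs : 0 < s) :
    ∫⁻ t in Ioi 0, ENNReal.ofReal (Real.exp (-(s * t))) * P x (Iic t) =
      ENNReal.ofReal (Real.exp (-(x * f.fn s)) / s) := by
  have := h.isFiniteMeasure_left x
  have hjm : Measurable (Function.uncurry fun (t y : ℝ) =>
      (Iic t).indicator (fun _ => ENNReal.ofReal (Real.exp (-(s * t)))) y) := by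
    have : (Function.uncurry fun (t y : ℝ) =>
      (Iic t).indicator (fun _ => ENNReal.ofReal (Real.exp (-(s * t)))) y) =
      {p : ℝ × ℝ | p.2 ≤ p.1}.indicator (fun p => ENNReal.ofReal (Real.exp (-(s * p.1)))) := by
      ext ⟨y, z⟩; simp [indicator]
    rw [this]
    exact Measurable.indicator (by fun_prop) (measurableSet_le measurable_snd measurable_fst)
  have h1 : ∀ t, ENNReal.ofReal (Real.exp (-(s * t))) * P x (Iic t) =
      ∫⁻ y, (Iic t).indicator (fun _ => ENNReal.ofReal (Real.exp (-(s * t)))) y ∂(P x) := by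
    intro t
    rw [lintegral_indicator measurableSet_Iic, setLIntegral_const]
  simp_rw [h1]
  rw [lintegral_lintegral_swap hjm.aemeasurable, div_eq_mul_inv, mul_comm,
    ENNReal.ofReal_mul (by positivity), ← h.lap_left x s hx hs, lap,
    ← lintegral_const_mul _ (by fun_prop)]
  refine lintegral_congr_ae ?_
  filter_upwards [ae_nonneg_of_Iio (h.left_Iio x)] with y hy
  have e1 : ∀ t, (Iic t).indicator (fun _ => ENNReal.ofReal (Real.exp (-(s * t)))) y =
      (Ici y).indicator (fun t => ENNReal.ofReal (Real.exp (-(s * t)))) t := by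
    intro y; simp [indicator]
  simp_rw [e1]
  rw [lintegral_indicator measurableSet_Ici, Measure.restrict_restrict measurableSet_Ici,
    Measure.restrict_congr_set (t := Ioi y), BernsteinTriplet.lintegral_exp_Ioi hs]
  · rw [← ENNReal.ofReal_mul (by positivity)]
    congr 1; ring
  · have e2 : (Ici y ∩ Ioi 0 : Set ℝ) =ᵐ[volume] (Ioi y ∩ Ioi 0 : Set ℝ) :=
      Ioi_ae_eq_Ici.symm.inter (ae_eq_refl _)
    rwa [Ioi_inter_Ioi, max_eq_left hy] at e2

/-- The Laplace transform in time of `E κ(Y(t))`. -/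
theorem lintegral_exp_mul_right (h : IsInversePair f P Q) (hf : f.ConditionI) [IsMarkovKernel Q]
    {s : ℝ} (hs : 0 < s) {κ : ℝ → ℝ≥0∞} (hκ : Measurable κ) :
    ∫⁻ t in Ioi 0, ENNReal.ofReal (Real.exp (-(s * t))) * ∫⁻ x, κ x ∂(Q t) =
      ENNReal.ofReal (f.fn s / s) *
        ∫⁻ x in Ioi 0, κ x * ENNReal.ofReal (Real.exp (-(x * f.fn s))) := by
  have hφ := hf.fn_pos hs
  -- The claim is the equality of measures A.bind Q = (f(s)/s) • B, which can be tested on right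
  -- half lines; there it reduces by duality to the time transform of t ↦ P x [0, t].
  set A := (volume.restrict (Ioi (0 : ℝ))).withDensity
    fun t => ENNReal.ofReal (Real.exp (-(s * t))) with hA
  set B := (volume.restrict (Ioi (0 : ℝ))).withDensity
    fun x => ENNReal.ofReal (Real.exp (-(x * f.fn s))) with hB
  have hAQ : ∀ {g : ℝ → ℝ≥0∞}, Measurable g → ∫⁻ x, g x ∂(A.bind Q) =
      ∫⁻ t in Ioi 0, ENNReal.ofReal (Real.exp (-(s * t))) * ∫⁻ x, g x ∂(Q t) := by
    intro g hg
    rw [Measure.lintegral_bind Q.measurable.aemeasurable hg.aemeasurable, hA,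
      lintegral_withDensity_eq_lintegral_mul _ (by fun_prop) hg.lintegral_kernel]
    rfl
  have hBI : ∀ x, 0 ≤ x → B (Ioi x) = ENNReal.ofReal (Real.exp (-(x * f.fn s)) / f.fn s) := by
    intro x hx
    rw [hB, withDensity_apply _ measurableSet_Ioi, Measure.restrict_restrict measurableSet_Ioi,
      Ioi_inter_Ioi, max_eq_left hx]
    simp_rw [mul_comm _ (f.fn s)]
    exact BernsteinTriplet.lintegral_exp_Ioi hφ x
  have hAI : ∀ x, (A.bind Q) (Ioi x) =
      ∫⁻ t in Ioi 0, ENNReal.ofReal (Real.exp (-(s * t))) * Q t (Ioi x) := by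
    intro x
    rw [← lintegral_indicator_one measurableSet_Ioi,
      hAQ (measurable_one.indicator measurableSet_Ioi)]
    simp_rw [lintegral_indicator_one (measurableSet_Ioi (a := x))]
  have htotal : ∫⁻ t in Ioi (0 : ℝ), ENNReal.ofReal (Real.exp (-(s * t))) =
      ENNReal.ofReal s⁻¹ := by
    rw [BernsteinTriplet.lintegral_exp_Ioi hs]; simp
  have hB0 : ∀ x ≤ 0, B (Ioi x) = B univ := by
    intro x hx
    refine measure_congr (eventuallyEq_univ.2 ?_)
    refine (withDensity_absolutelyContinuous _ _).ae_le ?_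
    filter_upwards [ae_restrict_mem measurableSet_Ioi] with y hy using lt_of_le_of_lt hx hy
  have hAu : (A.bind Q) univ = ∫⁻ t in Ioi (0 : ℝ), ENNReal.ofReal (Real.exp (-(s * t))) := by
    rw [← lintegral_one]
    refine (hAQ measurable_one).trans ?_
    simp
  have huniv : (A.bind Q) univ = (ENNReal.ofReal (f.fn s / s) • B) univ := by
    rw [Measure.smul_apply, ← hB0 0 le_rfl, hBI 0 le_rfl, hAu, htotal, smul_eq_mul,
      ← ENNReal.ofReal_mul (div_nonneg hφ.le hs.le)]
    simp only [zero_mul, neg_zero, Real.exp_zero]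
    congr 1
    field_simp
  have hfin : IsFiniteMeasure (A.bind Q) := ⟨by
    rw [huniv, Measure.smul_apply, ← hB0 0 le_rfl, hBI 0 le_rfl, smul_eq_mul]
    finiteness⟩
  have key : A.bind Q = ENNReal.ofReal (f.fn s / s) • B := by
    refine ext_of_Ioi huniv fun x => ?_
    rcases le_or_gt x 0 with hx | hx
    · rw [Measure.smul_apply, hB0 x hx, ← Measure.smul_apply, ← huniv, hAI, hAu]
      refine setLIntegral_congr_fun measurableSet_Ioi fun t ht => ?_
      simp [h.right_Ioi_of_nonpos hf hx ht]
    · rw [hAI, Measure.smul_apply, hBI x hx.le, smul_eq_mul,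
        ← ENNReal.ofReal_mul (div_nonneg hφ.le hs.le)]
      have e : f.fn s / s * (Real.exp (-(x * f.fn s)) / f.fn s) = Real.exp (-(x * f.fn s)) / s := by
        field_simp
      rw [e, ← h.lintegral_exp_mul_left_Iic hx.le hs]
      refine setLIntegral_congr_fun measurableSet_Ioi fun t ht => ?_
      simp only [h.right_Ioi hf hx (le_of_lt ht)]
  rw [← hAQ hκ, key, lintegral_smul_measure, hB,
    lintegral_withDensity_eq_lintegral_mul _ (by fun_prop) hκ, smul_eq_mul]
  simp_rw [Pi.mul_apply, mul_comm]

/-- The Markov property of the subordinator, seen by its inverse. -/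
theorem restrict_right (h : IsInversePair f P Q) (hf : f.ConditionI) [IsMarkovKernel Q] {ε t : ℝ}
    (hε : 0 < ε) (ht : 0 < t) {κ : ℝ → ℝ≥0∞} (hκ : Measurable κ) :
    ∫⁻ x in Ioi ε, κ x ∂(Q t) =
      ∫⁻ y in Iio t, ∫⁻ z, κ (ε + z) ∂(Q (t - y)) ∂(P ε) := by
  have := h.isFiniteMeasure_left ε
  -- `R y` is the law of ε + Y(t - y): the first passage over t when the subordinator stands at y <
  -- t at operational time ε.
  set R : Kernel ℝ ℝ := (Q.comap (fun y => t - y) (by fun_prop)).map (fun z => ε + z) with hR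
  have hRl : ∀ {g : ℝ → ℝ≥0∞}, Measurable g → ∀ y, ∫⁻ z, g z ∂(R y) =
      ∫⁻ z, g (ε + z) ∂(Q (t - y)) := by
    intro g hg y
    rw [hR, Kernel.map_apply _ (by fun_prop), Kernel.comap_apply,
      lintegral_map hg (by fun_prop)]
  have hRI : ∀ x y, R y (Ioi x) = Q (t - y) (Ioi (x - ε)) := by
    intro x y
    rw [hR, Kernel.map_apply _ (by fun_prop), Kernel.comap_apply,
      Measure.map_apply (by fun_prop) measurableSet_Ioi]
    congr 1; ext z; simp [sub_lt_iff_lt_add']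
  have hb : ∀ x, (((P ε).restrict (Iio t)).bind R) (Ioi x) =
      ∫⁻ y in Iio t, Q (t - y) (Ioi (x - ε)) ∂(P ε) := by
    intro x
    rw [Measure.bind_apply measurableSet_Ioi R.measurable.aemeasurable]
    simp_rw [hRI]
  have hb1 : ∀ x ≤ ε, (((P ε).restrict (Iio t)).bind R) (Ioi x) = P ε (Iio t) := by
    intro x hx
    rw [hb, ← setLIntegral_one]
    refine setLIntegral_congr_fun measurableSet_Iio fun y hy => ?_
    exact h.right_Ioi_of_nonpos hf (by linarith) (sub_pos.2 hy)
  have : IsMarkovKernel R := by rw [hR]; exact Kernel.IsMarkovKernel.map _ (by fun_prop)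
  have huniv : ((Q t).restrict (Ioi ε)) univ = (((P ε).restrict (Iio t)).bind R) univ := by
    rw [Measure.restrict_apply_univ, Measure.bind_apply MeasurableSet.univ R.measurable.aemeasurable,
      h.right_Ioi hf hε ht.le, ← h.left_Iio_eq_Iic hf hε]
    simp
  have key : (Q t).restrict (Ioi ε) = ((P ε).restrict (Iio t)).bind R := by
    refine ext_of_Ioi huniv fun x => ?_
    rw [Measure.restrict_apply measurableSet_Ioi, Ioi_inter_Ioi]
    rcases le_or_gt x ε with hx | hx
    · rw [hb1 x hx, max_eq_right hx, h.right_Ioi hf hε ht.le, h.left_Iio_eq_Iic hf hε]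
    · have hz : 0 < x - ε := sub_pos.2 hx
      rw [max_eq_left hx.le, hb, h.right_Ioi hf (hε.trans hx) ht.le]
      have e : x = ε + (x - ε) := by ring
      have := h.isFiniteMeasure_left (x - ε)
      conv_lhs => rw [e, h.left_add hε.le hz.le]
      rw [← lintegral_indicator_one measurableSet_Iic,
        Measure.lintegral_conv (measurable_one.indicator measurableSet_Iic),
        ← lintegral_indicator measurableSet_Iio]
      -- The level y = t falls under neither case below and is null for `P ε`.
      have hne : ∀ᵐ y ∂(P ε), y ≠ t := (h.absolutelyContinuous_left hf hε).ae_le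
        (Measure.ae_ne volume t)
      refine lintegral_congr_ae ?_
      filter_upwards [hne] with y hy
      have e3 : ∫⁻ z, (Iic t).indicator 1 (y + z) ∂(P (x - ε)) = P (x - ε) (Iic (t - y)) := by
        rw [← lintegral_indicator_one measurableSet_Iic]
        refine lintegral_congr fun z => ?_
        simp [indicator, le_sub_iff_add_le']
      rw [e3]
      rcases lt_or_gt_of_ne hy with hlt | hgt
      · rw [indicator_of_mem (mem_Iio.2 hlt), h.right_Ioi hf hz (sub_pos.2 hlt).le]
      · rw [indicator_of_notMem (by simpa using hgt.le)]
        refine measure_mono_null (fun z hz => ?_) (h.left_Iio (x - ε))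
        exact lt_of_le_of_lt hz (sub_neg.2 hgt)
  rw [key, Measure.lintegral_bind R.measurable.aemeasurable hκ.aemeasurable]
  simp_rw [hRl hκ]

/-- The inverse of the subordinator has absolutely continuous one-dimensional laws. -/
theorem absolutelyContinuous_right (h : IsInversePair f P Q) (hf : f.ConditionI)
    [IsMarkovKernel Q] {t : ℝ} (ht : 0 < t) : Q t ≪ volume := by
  refine Measure.AbsolutelyContinuous.mk fun B hB hB0 => ?_
  have hzero : ∀ ε, 0 < ε → Q t (B ∩ Ioi ε) = 0 := by
    intro ε hε
    rw [← Measure.restrict_apply hB, ← lintegral_indicator_one hB,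
      h.restrict_right hf hε ht (measurable_one.indicator hB)]
    have hm : Measurable fun z => B.indicator (1 : ℝ → ℝ≥0∞) (ε + z) :=
      (measurable_one.indicator hB).comp (measurable_const_add ε)
    -- The time transform is an integral over a translate of the null set B, so ε + Y(r) avoids B
    -- almost surely for a.e. r. Averaging r = t - y over the absolutely continuous law `P ε` turns
    -- a.e. r into the given t.
    have hE := h.lintegral_exp_mul_right hf one_pos hm
    have hr : ∫⁻ x in Ioi 0, B.indicator (1 : ℝ → ℝ≥0∞) (ε + x) *
        ENNReal.ofReal (Real.exp (-(x * f.fn 1))) = 0 := by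
      have : ∀ᵐ x : ℝ, ε + x ∉ B :=
        (quasiMeasurePreserving_add_left volume ε).ae (measure_eq_zero_iff_ae_notMem.1 hB0)
      refine (lintegral_congr_ae (g := fun _ => 0) ?_).trans lintegral_zero
      filter_upwards [ae_restrict_of_ae this] with x hx
      simp [hx]
    rw [hr, mul_zero, lintegral_eq_zero_iff (by
      exact Measurable.mul (by fun_prop) hm.lintegral_kernel)] at hE
    have hae : ∀ᵐ r : ℝ, 0 < r → ∫⁻ z, B.indicator (1 : ℝ → ℝ≥0∞) (ε + z) ∂(Q r) = 0 := by
      refine (ae_restrict_iff' (measurableSet_Ioi (a := (0 : ℝ)))).1 ?_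
      filter_upwards [hE] with r hr
      simpa [(Real.exp_pos _).not_ge] using hr
    have hae2 : ∀ᵐ y : ℝ, 0 < t - y → ∫⁻ z, B.indicator (1 : ℝ → ℝ≥0∞) (ε + z) ∂(Q (t - y)) = 0 :=
      (quasiMeasurePreserving_sub_left volume t).ae hae
    refine (lintegral_congr_ae (g := fun _ => 0) ?_).trans lintegral_zero
    filter_upwards [ae_restrict_of_ae ((h.absolutelyContinuous_left hf hε).ae_le hae2),
      ae_restrict_mem measurableSet_Iio] with y hy hy'
    exact hy (sub_pos.2 hy')
  refine measure_mono_null (t := Iic 0 ∪ ⋃ n : ℕ, B ∩ Ioi (1 / ((n : ℝ) + 1))) (fun x hx => ?_)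
    (measure_union_null (h.right_Iic_zero hf ht)
      (measure_iUnion_null fun n => hzero _ (by positivity)))
  rcases le_or_gt x 0 with h0 | h0
  · exact Or.inl h0
  · obtain ⟨n, hn⟩ := exists_nat_one_div_lt h0
    exact Or.inr (mem_iUnion.2 ⟨n, hx, hn⟩)

end IsInversePair

/-! ### Weighted potential measures and the convolution equation at almost every time. -/

/-- The tail of the Lévy measure, extended by zero to the negative half line. -/
def BernsteinTriplet.tailE (f : BernsteinTriplet) (r : ℝ) : ℝ≥0∞ :=
  (Ioi (0 : ℝ)).indicator (fun r => ENNReal.ofReal (f.tail r)) r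

/-- The weighted potential measure `∫_0^∞ κ(x) P_x dx`. -/
def potential (P : Kernel ℝ ℝ) (κ : ℝ → ℝ≥0∞) : Measure ℝ :=
  ((volume.restrict (Ioi (0 : ℝ))).withDensity κ).bind P

/-- The convolution of the tail with a measure. -/
def tailConv (f : BernsteinTriplet) (V : Measure ℝ) (t : ℝ) : ℝ≥0∞ :=
  ∫⁻ y, f.tailE (t - y) ∂V

namespace BernsteinTriplet

variable (f : BernsteinTriplet)

@[fun_prop]
theorem measurable_tailE : Measurable f.tailE :=
  (f.measurable_tail.ennreal_ofReal).indicator measurableSet_Ioi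

theorem tailE_of_pos {r : ℝ} (hr : 0 < r) : f.tailE r = ENNReal.ofReal (f.tail r) :=
  indicator_of_mem (mem_Ioi.2 hr) _

theorem tailE_of_nonpos {r : ℝ} (hr : r ≤ 0) : f.tailE r = 0 :=
  indicator_of_notMem (by simpa using hr) _

theorem lap_tailE {s : ℝ} (hs : 0 < s) :
    ENNReal.ofReal f.b + ∫⁻ y, ENNReal.ofReal (Real.exp (-(s * y))) * f.tailE y =
      ENNReal.ofReal (f.fn s / s) := by
  rw [← f.lintegral_exp_mul_tail hs, ← lintegral_indicator measurableSet_Ioi]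
  congr 1
  refine lintegral_congr fun y => ?_
  by_cases hy : y ∈ Ioi (0 : ℝ)
  · rw [indicator_of_mem hy, f.tailE_of_pos hy]
  · rw [indicator_of_notMem hy, f.tailE_of_nonpos (not_lt.1 hy), mul_zero]

/-- The tail is unbounded at 0 under Condition I, but its Laplace transform at 1 is finite and
dominates e^{-δ} times the integral over (0, δ]. -/
theorem lintegral_tailE_Ioc_lt_top (δ : ℝ) : ∫⁻ y in Ioc 0 δ, f.tailE y < ∞ := by
  have h1 : ∫⁻ y, ENNReal.ofReal (Real.exp (-(1 * y))) * f.tailE y ≤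
      ENNReal.ofReal (f.fn 1 / 1) := by
    rw [← f.lap_tailE one_pos]; exact le_add_self
  have h2 : ENNReal.ofReal (Real.exp (-δ)) * ∫⁻ y in Ioc 0 δ, f.tailE y ≤
      ENNReal.ofReal (f.fn 1 / 1) := by
    rw [← lintegral_const_mul _ f.measurable_tailE]
    refine le_trans ?_ ((setLIntegral_le_lintegral (Ioc 0 δ) _).trans h1)
    refine setLIntegral_mono (by fun_prop) fun y hy => ?_
    gcongr
    linarith [hy.2]
  by_contra hne
  rw [not_lt, top_le_iff] at hne
  rw [hne, ENNReal.mul_top (by simp [Real.exp_pos]), top_le_iff] at h2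
  exact ENNReal.ofReal_ne_top h2

variable {f}

theorem ConditionI.continuousAt_tailE (hf : f.ConditionI) {r : ℝ} (hr : r ≠ 0) :
    ContinuousAt f.tailE r := by
  rcases lt_or_gt_of_ne hr with h | h
  · refine (continuousAt_const (y := (0 : ℝ≥0∞))).congr ?_
    filter_upwards [Iio_mem_nhds h] with x hx using (f.tailE_of_nonpos (le_of_lt hx)).symm
  · refine ContinuousAt.congr (f := fun r => ENNReal.ofReal (f.tail r)) ?_ ?_
    · exact ENNReal.continuous_ofReal.continuousAt.comp
        (hf.continuousOn_tail.continuousAt (Ioi_mem_nhds h))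
    · filter_upwards [Ioi_mem_nhds h] with x hx using (f.tailE_of_pos hx).symm

end BernsteinTriplet

namespace IsInversePair

variable {f : BernsteinTriplet} {P Q : Kernel ℝ ℝ} {κ : ℝ → ℝ≥0∞}

theorem lintegral_potential (hκ : Measurable κ) {φ : ℝ → ℝ≥0∞} (hφ : Measurable φ) :
    ∫⁻ y, φ y ∂(potential P κ) = ∫⁻ x in Ioi 0, κ x * ∫⁻ y, φ y ∂(P x) := by
  rw [potential, Measure.lintegral_bind P.measurable.aemeasurable hφ.aemeasurable,
    lintegral_withDensity_eq_lintegral_mul _ hκ hφ.lintegral_kernel]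
  rfl

theorem potential_apply (hκ : Measurable κ) {A : Set ℝ} (hA : MeasurableSet A) :
    potential P κ A = ∫⁻ x in Ioi 0, κ x * P x A := by
  rw [← lintegral_indicator_one hA, lintegral_potential hκ (measurable_one.indicator hA)]
  simp_rw [lintegral_indicator_one hA]

theorem potential_absolutelyContinuous (h : IsInversePair f P Q) (hf : f.ConditionI)
    (hκ : Measurable κ) : potential P κ ≪ volume := by
  refine Measure.AbsolutelyContinuous.mk fun A hA hA0 => ?_
  rw [potential_apply hκ hA]
  refine (setLIntegral_congr_fun measurableSet_Ioi fun x hx => ?_).trans lintegral_zero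
  rw [h.absolutelyContinuous_left hf hx hA0, mul_zero]

theorem potential_Iio (h : IsInversePair f P Q) (hκ : Measurable κ) :
    potential P κ (Iio 0) = 0 := by
  rw [potential_apply hκ measurableSet_Iio]
  simp [h.left_Iio]

theorem potential_Iic (h : IsInversePair f P Q) (hf : f.ConditionI) (hκ : Measurable κ) :
    potential P κ (Iic 0) = 0 := by
  rw [← Iio_union_right]
  exact measure_union_null (h.potential_Iio hκ)
    (h.potential_absolutelyContinuous hf hκ (measure_singleton 0))

theorem potential_Iic_lt_top (h : IsInversePair f P Q) (hf : f.ConditionI)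
    (hκ : Measurable κ) (hκ1 : ∀ x, κ x ≤ 1) (t : ℝ) : potential P κ (Iic t) < ∞ := by
  rw [potential_apply hκ measurableSet_Iic]
  have hφ := hf.fn_pos one_pos
  calc ∫⁻ x in Ioi 0, κ x * P x (Iic t)
      ≤ ∫⁻ x in Ioi 0, ENNReal.ofReal (Real.exp t) *
          ENNReal.ofReal (Real.exp (-(f.fn 1 * x))) := by
        refine setLIntegral_mono (by fun_prop) fun x hx => ?_
        rw [← ENNReal.ofReal_mul (Real.exp_pos _).le, mul_comm (f.fn 1)]
        calc κ x * P x (Iic t) ≤ 1 * P x (Iic t) := by gcongr; exact hκ1 x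
          _ = P x (Iic t) := one_mul _
          _ ≤ _ := h.left_Iic_le (le_of_lt hx) t
    _ = ENNReal.ofReal (Real.exp t) * ENNReal.ofReal (Real.exp (-(f.fn 1 * 0)) / f.fn 1) := by
        rw [lintegral_const_mul _ (by fun_prop), BernsteinTriplet.lintegral_exp_Ioi hφ]
    _ < ∞ := by finiteness

theorem sigmaFinite_potential (h : IsInversePair f P Q) (hf : f.ConditionI)
    (hκ : Measurable κ) (hκ1 : ∀ x, κ x ≤ 1) : SigmaFinite (potential P κ) := by
  refine Measure.sigmaFinite_of_countable (S := range fun n : ℕ => Iic (n : ℝ))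
    (countable_range _) ?_ ?_
  · rintro s ⟨n, rfl⟩
    exact h.potential_Iic_lt_top hf hκ hκ1 n
  · refine eq_univ_of_forall fun x => ?_
    obtain ⟨n, hn⟩ := exists_nat_ge x
    exact ⟨_, ⟨n, rfl⟩, hn⟩

theorem lap_potential (h : IsInversePair f P Q) (hκ : Measurable κ) {s : ℝ} (hs : 0 < s) :
    lap (potential P κ) s =
      ∫⁻ x in Ioi 0, κ x * ENNReal.ofReal (Real.exp (-(x * f.fn s))) := by
  rw [lap, lintegral_potential hκ (by fun_prop)]
  refine setLIntegral_congr_fun measurableSet_Ioi fun x hx => ?_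
  change κ x * lap (P x) s = _
  rw [h.lap_left x s (le_of_lt hx) hs]

theorem measurable_tailConv (f : BernsteinTriplet) (V : Measure ℝ) [SFinite V] :
    Measurable (tailConv f V) := by
  have : Measurable fun p : ℝ × ℝ => f.tailE (p.1 - p.2) :=
    f.measurable_tailE.comp (measurable_fst.sub measurable_snd)
  exact this.lintegral_prod_right'

/-- Transform of a convolution. Restricting to t > 0 loses nothing, since V lives on [0, ∞) and the
extended tail vanishes on (-∞, 0]. -/
theorem lintegral_exp_mul_tailConv (f : BernsteinTriplet) {V : Measure ℝ} [SFinite V]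
    (hV : V (Iio 0) = 0) (s : ℝ) :
    ∫⁻ t in Ioi 0, ENNReal.ofReal (Real.exp (-(s * t))) * tailConv f V t =
      (∫⁻ r, ENNReal.ofReal (Real.exp (-(s * r))) * f.tailE r) * lap V s := by
  have hm : Measurable fun p : ℝ × ℝ => ENNReal.ofReal (Real.exp (-(s * p.1))) *
      f.tailE (p.1 - p.2) :=
    Measurable.mul (by fun_prop) (f.measurable_tailE.comp (measurable_fst.sub measurable_snd))
  have h1 : ∀ t, ENNReal.ofReal (Real.exp (-(s * t))) * tailConv f V t =
      ∫⁻ y, ENNReal.ofReal (Real.exp (-(s * t))) * f.tailE (t - y) ∂V := fun t => by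
    rw [tailConv, lintegral_const_mul _ (by fun_prop)]
  simp_rw [h1]
  rw [lintegral_lintegral_swap hm.aemeasurable, lap, ← lintegral_const_mul _ (by fun_prop)]
  refine lintegral_congr_ae ?_
  filter_upwards [ae_nonneg_of_Iio hV] with y hy
  rw [← lintegral_indicator measurableSet_Ioi]
  have h2 : ∀ t, (Ioi (0 : ℝ)).indicator
      (fun t => ENNReal.ofReal (Real.exp (-(s * t))) * f.tailE (t - y)) t =
      ENNReal.ofReal (Real.exp (-(s * y))) *
        (ENNReal.ofReal (Real.exp (-(s * (t - y)))) * f.tailE (t - y)) := by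
    intro t
    rw [← mul_assoc, ← ENNReal.ofReal_mul (Real.exp_pos _).le, ← Real.exp_add]
    by_cases ht : t ∈ Ioi (0 : ℝ)
    · rw [indicator_of_mem ht]
      congr 3; ring
    · rw [indicator_of_notMem ht, f.tailE_of_nonpos (by linarith [not_lt.1 (mem_Ioi.not.1 ht)]), mul_zero]
  simp_rw [h2]
  rw [lintegral_const_mul _ (by fun_prop),
    lintegral_sub_right_eq_self (fun r => ENNReal.ofReal (Real.exp (-(s * r))) * f.tailE r) y,
    mul_comm]

theorem lap_withDensity_Ioi {g : ℝ → ℝ≥0∞} (hg : Measurable g) (s : ℝ) :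
    lap ((volume.restrict (Ioi 0)).withDensity g) s =
      ∫⁻ t in Ioi 0, ENNReal.ofReal (Real.exp (-(s * t))) * g t := by
  rw [lap, lintegral_withDensity_eq_lintegral_mul _ hg (by fun_prop)]
  simp_rw [Pi.mul_apply, mul_comm]

theorem withDensity_Ioi_Iio (g : ℝ → ℝ≥0∞) :
    ((volume.restrict (Ioi (0 : ℝ))).withDensity g) (Iio 0) = 0 := by
  refine withDensity_absolutelyContinuous _ _ ?_
  rw [Measure.restrict_apply measurableSet_Iio]
  have : Iio (0 : ℝ) ∩ Ioi 0 = ∅ := by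
    ext x; simp only [mem_inter_iff, mem_Iio, mem_Ioi, mem_empty_iff_false]; constructor
    · rintro ⟨h1, h2⟩; linarith
    · exact False.elim
  rw [this, measure_empty]

/-- The convolution equation as an identity of measures in time. -/
theorem potential_add_tailConv (h : IsInversePair f P Q) (hf : f.ConditionI) [IsMarkovKernel Q]
    (hκ : Measurable κ) (hκ1 : ∀ x, κ x ≤ 1) :
    ENNReal.ofReal f.b • potential P κ +
        (volume.restrict (Ioi 0)).withDensity (tailConv f (potential P κ)) =
      (volume.restrict (Ioi 0)).withDensity fun t => ∫⁻ x, κ x ∂(Q t) := by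
  have := h.sigmaFinite_potential hf hκ hκ1
  have hEm : Measurable fun t => ∫⁻ x, κ x ∂(Q t) := hκ.lintegral_kernel
  have hlap : ∀ s, 0 < s → lap (ENNReal.ofReal f.b • potential P κ +
        (volume.restrict (Ioi 0)).withDensity (tailConv f (potential P κ))) s =
      lap ((volume.restrict (Ioi 0)).withDensity fun t => ∫⁻ x, κ x ∂(Q t)) s := by
    intro s hs
    rw [lap_add, lap_smul, lap_withDensity_Ioi (measurable_tailConv f _),
      lap_withDensity_Ioi hEm, lintegral_exp_mul_tailConv f (h.potential_Iio hκ), ← add_mul,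
      f.lap_tailE hs, h.lintegral_exp_mul_right hf hs hκ, h.lap_potential hκ hs]
  refine ext_of_lap ?_ (withDensity_Ioi_Iio _) (fun s hs => ?_) hlap
  · rw [Measure.add_apply, Measure.smul_apply, h.potential_Iio hκ, withDensity_Ioi_Iio]; simp
  · rw [hlap s hs, lap_withDensity_Ioi hEm]
    have : ∫⁻ t in Ioi 0, ENNReal.ofReal (Real.exp (-(s * t))) * ∫⁻ x, κ x ∂(Q t) ≤
        ∫⁻ t in Ioi 0, ENNReal.ofReal (Real.exp (-(s * t))) := by
      refine lintegral_mono fun t => ?_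
      calc _ ≤ ENNReal.ofReal (Real.exp (-(s * t))) * ∫⁻ _, 1 ∂(Q t) := by
            gcongr; exact hκ1 _
        _ = _ := by simp
    rw [BernsteinTriplet.lintegral_exp_Ioi hs] at this
    exact (this.trans_lt ENNReal.ofReal_lt_top).ne

theorem withDensity_rnDeriv_potential (h : IsInversePair f P Q) (hf : f.ConditionI)
    (hκ : Measurable κ) (hκ1 : ∀ x, κ x ≤ 1) :
    volume.withDensity ((potential P κ).rnDeriv volume) = potential P κ := by
  have := h.sigmaFinite_potential hf hκ hκ1
  exact Measure.withDensity_rnDeriv_eq _ _ (h.potential_absolutelyContinuous hf hκ)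

/-- The convolution equation at almost every time. -/
theorem ae_rnDeriv_add_tailConv (h : IsInversePair f P Q) (hf : f.ConditionI) [IsMarkovKernel Q]
    (hκ : Measurable κ) (hκ1 : ∀ x, κ x ≤ 1) :
    ∀ᵐ t, 0 < t → ENNReal.ofReal f.b * (potential P κ).rnDeriv volume t +
      tailConv f (potential P κ) t = ∫⁻ x, κ x ∂(Q t) := by
  have := h.sigmaFinite_potential hf hκ hκ1
  have hEm : Measurable fun t => ∫⁻ x, κ x ∂(Q t) := hκ.lintegral_kernel
  have hWm := measurable_tailConv f (potential P κ)
  have hvm := Measure.measurable_rnDeriv (potential P κ) volume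
  -- V does not charge (-∞, 0], so after restriction both sides of the identity have densities with
  -- respect to the same measure, and these can be compared.
  have hres : (potential P κ).restrict (Ioi 0) = potential P κ := by
    rw [Measure.restrict_eq_self_of_ae_mem]
    rw [ae_iff]; simpa [Iic] using h.potential_Iic hf hκ
  have key := h.potential_add_tailConv hf hκ hκ1
  rw [← hres] at key
  nth_rewrite 1 [← h.withDensity_rnDeriv_potential hf hκ hκ1] at key
  rw [hres, restrict_withDensity measurableSet_Ioi, ← withDensity_smul _ hvm,
    ← withDensity_add_left (hvm.const_smul _)] at key
  have hae := (withDensity_eq_iff_of_sigmaFinite (((hvm.const_smul _).add hWm).aemeasurable)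
    hEm.aemeasurable).1 key
  exact (ae_restrict_iff' measurableSet_Ioi).1 hae

end IsInversePair

/-! ### Continuity of the convolution of the tail with a bounded density. -/

namespace BernsteinTriplet

variable (f : BernsteinTriplet)

theorem tailE_anti {r s : ℝ} (hr : 0 < r) (hrs : r ≤ s) : f.tailE s ≤ f.tailE r := by
  rw [f.tailE_of_pos hr, f.tailE_of_pos (hr.trans_le hrs)]
  exact ENNReal.ofReal_le_ofReal (f.tail_anti hr hrs)

/-- The integrated tail. -/
def intTail (δ : ℝ) : ℝ≥0∞ := ∫⁻ y in Ioc 0 δ, f.tailE y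

theorem lintegral_tailE_sub (t : ℝ) {a b : ℝ} :
    ∫⁻ y in Ico a b, f.tailE (t - y) = ∫⁻ r in Ioc (t - b) (t - a), f.tailE r := by
  rw [← lintegral_indicator measurableSet_Ico, ← lintegral_indicator measurableSet_Ioc,
    ← lintegral_sub_left_eq_self ((Ioc (t - b) (t - a)).indicator f.tailE) t]
  refine lintegral_congr fun y => ?_
  have : y ∈ Ico a b ↔ t - y ∈ Ioc (t - b) (t - a) := by
    simp only [mem_Ico, mem_Ioc]; constructor <;> rintro ⟨h1, h2⟩ <;> constructor <;> linarith
  by_cases hy : y ∈ Ico a b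
  · rw [indicator_of_mem hy, indicator_of_mem (this.1 hy)]
  · rw [indicator_of_notMem hy, indicator_of_notMem (fun h => hy (this.2 h))]

theorem tendsto_intTail : Tendsto (fun δ => (f.intTail |δ|).toReal) (𝓝 0) (𝓝 0) := by
  have h1 : Tendsto (fun δ : ℝ => ∫⁻ y in Ioc 0 |δ|, (Ioc (0 : ℝ) 1).indicator f.tailE y) (𝓝 0)
      (𝓝 0) := by
    refine tendsto_setLIntegral_zero ?_ ?_
    · rw [lintegral_indicator measurableSet_Ioc]; exact (f.lintegral_tailE_Ioc_lt_top 1).ne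
    · change Tendsto (fun δ : ℝ => volume (Ioc 0 |δ|)) _ _
      simp only [Real.volume_Ioc, sub_zero]
      have : Continuous fun δ : ℝ => ENNReal.ofReal |δ| :=
        ENNReal.continuous_ofReal.comp continuous_abs
      simpa [Function.comp_def] using this.tendsto 0
  have h2 := (ENNReal.tendsto_toReal ENNReal.zero_ne_top).comp h1
  refine h2.congr' ?_
  filter_upwards [Metric.ball_mem_nhds (0 : ℝ) one_pos] with δ hδ
  simp only [Function.comp, intTail]
  congr 1
  refine setLIntegral_congr_fun measurableSet_Ioc fun y hy => ?_
  rw [mem_ball_zero_iff, Real.norm_eq_abs] at hδ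
  exact (indicator_of_mem (mem_Ioc.2 ⟨hy.1, hy.2.trans hδ.le⟩) _)

end BernsteinTriplet

section BoundedDensity

variable {f : BernsteinTriplet} {g : ℝ → ℝ≥0∞} {C : ℝ≥0∞}

theorem tailConv_withDensity (f : BernsteinTriplet) (hg : Measurable g) (t : ℝ) :
    tailConv f (volume.withDensity g) t = ∫⁻ y, f.tailE (t - y) * g y := by
  rw [tailConv, lintegral_withDensity_eq_lintegral_mul _ hg (by fun_prop)]
  simp_rw [Pi.mul_apply, mul_comm]

/-- Moving t forward decreases the tail at every y < t; only the new range [t, t') adds mass, at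
most C times the tail integrated over (0, t' - t]. -/
theorem tailConv_le_add (f : BernsteinTriplet) (hg : Measurable g) (hgC : ∀ y, g y ≤ C) {t t' : ℝ}
    (htt : t ≤ t') : tailConv f (volume.withDensity g) t' ≤
      tailConv f (volume.withDensity g) t + C * f.intTail (t' - t) := by
  rw [tailConv_withDensity f hg, tailConv_withDensity f hg]
  have h1 : ∀ y, f.tailE (t' - y) * g y ≤
      f.tailE (t - y) * g y + C * (Ico t t').indicator (fun y => f.tailE (t' - y)) y := by
    intro y
    rcases lt_or_ge y t with hy | hy
    · refine le_add_right ?_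
      gcongr
      exact f.tailE_anti (sub_pos.2 hy) (by linarith)
    · refine le_add_left ?_
      rcases lt_or_ge y t' with hy' | hy'
      · rw [indicator_of_mem (mem_Ico.2 ⟨hy, hy'⟩), mul_comm]
        gcongr
        exact hgC y
      · rw [f.tailE_of_nonpos (by linarith), zero_mul]; exact zero_le
  refine (lintegral_mono h1).trans ?_
  rw [lintegral_add_left (by fun_prop), lintegral_const_mul _
    (Measurable.indicator (by fun_prop) measurableSet_Ico), lintegral_indicator measurableSet_Ico,
    f.lintegral_tailE_sub, sub_self, BernsteinTriplet.intTail]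

/-- The loss between t and t' is at most C ∫_0^t (ν(t - y) - ν(t' - y)) dy, and monotonicity of the
integrated tail bounds this telescoping difference by its value at t' - t. -/
theorem tailConv_le_add' (f : BernsteinTriplet) (hg : Measurable g) (hgC : ∀ y, g y ≤ C)
    (hg0 : ∀ y ≤ 0, g y = 0) {t t' : ℝ} (ht : 0 ≤ t) (htt : t ≤ t') :
    tailConv f (volume.withDensity g) t ≤
      tailConv f (volume.withDensity g) t' + C * f.intTail (t' - t) := by
  rw [tailConv_withDensity f hg, tailConv_withDensity f hg]
  have h1 : ∀ y, f.tailE (t - y) * g y ≤ f.tailE (t' - y) * g y +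
      C * (Ico 0 t).indicator (fun y => f.tailE (t - y) - f.tailE (t' - y)) y := by
    intro y
    rcases lt_or_ge y 0 with hy0 | hy0
    · simp [hg0 y hy0.le]
    rcases lt_or_ge y t with hy | hy
    · rw [indicator_of_mem (mem_Ico.2 ⟨hy0, hy⟩)]
      calc f.tailE (t - y) * g y ≤ (f.tailE (t' - y) + (f.tailE (t - y) - f.tailE (t' - y))) * g y := by
            gcongr; exact le_add_tsub
        _ = f.tailE (t' - y) * g y + g y * (f.tailE (t - y) - f.tailE (t' - y)) := by
            rw [add_mul, mul_comm (g y)]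
        _ ≤ _ := by gcongr; exact hgC y
    · rw [f.tailE_of_nonpos (by linarith), zero_mul]; exact zero_le
  refine (lintegral_mono h1).trans ?_
  have hfin : ∫⁻ y in Ico 0 t, f.tailE (t' - y) ≠ ∞ := by
    rw [f.lintegral_tailE_sub, sub_zero]
    refine ((lintegral_mono_set (Ioc_subset_Ioc_left (by linarith))).trans_lt
      (f.lintegral_tailE_Ioc_lt_top t')).ne
  rw [lintegral_add_left (by fun_prop), lintegral_const_mul _
    (Measurable.indicator (by fun_prop) measurableSet_Ico), lintegral_indicator measurableSet_Ico,
    lintegral_sub (by fun_prop) hfin]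
  · gcongr
    simp only [tsub_le_iff_right, f.lintegral_tailE_sub, sub_self, sub_zero,
      BernsteinTriplet.intTail]
    have e : Ioc 0 t' = Ioc 0 (t' - t) ∪ Ioc (t' - t) t' :=
      (Ioc_union_Ioc_eq_Ioc (by linarith) (by linarith)).symm
    calc ∫⁻ r in Ioc 0 t, f.tailE r ≤ ∫⁻ r in Ioc 0 t', f.tailE r :=
          lintegral_mono_set (Ioc_subset_Ioc_right htt)
      _ ≤ _ := by rw [e]; exact lintegral_union_le _ _ _
  · filter_upwards [ae_restrict_mem measurableSet_Ico] with y hy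
    exact f.tailE_anti (sub_pos.2 hy.2) (by linarith)

theorem tailConv_lt_top (f : BernsteinTriplet) (hg : Measurable g) (hgC : ∀ y, g y ≤ C)
    (hC : C ≠ ∞) (hg0 : ∀ y ≤ 0, g y = 0) (t : ℝ) :
    tailConv f (volume.withDensity g) t < ∞ := by
  have h0 : tailConv f (volume.withDensity g) 0 = 0 := by
    rw [tailConv_withDensity f hg]
    refine (lintegral_congr fun y => ?_).trans lintegral_zero
    rcases le_or_gt y 0 with hy | hy
    · rw [hg0 y hy, mul_zero]
    · rw [f.tailE_of_nonpos (by linarith), zero_mul]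
  rcases le_or_gt t 0 with ht | ht
  · have : tailConv f (volume.withDensity g) t = 0 := by
      rw [tailConv_withDensity f hg]
      refine (lintegral_congr fun y => ?_).trans lintegral_zero
      rcases le_or_gt y 0 with hy | hy
      · rw [hg0 y hy, mul_zero]
      · rw [f.tailE_of_nonpos (by linarith), zero_mul]
    rw [this]; exact ENNReal.zero_lt_top
  · have := tailConv_le_add f hg hgC ht.le
    rw [h0, zero_add] at this
    exact this.trans_lt (ENNReal.mul_lt_top hC.lt_top (f.lintegral_tailE_Ioc_lt_top _))

theorem continuousOn_tailConv (f : BernsteinTriplet) (hg : Measurable g) (hgC : ∀ y, g y ≤ C)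
    (hC : C ≠ ∞) (hg0 : ∀ y ≤ 0, g y = 0) :
    ContinuousOn (fun t => (tailConv f (volume.withDensity g) t).toReal) (Ioi 0) := by
  set W := tailConv f (volume.withDensity g) with hW
  have hfin : ∀ t, W t ≠ ∞ := fun t => (tailConv_lt_top f hg hgC hC hg0 t).ne
  have hN : ∀ δ, f.intTail δ ≠ ∞ := fun δ => (f.lintegral_tailE_Ioc_lt_top δ).ne
  have hle : ∀ t t', 0 ≤ t → t ≤ t' →
      |(W t').toReal - (W t).toReal| ≤ C.toReal * (f.intTail (t' - t)).toReal := by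
    intro t t' ht htt
    have h1 := ENNReal.toReal_mono (by finiteness [hfin t, hN (t' - t)])
      (tailConv_le_add f hg hgC htt)
    have h2 := ENNReal.toReal_mono (by finiteness [hfin t', hN (t' - t)])
      (tailConv_le_add' f hg hgC hg0 ht htt)
    rw [ENNReal.toReal_add (hfin _) (ENNReal.mul_ne_top hC (hN _)), ENNReal.toReal_mul] at h1 h2
    rw [abs_le]
    constructor <;> linarith
  intro t ht
  refine ContinuousAt.continuousWithinAt ?_
  rw [ContinuousAt, tendsto_iff_dist_tendsto_zero]
  have hlim : Tendsto (fun t' => C.toReal * (f.intTail |t' - t|).toReal) (𝓝 t) (𝓝 0) := by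
    have h1 : Tendsto (fun t' => t' - t) (𝓝 t) (𝓝 0) := by
      have : Continuous fun t' : ℝ => t' - t := by fun_prop
      simpa using this.tendsto t
    simpa using (f.tendsto_intTail.comp h1).const_mul C.toReal
  refine tendsto_of_tendsto_of_tendsto_of_le_of_le' tendsto_const_nhds hlim
    (Eventually.of_forall fun _ => dist_nonneg) ?_
  filter_upwards [Ioi_mem_nhds ht] with t' ht'
  rw [Real.dist_eq]
  rcases le_total t t' with hle' | hle'
  · rw [abs_of_nonneg (sub_nonneg.2 hle')]; exact hle t t' (le_of_lt ht) hle'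
  · rw [abs_sub_comm, abs_sub_comm t', abs_of_nonneg (sub_nonneg.2 hle')]
    exact hle t' t (le_of_lt ht') hle'

end BoundedDensity

/-! ### The convolution equation at every time. -/

namespace IsInversePair

variable {f : BernsteinTriplet} {P Q : Kernel ℝ ℝ} {κ : ℝ → ℝ≥0∞}

theorem lintegral_right_le_one [IsMarkovKernel Q] (hκ1 : ∀ x, κ x ≤ 1) (t : ℝ) :
    ∫⁻ x, κ x ∂(Q t) ≤ 1 :=
  (lintegral_mono hκ1).trans (by simp)

/-- Fatou's lemma along times r n > t tending to t at which the a.e. equation holds. The integrand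
converges off y = t, where V has no atom, and the right side converges by the assumed continuity. -/
theorem tailConv_le (h : IsInversePair f P Q) (hf : f.ConditionI) [IsMarkovKernel Q]
    (hκ : Measurable κ) (hκ1 : ∀ x, κ x ≤ 1)
    (hc : ContinuousOn (fun t => ∫⁻ x, κ x ∂(Q t)) (Ioi 0)) {t : ℝ} (ht : 0 < t) :
    tailConv f (potential P κ) t ≤ ∫⁻ x, κ x ∂(Q t) := by
  set V := potential P κ with hV
  have hgood : ∀ n : ℕ, ∃ r ∈ Ioo t (t + 1 / ((n : ℝ) + 1)),
      tailConv f V r ≤ ∫⁻ x, κ x ∂(Q r) := by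
    intro n
    have hpos : volume (Ioo t (t + 1 / ((n : ℝ) + 1))) ≠ 0 := by
      rw [Real.volume_Ioo, ne_eq, ENNReal.ofReal_eq_zero, not_le]
      have : (0 : ℝ) < 1 / ((n : ℝ) + 1) := by positivity
      linarith
    obtain ⟨r, hr, hr'⟩ := ((frequently_ae_mem_iff.2 hpos).and_eventually
      (h.ae_rnDeriv_add_tailConv hf hκ hκ1)).exists
    exact ⟨r, hr, by rw [← hr' (ht.trans hr.1)]; exact le_add_self⟩
  choose r hr hle using hgood
  have hrt : Tendsto r atTop (𝓝 t) := by
    have h1 : Tendsto (fun n : ℕ => t + 1 / ((n : ℝ) + 1)) atTop (𝓝 t) := by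
      simpa using (tendsto_one_div_add_atTop_nhds_zero_nat (𝕜 := ℝ)).const_add t
    exact tendsto_of_tendsto_of_tendsto_of_le_of_le tendsto_const_nhds h1
      (fun n => (hr n).1.le) (fun n => (hr n).2.le)
  have hE : Tendsto (fun n => ∫⁻ x, κ x ∂(Q (r n))) atTop (𝓝 (∫⁻ x, κ x ∂(Q t))) :=
    (hc.continuousAt (Ioi_mem_nhds ht)).tendsto.comp hrt
  have hne : ∀ᵐ y ∂V, y ≠ t :=
    (h.potential_absolutelyContinuous hf hκ).ae_le (Measure.ae_ne volume t)
  calc tailConv f V t = ∫⁻ y, liminf (fun n => f.tailE (r n - y)) atTop ∂V := by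
        refine lintegral_congr_ae ?_
        filter_upwards [hne] with y hy
        refine (Tendsto.liminf_eq ?_).symm
        refine (hf.continuousAt_tailE (sub_ne_zero.2 hy.symm)).tendsto.comp ?_
        exact hrt.sub_const y
    _ ≤ liminf (fun n => tailConv f V (r n)) atTop :=
        lintegral_liminf_le fun n => by fun_prop
    _ ≤ liminf (fun n => ∫⁻ x, κ x ∂(Q (r n))) atTop := liminf_le_liminf (Eventually.of_forall hle)
    _ = _ := hE.liminf_eq

/-- On Y(t) > ε the Markov property writes the expectation as an average over y ~ `P ε` of E κ(ε +
Y(t - y)). As `P ε` is absolutely continuous, the a.e. equation at time t - y suffices. The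
semigroup property P_ε ∗ P_x = P_{ε+x} reassembles the part of `tailConv` with operational time
above ε. -/
theorem le_tailConv_of_drift_eq_zero (h : IsInversePair f P Q) (hf : f.ConditionI)
    [IsMarkovKernel Q] (hb : f.b = 0) (hκ : Measurable κ) (hκ1 : ∀ x, κ x ≤ 1) {ε t : ℝ}
    (hε : 0 < ε) (ht : 0 < t) :
    ∫⁻ x in Ioi ε, κ x ∂(Q t) ≤ tailConv f (potential P κ) t := by
  have hκε : Measurable fun z => κ (ε + z) := hκ.comp (measurable_const_add ε)
  have hae := h.ae_rnDeriv_add_tailConv hf hκε fun x => hκ1 _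
  rw [hb] at hae
  simp only [ENNReal.ofReal_zero, zero_mul, zero_add] at hae
  have hae2 : ∀ᵐ y : ℝ, 0 < t - y → tailConv f (potential P fun z => κ (ε + z)) (t - y) =
      ∫⁻ x, κ (ε + x) ∂(Q (t - y)) := (quasiMeasurePreserving_sub_left volume t).ae hae
  have := h.isFiniteMeasure_left ε
  have := h.isFiniteKernel_left
  calc ∫⁻ x in Ioi ε, κ x ∂(Q t)
      = ∫⁻ y in Iio t, ∫⁻ z, κ (ε + z) ∂(Q (t - y)) ∂(P ε) := h.restrict_right hf hε ht hκ
    _ = ∫⁻ y in Iio t, tailConv f (potential P fun z => κ (ε + z)) (t - y) ∂(P ε) := by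
        refine lintegral_congr_ae ?_
        filter_upwards [ae_restrict_of_ae ((h.absolutelyContinuous_left hf hε).ae_le hae2),
          ae_restrict_mem measurableSet_Iio] with y hy hy'
        exact (hy (sub_pos.2 hy')).symm
    _ ≤ ∫⁻ y, tailConv f (potential P fun z => κ (ε + z)) (t - y) ∂(P ε) :=
        setLIntegral_le_lintegral _ _
    _ = ∫⁻ y, (∫⁻ x in Ioi 0, κ (ε + x) * ∫⁻ w, f.tailE (t - y - w) ∂(P x)) ∂(P ε) := by
        refine lintegral_congr fun y => ?_
        rw [tailConv, lintegral_potential hκε (by fun_prop)]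
    _ = ∫⁻ x in Ioi 0, (∫⁻ y, κ (ε + x) * (∫⁻ w, f.tailE (t - y - w) ∂(P x)) ∂(P ε)) := by
        refine lintegral_lintegral_swap ?_
        refine Measurable.aemeasurable ?_
        refine (hκε.comp measurable_snd).mul ?_
        have hm : Measurable fun p : (ℝ × ℝ) × ℝ => f.tailE (t - p.1.1 - p.2) := by fun_prop
        exact Measurable.lintegral_kernel_prod_right (κ := P.comap Prod.snd measurable_snd) hm
    _ = ∫⁻ x in Ioi 0, κ (ε + x) * ∫⁻ w, f.tailE (t - w) ∂(P (ε + x)) := by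
        refine setLIntegral_congr_fun measurableSet_Ioi fun x hx => ?_
        have := h.isFiniteMeasure_left x
        have hm : Measurable fun p : ℝ × ℝ => f.tailE (t - p.1 - p.2) := by fun_prop
        rw [lintegral_const_mul _ hm.lintegral_prod_right', h.left_add hε.le (le_of_lt hx),
          Measure.lintegral_conv (by fun_prop)]
        simp_rw [sub_sub]
    _ = ∫⁻ x in Ioi ε, κ x * ∫⁻ w, f.tailE (t - w) ∂(P x) := by
        rw [← lintegral_indicator measurableSet_Ioi, ← lintegral_indicator measurableSet_Ioi,
          ← lintegral_add_left_eq_self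
            ((Ioi ε).indicator fun x => κ x * ∫⁻ w, f.tailE (t - w) ∂(P x)) ε]
        refine lintegral_congr fun x => ?_
        by_cases hx : 0 < x
        · rw [indicator_of_mem (mem_Ioi.2 hx), indicator_of_mem (by simpa using hx)]
        · rw [indicator_of_notMem (by simpa using hx), indicator_of_notMem (by simpa using hx)]
    _ ≤ ∫⁻ x in Ioi 0, κ x * ∫⁻ w, f.tailE (t - w) ∂(P x) :=
        lintegral_mono_set (Ioi_subset_Ioi hε.le)
    _ = _ := by rw [tailConv, lintegral_potential hκ (by fun_prop)]

/-- The part of the expectation lost to Y(t) ≤ ε vanishes as ε → 0, because Y(t) > 0 almost surely.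
-/
theorem tailConv_eq_of_drift_eq_zero (h : IsInversePair f P Q) (hf : f.ConditionI)
    [IsMarkovKernel Q] (hb : f.b = 0) (hκ : Measurable κ) (hκ1 : ∀ x, κ x ≤ 1)
    (hc : ContinuousOn (fun t => ∫⁻ x, κ x ∂(Q t)) (Ioi 0)) {t : ℝ} (ht : 0 < t) :
    tailConv f (potential P κ) t = ∫⁻ x, κ x ∂(Q t) := by
  refine le_antisymm (h.tailConv_le hf hκ hκ1 hc ht) ?_
  have hle : ∀ x : ℝ, 0 < x → ∫⁻ x, κ x ∂(Q t) ≤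
      tailConv f (potential P κ) t + ENNReal.ofReal ((Q t).real (Iic x)) := by
    intro x hx
    rw [← lintegral_add_compl _ measurableSet_Ioi (A := Ioi x), compl_Ioi]
    gcongr
    · exact h.le_tailConv_of_drift_eq_zero hf hb hκ hκ1 hx ht
    · rw [ofReal_measureReal, ← setLIntegral_one]
      exact lintegral_mono hκ1
  have hlim : Tendsto (fun x => tailConv f (potential P κ) t +
      ENNReal.ofReal ((Q t).real (Iic x))) (𝓝[>] 0) (𝓝 (tailConv f (potential P κ) t + 0)) := by
    refine Tendsto.const_add _ ?_
    simpa using ENNReal.tendsto_ofReal (h.tendsto_right_Iic hf ht)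
  rw [add_zero] at hlim
  refine ge_of_tendsto hlim ?_
  filter_upwards [self_mem_nhdsWithin] with x hx using hle x hx

/-- The weighted potential has a density `g` with `b g(t) + (ν ∗ V)(t) = E κ(Y(t))` at every
time, and `g` is continuous in the presence of a drift. -/
theorem exists_density (h : IsInversePair f P Q) (hf : f.ConditionI) [IsMarkovKernel Q]
    (hκ : Measurable κ) (hκ1 : ∀ x, κ x ≤ 1)
    (hc : ContinuousOn (fun t => ∫⁻ x, κ x ∂(Q t)) (Ioi 0)) :
    ∃ g : ℝ → ℝ, Measurable g ∧ (∀ y, 0 ≤ g y) ∧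
      potential P κ = volume.withDensity (fun y => ENNReal.ofReal (g y)) ∧
      (∀ t, 0 < t → ENNReal.ofReal f.b * ENNReal.ofReal (g t) + tailConv f (potential P κ) t =
        ∫⁻ x, κ x ∂(Q t)) ∧
      (f.b ≠ 0 → ContinuousOn g (Ioi 0)) := by
  have := h.sigmaFinite_potential hf hκ hκ1
  have hvm := Measure.measurable_rnDeriv (potential P κ) volume
  have hvV := h.withDensity_rnDeriv_potential hf hκ hκ1
  set V := potential P κ with hV
  by_cases hb : f.b = 0
  -- Without drift the value of g at a point does not enter the equation, so any version of the
  -- density will do.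
  · refine ⟨fun y => (V.rnDeriv volume y).toReal, hvm.ennreal_toReal,
      fun y => ENNReal.toReal_nonneg, ?_, fun t ht => ?_, fun hne => absurd hb hne⟩
    · conv_lhs => rw [← hvV]
      refine withDensity_congr_ae ?_
      filter_upwards [Measure.rnDeriv_lt_top V volume] with y hy
      rw [ENNReal.ofReal_toReal hy.ne]
    · rw [hb, ENNReal.ofReal_zero, zero_mul, zero_add]
      exact h.tailConv_eq_of_drift_eq_zero hf hb hκ hκ1 hc ht
  · have hb0 : 0 < f.b := lt_of_le_of_ne f.b_nonneg (Ne.symm hb)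
    have hWm := IsInversePair.measurable_tailConv f V
    have hEm : Measurable fun t => ∫⁻ x, κ x ∂(Q t) := hκ.lintegral_kernel
    set E : ℝ → ℝ := fun t => (∫⁻ x, κ x ∂(Q t)).toReal with hE
    have hEfin : ∀ t, ∫⁻ x, κ x ∂(Q t) ≠ ∞ := fun t =>
      ((lintegral_right_le_one hκ1 t).trans_lt ENNReal.one_lt_top).ne
    have hE1 : ∀ t, E t ≤ 1 := fun t =>
      ENNReal.toReal_mono ENNReal.one_ne_top (lintegral_right_le_one hκ1 t)
    -- With b > 0 the equation is solved for the density. The truncation at 0 and E κ ≤ 1 bound g by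
    -- 1/b at once; boundedness makes ν ∗ g continuous, hence g continuous; and `tailConv_le` shows
    -- afterwards that the truncation never acts.
    set g : ℝ → ℝ := (Ioi (0 : ℝ)).indicator
      fun t => max 0 ((E t - (tailConv f V t).toReal) / f.b) with hg
    have hgm : Measurable g := by
      refine Measurable.indicator ?_ measurableSet_Ioi
      exact measurable_const.max
        ((hEm.ennreal_toReal.sub hWm.ennreal_toReal).div_const _)
    have hg0 : ∀ y, 0 ≤ g y := fun y => indicator_nonneg (fun t _ => le_max_left _ _) y
    have hgC : ∀ y, ENNReal.ofReal (g y) ≤ ENNReal.ofReal (1 / f.b) := by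
      intro y
      refine ENNReal.ofReal_le_ofReal ?_
      by_cases hy : y ∈ Ioi (0 : ℝ)
      · rw [hg, indicator_of_mem hy]
        refine max_le (by positivity) ?_
        gcongr
        linarith [hE1 y, ENNReal.toReal_nonneg (a := tailConv f V y)]
      · rw [hg, indicator_of_notMem hy]
        positivity
    have hgneg : ∀ y ≤ 0, ENNReal.ofReal (g y) = 0 := by
      intro y hy
      rw [hg, indicator_of_notMem (by simpa using hy), ENNReal.ofReal_zero]
    have hae := h.ae_rnDeriv_add_tailConv hf hκ hκ1
    have hneg : ∀ᵐ y, y ∈ Iic (0 : ℝ) → V.rnDeriv volume y = 0 := by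
      have h1 := h.potential_Iic hf hκ
      rw [← hV, ← hvV, withDensity_apply _ measurableSet_Iic, lintegral_eq_zero_iff hvm] at h1
      exact (ae_restrict_iff' measurableSet_Iic).1 h1
    have hVg : V = volume.withDensity fun y => ENNReal.ofReal (g y) := by
      conv_lhs => rw [← hvV]
      refine withDensity_congr_ae ?_
      filter_upwards [hae, hneg] with t ht ht'
      rcases le_or_gt t 0 with h0 | h0
      · rw [ht' h0, hgneg t h0]
      · have h1 := ht h0
        have hWfin : tailConv f V t ≠ ∞ := by
          intro htop; rw [htop, add_top] at h1; exact hEfin t h1.symm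
        have hvfin : V.rnDeriv volume t ≠ ∞ := by
          intro htop
          rw [htop, ENNReal.mul_top (by simpa using hb0), top_add] at h1
          exact hEfin t h1.symm
        have h2 : E t = f.b * (V.rnDeriv volume t).toReal + (tailConv f V t).toReal := by
          simp only [hE]
          rw [← h1, ENNReal.toReal_add (by finiteness) hWfin, ENNReal.toReal_mul,
            ENNReal.toReal_ofReal hb0.le]
        have h3 : (E t - (tailConv f V t).toReal) / f.b = (V.rnDeriv volume t).toReal := by
          rw [h2]; field_simp; ring
        rw [hg, indicator_of_mem (mem_Ioi.2 h0), h3, max_eq_right ENNReal.toReal_nonneg,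
          ENNReal.ofReal_toReal hvfin]
    have hgEm : Measurable fun y => ENNReal.ofReal (g y) := hgm.ennreal_ofReal
    have hWc : ContinuousOn (fun t => (tailConv f V t).toReal) (Ioi 0) := by
      rw [hVg]; exact continuousOn_tailConv f hgEm hgC ENNReal.ofReal_ne_top hgneg
    have hWfin : ∀ t, tailConv f V t ≠ ∞ := by
      rw [hVg]; exact fun t => (tailConv_lt_top f hgEm hgC ENNReal.ofReal_ne_top hgneg t).ne
    have hEc : ContinuousOn E (Ioi 0) := fun t ht =>
      (ENNReal.tendsto_toReal (hEfin t)).comp (hc t ht)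
    have hWE : ∀ t, 0 < t → (tailConv f V t).toReal ≤ E t := fun t ht =>
      ENNReal.toReal_mono (hEfin t) (h.tailConv_le hf hκ hκ1 hc ht)
    have hgeq : ∀ t, 0 < t → g t = (E t - (tailConv f V t).toReal) / f.b := by
      intro t ht
      rw [hg, indicator_of_mem (mem_Ioi.2 ht), max_eq_right]
      exact div_nonneg (sub_nonneg.2 (hWE t ht)) hb0.le
    refine ⟨g, hgm, hg0, hVg, fun t ht => ?_, fun _ => ?_⟩
    · rw [← ENNReal.ofReal_mul hb0.le, hgeq t ht, mul_div_cancel₀ _ hb,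
        ENNReal.ofReal_sub _ ENNReal.toReal_nonneg, ENNReal.ofReal_toReal (hWfin t), hE,
        ENNReal.ofReal_toReal (hEfin t), tsub_add_cancel_of_le]
      exact h.tailConv_le hf hκ hκ1 hc ht
    · exact ((hEc.sub hWc).div_const f.b).congr fun t ht => hgeq t ht

end IsInversePair

/-! ### The convolution-type derivative of expectations under the inverse. -/

theorem absolutelyContinuousOnInterval_congr {u v : ℝ → ℝ} {a b : ℝ}
    (hu : AbsolutelyContinuousOnInterval u a b) (h : EqOn u v (uIcc a b)) :
    AbsolutelyContinuousOnInterval v a b := by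
  rw [absolutelyContinuousOnInterval_iff] at hu ⊢
  intro ε hε
  obtain ⟨δ, hδ, hlt⟩ := hu ε hε
  refine ⟨δ, hδ, fun E hE hEδ => ?_⟩
  convert! hlt E hE hEδ using 1
  refine Finset.sum_congr rfl fun i hi => ?_
  have := hE.1 i hi
  rw [h this.1, h this.2]

/-- The convolution-type derivative of an indefinite integral. -/
theorem convDeriv_of_integral (f : BernsteinTriplet) {g u : ℝ → ℝ} {t : ℝ} (ht : 0 < t)
    (hg : ∀ a b, IntervalIntegrable g volume a b)
    (hu : ∀ r, 0 ≤ r → u r = u 0 + ∫ x in (0 : ℝ)..r, g x)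
    (hconv : IntervalIntegrable (fun s => g (t - s) * f.tail s) volume 0 t)
    (hcont : f.b ≠ 0 → ContinuousOn g (Ioi 0)) :
    f.ConvDifferentiableAt u t ∧
      f.convDeriv u t = f.b * g t + ∫ s in (0 : ℝ)..t, g (t - s) * f.tail s := by
  have hev : ∀ r, 0 < r → u =ᶠ[𝓝 r] fun r => u 0 + ∫ x in (0 : ℝ)..r, g x := fun r hr => by
    filter_upwards [Ioi_mem_nhds hr] with x hx using hu x (le_of_lt hx)
  -- Almost everywhere is enough under the convolution integral. At t itself the derivative matters
  -- only if b ≠ 0, and then continuity of g provides it.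
  have hder : ∀ᵐ x, x ∈ Ioc 0 t → deriv u x = g x := by
    filter_upwards [(hg 0 t).ae_hasDerivAt_integral] with x hx hxt
    rw [(hev x hxt.1).deriv_eq]
    refine ((hx ?_ 0 left_mem_uIcc).const_add _).deriv
    rw [uIcc_of_le ht.le]
    exact Ioc_subset_Icc_self hxt
  have hder2 : ∀ᵐ s, s ∈ Ico 0 t → deriv u (t - s) = g (t - s) := by
    filter_upwards [(quasiMeasurePreserving_sub_left volume t).ae hder] with s hs hst
    exact hs ⟨sub_pos.2 hst.2, by linarith [hst.1]⟩
  have hder3 : ∀ᵐ s, s ∈ uIoc 0 t → g (t - s) * f.tail s = deriv u (t - s) * f.tail s := by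
    rw [uIoc_of_le ht.le]
    filter_upwards [hder2, Measure.ae_ne volume t] with s hs hne hst
    rw [hs ⟨hst.1.le, lt_of_le_of_ne hst.2 hne⟩]
  have hdt : f.b ≠ 0 → HasDerivAt u (g t) t := fun hb => by
    have hc : ContinuousAt g t := (hcont hb).continuousAt (Ioi_mem_nhds ht)
    have hm : StronglyMeasurableAtFilter g (𝓝 t) volume :=
      (hcont hb).stronglyMeasurableAtFilter isOpen_Ioi t ht
    exact ((intervalIntegral.integral_hasDerivAt_right (hg 0 t) hm hc).const_add
      (u 0)).congr_of_eventuallyEq (hev t ht)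
  refine ⟨⟨?_, fun hb => (hdt hb).differentiableAt, ?_⟩, ?_⟩
  · have hconst : AbsolutelyContinuousOnInterval (fun _ : ℝ => u 0) 0 t := by
      simpa [AbsolutelyContinuousOnInterval] using tendsto_const_nhds
    refine absolutelyContinuousOnInterval_congr
      (hconst.add ((hg 0 t).absolutelyContinuousOnInterval_intervalIntegral left_mem_uIcc))
      fun r hr => ?_
    rw [uIcc_of_le ht.le] at hr
    exact (hu r hr.1).symm
  · exact hconv.congr_ae ((ae_restrict_iff' measurableSet_uIoc).2 hder3)
  · rw [BernsteinTriplet.convDeriv, intervalIntegral.integral_congr_ae hder3]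
    congr 1
    by_cases hb : f.b = 0
    · simp [hb]
    · rw [(hdt hb).deriv]

section Density

variable {V : Measure ℝ} {g : ℝ → ℝ}

theorem intervalIntegrable_of_withDensity (hgm : Measurable g) (hg0 : ∀ y, 0 ≤ g y)
    (hV : V = volume.withDensity fun y => ENNReal.ofReal (g y)) (hfin : ∀ t, V (Iic t) < ∞) :
    ∀ t, IntegrableOn g (Iic t) := by
  intro t
  refine ⟨hgm.aestronglyMeasurable, ?_⟩
  rw [hasFiniteIntegral_iff_ofReal (ae_of_all _ hg0)]
  have := hfin t
  rwa [hV, withDensity_apply _ measurableSet_Iic] at this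

theorem measureReal_Iic_of_withDensity (hgm : Measurable g) (hg0 : ∀ y, 0 ≤ g y)
    (hV : V = volume.withDensity fun y => ENNReal.ofReal (g y)) (hfin : ∀ t, V (Iic t) < ∞)
    (h0 : V (Iic 0) = 0) {t : ℝ} (ht : 0 ≤ t) : V.real (Iic t) = ∫ x in (0 : ℝ)..t, g x := by
  have hi := intervalIntegrable_of_withDensity hgm hg0 hV hfin t
  rw [measureReal_def, intervalIntegral.integral_of_le ht,
    integral_eq_lintegral_of_nonneg_ae (ae_of_all _ hg0) hgm.aestronglyMeasurable,
    ← withDensity_apply _ measurableSet_Ioc, ← hV, ← Iic_union_Ioc_eq_Iic ht]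
  rw [measure_union (by
      rw [Set.disjoint_left]; exact fun x hx hx' => not_lt.2 hx hx'.1) measurableSet_Ioc, h0,
      zero_add]

end Density

namespace IsInversePair

variable {f : BernsteinTriplet} {P Q : Kernel ℝ ℝ} {κ : ℝ → ℝ}

/-- The distribution function is a primitive of a locally integrable density. This is the source of
the continuity hypothesis in `exists_density`. -/
theorem continuousOn_potential_Iic (h : IsInversePair f P Q) (hf : f.ConditionI)
    {κ : ℝ → ℝ≥0∞} (hκ : Measurable κ) (hκ1 : ∀ x, κ x ≤ 1) :
    ContinuousOn (fun t => (potential P κ).real (Iic t)) (Ioi 0) := by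
  have := h.sigmaFinite_potential hf hκ hκ1
  set g := fun y => ((potential P κ).rnDeriv volume y).toReal with hg
  have hgm : Measurable g := (Measure.measurable_rnDeriv _ _).ennreal_toReal
  have hV : potential P κ = volume.withDensity fun y => ENNReal.ofReal (g y) := by
    conv_lhs => rw [← h.withDensity_rnDeriv_potential hf hκ hκ1]
    refine withDensity_congr_ae ?_
    filter_upwards [Measure.rnDeriv_lt_top (potential P κ) volume] with y hy
    rw [ENNReal.ofReal_toReal hy.ne]
  have hi := intervalIntegrable_of_withDensity hgm (fun y => ENNReal.toReal_nonneg) hV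
    (h.potential_Iic_lt_top hf hκ hκ1)
  have hc := intervalIntegral.continuous_primitive (μ := volume) (f := g) (fun a b =>
    ((hi (max a b)).mono_set fun x hx => hx.2).intervalIntegrable) 0
  refine hc.continuousOn.congr fun t ht => ?_
  exact measureReal_Iic_of_withDensity hgm (fun y => ENNReal.toReal_nonneg) hV
    (h.potential_Iic_lt_top hf hκ hκ1) (h.potential_Iic hf hκ) (le_of_lt ht)

/-- `exists_density` transferred to real integrals; absolute convergence of the convolution comes
from ν ∗ V ≤ E κ(Y(t)) ≤ 1. -/
theorem exists_real_density (h : IsInversePair f P Q) (hf : f.ConditionI) [IsMarkovKernel Q]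
    (hκ : Measurable κ) (hκ0 : ∀ x, 0 ≤ κ x) (hκ1 : ∀ x, κ x ≤ 1)
    (hc : ContinuousOn (fun t => ∫ x, κ x ∂(Q t)) (Ioi 0)) :
    ∃ g : ℝ → ℝ, (∀ a b, IntervalIntegrable g volume a b) ∧
      (∀ t, 0 ≤ t → (potential P fun x => ENNReal.ofReal (κ x)).real (Iic t) =
        ∫ x in (0 : ℝ)..t, g x) ∧
      (∀ t, 0 < t → IntervalIntegrable (fun s => g (t - s) * f.tail s) volume 0 t ∧
        f.b * g t + ∫ s in (0 : ℝ)..t, g (t - s) * f.tail s = ∫ x, κ x ∂(Q t)) ∧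
      (f.b ≠ 0 → ContinuousOn g (Ioi 0)) := by
  have hκ' : Measurable fun x => ENNReal.ofReal (κ x) := hκ.ennreal_ofReal
  have hκ1' : ∀ x, ENNReal.ofReal (κ x) ≤ 1 := fun x => ENNReal.ofReal_le_one.2 (hκ1 x)
  have hint : ∀ t, Integrable κ (Q t) := fun t =>
    Integrable.of_bound hκ.aestronglyMeasurable 1 (ae_of_all _ fun x => by
      rw [Real.norm_of_nonneg (hκ0 x)]; exact hκ1 x)
  have hE : ∀ t, ∫⁻ x, ENNReal.ofReal (κ x) ∂(Q t) = ENNReal.ofReal (∫ x, κ x ∂(Q t)) :=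
    fun t => (ofReal_integral_eq_lintegral_ofReal (hint t) (ae_of_all _ hκ0)).symm
  have hc' : ContinuousOn (fun t => ∫⁻ x, ENNReal.ofReal (κ x) ∂(Q t)) (Ioi 0) := by
    simp_rw [hE]
    exact ENNReal.continuous_ofReal.comp_continuousOn hc
  obtain ⟨g, hgm, hg0, hV, heq, hgc⟩ := h.exists_density hf hκ' hκ1' hc'
  have hi := intervalIntegrable_of_withDensity hgm hg0 hV (h.potential_Iic_lt_top hf hκ' hκ1')
  refine ⟨g, fun a b => ((hi (max a b)).mono_set fun x hx => hx.2).intervalIntegrable,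
    fun t ht => measureReal_Iic_of_withDensity hgm hg0 hV (h.potential_Iic_lt_top hf hκ' hκ1')
      (h.potential_Iic hf hκ') ht, fun t ht => ?_, hgc⟩
  have hneg : ∀ᵐ y, y ∈ Iic (0 : ℝ) → ENNReal.ofReal (g y) = 0 := by
    have h1 := h.potential_Iic hf hκ'
    rw [hV, withDensity_apply _ measurableSet_Iic,
      lintegral_eq_zero_iff hgm.ennreal_ofReal] at h1
    exact (ae_restrict_iff' measurableSet_Iic).1 h1
  have hW : tailConv f (potential P fun x => ENNReal.ofReal (κ x)) t =
      ∫⁻ s in Ioc 0 t, ENNReal.ofReal (g (t - s) * f.tail s) := by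
    rw [hV, tailConv_withDensity f hgm.ennreal_ofReal, ← lintegral_indicator measurableSet_Ioc,
      ← lintegral_sub_left_eq_self (fun y => f.tailE (t - y) * ENNReal.ofReal (g y)) t]
    refine lintegral_congr_ae ?_
    filter_upwards [(quasiMeasurePreserving_sub_left volume t).ae hneg] with s hs
    rw [sub_sub_cancel]
    by_cases h0 : 0 < s
    · by_cases h1 : s ≤ t
      · rw [indicator_of_mem (mem_Ioc.2 ⟨h0, h1⟩), f.tailE_of_pos h0, mul_comm,
          ENNReal.ofReal_mul (hg0 _)]
      · rw [indicator_of_notMem (fun hm => h1 hm.2), hs (by simp; linarith), mul_zero]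
    · rw [indicator_of_notMem (fun hm => h0 hm.1), f.tailE_of_nonpos (not_lt.1 h0), zero_mul]
  have hm : Measurable fun s => g (t - s) * f.tail s :=
    (hgm.comp (measurable_const.sub measurable_id)).mul f.measurable_tail
  have hpos : ∀ s, 0 ≤ g (t - s) * f.tail s := fun s => mul_nonneg (hg0 _) (f.tail_nonneg s)
  have hWle : tailConv f (potential P fun x => ENNReal.ofReal (κ x)) t ≠ ∞ := by
    refine (lt_of_le_of_lt ?_ ENNReal.one_lt_top).ne
    refine le_trans ?_ (lintegral_right_le_one (Q := Q) hκ1' t)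
    rw [← heq t ht]
    exact le_add_self
  constructor
  · rw [intervalIntegrable_iff_integrableOn_Ioc_of_le ht.le]
    refine ⟨hm.aestronglyMeasurable, ?_⟩
    rw [hasFiniteIntegral_iff_ofReal (ae_of_all _ hpos), ← hW]
    exact hWle.lt_top
  · have h1 := congrArg ENNReal.toReal (heq t ht)
    rw [ENNReal.toReal_add (by finiteness) hWle, ENNReal.toReal_mul,
      ENNReal.toReal_ofReal f.b_nonneg, ENNReal.toReal_ofReal (hg0 t), hE,
      ENNReal.toReal_ofReal (integral_nonneg hκ0)] at h1
    rw [← h1, intervalIntegral.integral_of_le ht.le,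
      integral_eq_lintegral_of_nonneg_ae (ae_of_all _ hpos) hm.aestronglyMeasurable, ← hW]

/-- `E ∫_0^{Y(t)} κ = V_κ[0, t]`. -/
theorem integral_primitive_right (h : IsInversePair f P Q) (hf : f.ConditionI) [IsMarkovKernel Q]
    (hκ : Continuous κ) (hκ0 : ∀ x, 0 ≤ κ x) (hκ1 : ∀ x, κ x ≤ 1) {t : ℝ} (ht : 0 ≤ t) :
    Integrable (fun z => ∫ x in (0 : ℝ)..z, κ x) (Q t) ∧
      ∫ z, (∫ x in (0 : ℝ)..z, κ x) ∂(Q t) =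
        (potential P fun x => ENNReal.ofReal (κ x)).real (Iic t) := by
  have hκ' : Measurable fun x => ENNReal.ofReal (κ x) := hκ.measurable.ennreal_ofReal
  have hκ1' : ∀ x, ENNReal.ofReal (κ x) ≤ 1 := fun x => ENNReal.ofReal_le_one.2 (hκ1 x)
  have hcont : Continuous fun z => ∫ x in (0 : ℝ)..z, κ x :=
    intervalIntegral.continuous_primitive (fun a b => hκ.intervalIntegrable a b) 0
  have hnn : ∀ᵐ z ∂(Q t), 0 ≤ ∫ x in (0 : ℝ)..z, κ x := by
    filter_upwards [ae_nonneg_of_Iio (h.right_Iio t)] with z hz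
    exact intervalIntegral.integral_nonneg hz fun x _ => hκ0 x
  have hmeas : Measurable (Function.uncurry fun (z x : ℝ) =>
      (Iio z).indicator (fun x => ENNReal.ofReal (κ x)) x) := by
    have : (Function.uncurry fun (z x : ℝ) =>
        (Iio z).indicator (fun x => ENNReal.ofReal (κ x)) x) =
        {p : ℝ × ℝ | p.2 < p.1}.indicator fun p => ENNReal.ofReal (κ p.2) := by
      ext ⟨z, x⟩; simp [indicator]
    rw [this]
    exact (hκ'.comp measurable_snd).indicator (measurableSet_lt measurable_snd measurable_fst)
  -- Tonelli, writing the primitive as the integral of κ(x) over x < z, and then Q t (x, ∞) = P x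
  -- [0, t].
  have key : ∫⁻ z, ENNReal.ofReal (∫ x in (0 : ℝ)..z, κ x) ∂(Q t) =
      potential P (fun x => ENNReal.ofReal (κ x)) (Iic t) := by
    calc ∫⁻ z, ENNReal.ofReal (∫ x in (0 : ℝ)..z, κ x) ∂(Q t)
        = ∫⁻ z, (∫⁻ x in Ioi 0, (Iio z).indicator (fun x => ENNReal.ofReal (κ x)) x) ∂(Q t) := by
          refine lintegral_congr_ae ?_
          filter_upwards [ae_nonneg_of_Iio (h.right_Iio t)] with z hz
          rw [lintegral_indicator measurableSet_Iio, Measure.restrict_restrict measurableSet_Iio,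
            Iio_inter_Ioi, intervalIntegral.integral_of_le hz, integral_Ioc_eq_integral_Ioo,
            ofReal_integral_eq_lintegral_ofReal _ (ae_of_all _ hκ0)]
          exact (hκ.integrableOn_Icc).mono_set Ioo_subset_Icc_self
      _ = ∫⁻ x in Ioi 0, (∫⁻ z, (Iio z).indicator (fun x => ENNReal.ofReal (κ x)) x ∂(Q t)) :=
          lintegral_lintegral_swap hmeas.aemeasurable
      _ = ∫⁻ x in Ioi 0, ENNReal.ofReal (κ x) * P x (Iic t) := by
          refine setLIntegral_congr_fun measurableSet_Ioi fun x hx => ?_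
          have e : ∀ z, (Iio z).indicator (fun x => ENNReal.ofReal (κ x)) x =
              (Ioi x).indicator (fun _ => ENNReal.ofReal (κ x)) z := fun z => by
            simp [indicator]
          simp_rw [e]
          rw [lintegral_indicator measurableSet_Ioi, setLIntegral_const, h.right_Ioi hf hx ht]
      _ = _ := (potential_apply hκ' measurableSet_Iic).symm
  constructor
  · refine ⟨hcont.aestronglyMeasurable, ?_⟩
    rw [hasFiniteIntegral_iff_ofReal hnn, key]
    exact h.potential_Iic_lt_top hf hκ' hκ1' t
  · rw [integral_eq_lintegral_of_nonneg_ae hnn hcont.aestronglyMeasurable, key]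
    rfl

/-- If the functions `w_k` solve a triangular linear system of differential equations, then
`E w_k(Y(t))` solves the corresponding system for the convolution-type derivative. -/
theorem convDeriv_integral_right (h : IsInversePair f P Q) (hf : f.ConditionI) [IsMarkovKernel Q]
    {w : ℕ → ℝ → ℝ} {c : ℕ → ℕ → ℝ} (hw : ∀ k, Continuous (w k)) (hw0 : ∀ k x, 0 ≤ w k x)
    (hw1 : ∀ k x, w k x ≤ 1)
    (hode : ∀ k z, 0 ≤ z → w k z = w k 0 +
      ∑ j ∈ Finset.range (k + 1), c k j * ∫ x in (0 : ℝ)..z, w j x)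
    {u : ℝ → ℝ} {k : ℕ} (hu : ∀ r, 0 ≤ r → u r = ∫ x, w k x ∂(Q r)) {t : ℝ} (ht : 0 < t) :
    f.ConvDifferentiableAt u t ∧
      f.convDeriv u t = ∑ j ∈ Finset.range (k + 1), c k j * ∫ x, w j x ∂(Q t) := by
  -- The integrated system expresses E w_k(Y(r)) through distribution functions of potentials. It
  -- yields both the continuity in r and the representation of u as a primitive.
  have hval : ∀ k r, 0 ≤ r → ∫ x, w k x ∂(Q r) = w k 0 + ∑ j ∈ Finset.range (k + 1),
      c k j * (potential P fun x => ENNReal.ofReal (w j x)).real (Iic r) := by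
    intro k r hr
    have hi : ∀ j ∈ Finset.range (k + 1),
        Integrable (fun z => c k j * ∫ x in (0 : ℝ)..z, w j x) (Q r) := fun j _ =>
      (h.integral_primitive_right hf (hw j) (hw0 j) (hw1 j) hr).1.const_mul _
    calc ∫ x, w k x ∂(Q r) = ∫ z, (w k 0 +
          ∑ j ∈ Finset.range (k + 1), c k j * ∫ x in (0 : ℝ)..z, w j x) ∂(Q r) := by
          refine integral_congr_ae ?_
          filter_upwards [ae_nonneg_of_Iio (h.right_Iio r)] with z hz using hode k z hz
      _ = _ := by
          rw [integral_add (integrable_const _) (integrable_finsetSum _ hi),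
            integral_finsetSum _ hi, integral_const, probReal_univ, one_smul]
          congr 1
          refine Finset.sum_congr rfl fun j _ => ?_
          rw [integral_const_mul,
            (h.integral_primitive_right hf (hw j) (hw0 j) (hw1 j) hr).2]
  have hc : ∀ k, ContinuousOn (fun r => ∫ x, w k x ∂(Q r)) (Ioi 0) := by
    intro k
    refine ContinuousOn.congr (f := fun r => w k 0 + ∑ j ∈ Finset.range (k + 1),
      c k j * (potential P fun x => ENNReal.ofReal (w j x)).real (Iic r)) ?_
      fun r hr => hval k r (le_of_lt hr)
    refine continuousOn_const.add (continuousOn_finsetSum _ fun j _ => continuousOn_const.mul ?_)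
    exact h.continuousOn_potential_Iic hf (hw j).measurable.ennreal_ofReal
      fun x => ENNReal.ofReal_le_one.2 (hw1 j x)
  choose g hgi hgV hgconv hgc using fun k =>
    h.exists_real_density hf (hw k).measurable (hw0 k) (hw1 k) (hc k)
  have hu0 : u 0 = w k 0 := by
    rw [hu 0 le_rfl, hval k 0 le_rfl]
    simp [hgV _ 0 le_rfl]
  have hmain := convDeriv_of_integral f (u := u)
    (g := fun x => ∑ j ∈ Finset.range (k + 1), c k j * g j x) ht
    (fun a b => by
      simpa only [Finset.sum_fn] using IntervalIntegrable.sum (Finset.range (k + 1))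
        (f := fun j x => c k j * g j x) fun j _ => (hgi j a b).const_mul (c k j))
    (fun r hr => by
      rw [hu0, hu r hr, hval k r hr, intervalIntegral.integral_finsetSum
        fun j _ => (hgi j 0 r).const_mul (c k j)]
      congr 1
      refine Finset.sum_congr rfl fun j _ => ?_
      rw [intervalIntegral.integral_const_mul, hgV j r hr])
    (by
      simp_rw [Finset.sum_mul, mul_assoc]
      simpa only [Finset.sum_fn] using IntervalIntegrable.sum (Finset.range (k + 1))
        (f := fun j s => c k j * (g j (t - s) * f.tail s))
        fun j _ => (hgconv j t ht).1.const_mul (c k j))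
    (fun hb => continuousOn_finsetSum _ fun j _ => continuousOn_const.mul (hgc j hb))
  refine ⟨hmain.1, hmain.2.trans ?_⟩
  simp_rw [Finset.sum_mul, mul_assoc]
  rw [intervalIntegral.integral_finsetSum fun j _ => (hgconv j t ht).1.const_mul (c k j),
    Finset.mul_sum, ← Finset.sum_add_distrib]
  refine Finset.sum_congr rfl fun j _ => ?_
  rw [intervalIntegral.integral_const_mul, ← (hgconv j t ht).2]
  ring

end IsInversePair

/-! ### From the process to kernels: jointly measurable versions along rational times. -/

/-- The infimum of a path over the rational times to the right of `x`. -/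
def rightInf (p : ℝ≥0 → ℝ≥0∞) (x : ℝ≥0) : ℝ≥0∞ :=
  ⨅ q : ℚ, if x < Real.toNNReal q then p (Real.toNNReal q) else ∞

/-- The first passage time of a path, computed along rational times. -/
def ratInverse (p : ℝ≥0 → ℝ≥0∞) (t : ℝ≥0) : ℝ≥0∞ :=
  ⨅ q : ℚ, if (t : ℝ≥0∞) < p (Real.toNNReal q) then (Real.toNNReal q : ℝ≥0∞) else ∞

theorem exists_rat_toNNReal_btwn {x y : ℝ≥0} (h : x < y) :
    ∃ q : ℚ, x < Real.toNNReal q ∧ Real.toNNReal q < y := by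
  obtain ⟨q, -, h1, h2⟩ := (NNReal.lt_iff_exists_rat_btwn x y).1 h
  exact ⟨q, h1, h2⟩

theorem rightInf_eq {p : ℝ≥0 → ℝ≥0∞} (hm : Monotone p) {x : ℝ≥0}
    (hc : ContinuousWithinAt p (Ici x) x) : rightInf p x = p x := by
  refine le_antisymm (le_of_forall_gt fun c hlt => ?_) (le_iInf fun q => ?_)
  · have h1 : ∀ᶠ s in 𝓝[>] x, p s < c :=
      (hc.mono Ioi_subset_Ici_self).eventually (gt_mem_nhds hlt)
    obtain ⟨y, hy, hy'⟩ := (mem_nhdsGT_iff_exists_Ioo_subset' (lt_add_one x)).1 h1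
    obtain ⟨q, hq1, hq2⟩ := exists_rat_toNNReal_btwn (mem_Ioi.1 hy)
    refine lt_of_le_of_lt (iInf_le _ q) ?_
    rw [if_pos hq1]
    exact hy' ⟨hq1, hq2⟩
  · split_ifs with hq
    · exact hm hq.le
    · exact le_top

/-- For a path that never passes t both sides take the default value 0: `sInf ∅` in `ℝ≥0`, and
`∞.toNNReal`. -/
theorem sInf_eq_ratInverse {p : ℝ≥0 → ℝ≥0∞} (hm : Monotone p) (t : ℝ≥0) :
    sInf {s : ℝ≥0 | (t : ℝ≥0∞) < p s} = (ratInverse p t).toNNReal := by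
  rcases eq_empty_or_nonempty {s : ℝ≥0 | (t : ℝ≥0∞) < p s} with h | h
  · have h0 : ∀ s, ¬ (t : ℝ≥0∞) < p s := fun s hs => by
      have : s ∈ {s : ℝ≥0 | (t : ℝ≥0∞) < p s} := hs
      rw [h] at this; exact this
    simp [ratInverse, h0]
  · have : ratInverse p t = (sInf {s : ℝ≥0 | (t : ℝ≥0∞) < p s} : ℝ≥0) := by
      refine le_antisymm (le_of_forall_gt fun c hlt => ?_) (le_iInf fun q => ?_)
      · obtain ⟨s, hs, hsc⟩ : ∃ s : ℝ≥0, (t : ℝ≥0∞) < p s ∧ (s : ℝ≥0∞) < c := by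
          obtain ⟨b, hb1, hb2⟩ := ENNReal.lt_iff_exists_nnreal_btwn.1 hlt
          obtain ⟨s, hs, hsb⟩ := exists_lt_of_csInf_lt h (ENNReal.coe_lt_coe.1 hb1)
          exact ⟨s, hs, (ENNReal.coe_lt_coe.2 hsb).trans hb2⟩
        obtain ⟨b, hb1, hb2⟩ := ENNReal.lt_iff_exists_nnreal_btwn.1 hsc
        obtain ⟨q, hq1, hq2⟩ := exists_rat_toNNReal_btwn (ENNReal.coe_lt_coe.1 hb1)
        refine lt_of_le_of_lt (iInf_le _ q) ?_
        rw [if_pos (hs.trans_le (hm hq1.le))]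
        exact (ENNReal.coe_lt_coe.2 hq2).trans hb2
      · split_ifs with hq
        · exact ENNReal.coe_le_coe.2 (csInf_le (OrderBot.bddBelow _) hq)
        · exact le_top
    rw [this, ENNReal.toNNReal_coe]

/-- Joint measurability in time and sample is the purpose of the rational infima: right-continuity
is only almost sure, so evaluation at a varying time goes through this version. -/
theorem measurable_rightInf {β : Type*} [MeasurableSpace β] {X : ℝ≥0 → β → ℝ≥0∞} {S : β → ℝ≥0}
    (hX : ∀ s, Measurable (X s)) (hS : Measurable S) :
    Measurable fun z => rightInf (fun s => X s z) (S z) :=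
  Measurable.iInf fun _ => Measurable.ite (measurableSet_lt hS measurable_const) (hX _)
    measurable_const

theorem measurable_ratInverse {β : Type*} [MeasurableSpace β] {X : ℝ≥0 → β → ℝ≥0∞} {S : β → ℝ≥0}
    (hX : ∀ s, Measurable (X s)) (hS : Measurable S) :
    Measurable fun z => ratInverse (fun s => X s z) (S z) :=
  Measurable.iInf fun _ => Measurable.ite (measurableSet_lt hS.coe_nnreal_ennreal (hX _))
    measurable_const measurable_const

section InverseSubordinator

variable {Ω : Type*} [MeasurableSpace Ω] {μ : Measure Ω}

/-- Restricting to a section of D discards the killed paths in the law of H(x); with D everything,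
the law of Y(t) is obtained. -/
theorem exists_kernel_map_restrict [SFinite μ] {D : Set (ℝ × Ω)} (hD : MeasurableSet D)
    {F : ℝ × Ω → ℝ} (hF : Measurable F) :
    ∃ K : Kernel ℝ ℝ, ∀ x,
      K x = (μ.restrict (Prod.mk x ⁻¹' D)).map fun ω => F (x, ω) := by
  refine ⟨⟨fun x => (μ.restrict (Prod.mk x ⁻¹' D)).map fun ω => F (x, ω), ?_⟩, fun x => rfl⟩
  refine Measure.measurable_of_measurable_coe _ fun B hB => ?_
  have : ∀ x, ((μ.restrict (Prod.mk x ⁻¹' D)).map fun ω => F (x, ω)) B =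
      μ (Prod.mk x ⁻¹' (F ⁻¹' B ∩ D)) := fun x => by
    have hFx : Measurable fun ω => F (x, ω) := hF.comp measurable_prodMk_left
    rw [Measure.map_apply hFx hB, Measure.restrict_apply (hFx hB)]
    rfl
  simp_rw [this]
  exact measurable_measure_prodMk_left ((hF hB).inter hD)

namespace IsSubordinator

variable {H : ℝ≥0 → Ω → ℝ≥0∞} {f : BernsteinTriplet} {φ : ℝ → ℝ}

theorem ae_inverse_eq (hH : IsSubordinator H φ μ) :
    ∀ᵐ ω ∂μ, ∀ t, inverse H t ω = (ratInverse (fun s => H s ω) t).toNNReal := by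
  filter_upwards [hH.regular] with ω hω t using sInf_eq_ratInverse hω.1 t

theorem lap_map_restrict [IsFiniteMeasure μ] (hH : IsSubordinator H φ μ) (x : ℝ≥0) {s : ℝ}
    (hs : 0 < s) :
    lap ((μ.restrict {ω | H x ω ≠ ∞}).map fun ω => (H x ω).toReal) s =
      ENNReal.ofReal (Real.exp (-(x * φ s))) := by
  have hm := hH.measurable x
  have hset : MeasurableSet {ω | H x ω ≠ ∞} := (hm (measurableSet_singleton ∞)).compl
  rw [← hH.laplace x s hs, lap, lintegral_map (by fun_prop) hm.ennreal_toReal,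
    ofReal_integral_eq_lintegral_ofReal, ← lintegral_indicator hset]
  · refine lintegral_congr fun ω => ?_
    by_cases h : H x ω = ∞
    · simp [h]
    · simp [h]
  · refine Integrable.of_bound (Measurable.aestronglyMeasurable ?_) 1 (ae_of_all _ fun ω => ?_)
    · exact Measurable.ite (hm (measurableSet_singleton ∞)) measurable_const (by fun_prop)
    · split_ifs
      · simp
      · rw [Real.norm_of_nonneg (Real.exp_pos _).le, Real.exp_le_one_iff]
        have := mul_nonneg hs.le (ENNReal.toReal_nonneg (a := H x ω))
        linarith
  · exact ae_of_all _ fun ω => by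
      show (0 : ℝ) ≤ if H x ω = ∞ then 0 else _
      split_ifs
      · exact le_rfl
      · exact (Real.exp_pos _).le

/-- The subordinator passes every level. -/
theorem ae_exists_lt [IsFiniteMeasure μ] (hH : IsSubordinator H φ μ) (hφ : 0 < φ 1) (t : ℝ≥0) :
    ∀ᵐ ω ∂μ, ∃ s, (t : ℝ≥0∞) < H s ω := by
  have hle : ∀ n : ℕ, μ {ω | ∀ s, ¬ (t : ℝ≥0∞) < H s ω} ≤
      ENNReal.ofReal (Real.exp t * Real.exp (-(n * φ 1))) := by
    intro n
    have hm := hH.measurable n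
    have h1 := measure_Iic_le_lap ((μ.restrict {ω | H n ω ≠ ∞}).map fun ω => (H n ω).toReal) t
    rw [hH.lap_map_restrict n one_pos, ← ENNReal.ofReal_mul (Real.exp_pos _).le,
      Measure.map_apply hm.ennreal_toReal measurableSet_Iic,
      Measure.restrict_apply (hm.ennreal_toReal measurableSet_Iic)] at h1
    refine le_trans (measure_mono fun ω hω => ?_) h1
    have h2 : H n ω ≤ t := not_lt.1 (hω n)
    have h3 : H n ω ≠ ∞ := (h2.trans_lt ENNReal.coe_lt_top).ne
    refine ⟨?_, h3⟩
    exact ENNReal.toReal_le_coe_of_le_coe h2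
  have hlim : Tendsto (fun n : ℕ => ENNReal.ofReal (Real.exp t * Real.exp (-(n * φ 1)))) atTop
      (𝓝 0) := by
    have h1 : Tendsto (fun n : ℕ => (n : ℝ) * φ 1) atTop atTop :=
      tendsto_natCast_atTop_atTop.atTop_mul_const hφ
    have h2 := (Real.tendsto_exp_atBot.comp (tendsto_neg_atTop_atBot.comp h1)).const_mul
      (Real.exp t)
    simpa using ENNReal.tendsto_ofReal h2
  have h0 : μ {ω | ∀ s, ¬ (t : ℝ≥0∞) < H s ω} = 0 :=
    le_antisymm (ge_of_tendsto' hlim hle) zero_le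
  rw [ae_iff]
  simpa only [not_exists] using h0

/-- The laws of a subordinator and of its inverse. -/
theorem exists_isInversePair [IsProbabilityMeasure μ] (hH : IsSubordinator H f.fn μ)
    (hf : f.ConditionI) :
    ∃ P Q : Kernel ℝ ℝ, IsMarkovKernel Q ∧ IsInversePair f P Q ∧
      ∀ t : ℝ≥0, Q t = inverseLaw H μ t := by
  -- `toNNReal` repeats the value at time 0 on the negative axis, so that the kernels are defined on
  -- all of ℝ.
  set Hh : ℝ × Ω → ℝ≥0∞ := fun z => rightInf (fun s => H s z.2) z.1.toNNReal with hHh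
  set Yh : ℝ × Ω → ℝ := fun z =>
    ((ratInverse (fun s => H s z.2) z.1.toNNReal).toNNReal : ℝ) with hYh
  have hHm : Measurable Hh := measurable_rightInf (X := fun s (z : ℝ × Ω) => H s z.2)
    (fun s => (hH.measurable s).comp measurable_snd) measurable_fst.real_toNNReal
  have hYm : Measurable Yh := (measurable_ratInverse (X := fun s (z : ℝ × Ω) => H s z.2)
    (fun s => (hH.measurable s).comp measurable_snd)
    measurable_fst.real_toNNReal).ennreal_toNNReal.coe_nnreal_real
  have hHae : ∀ x : ℝ, ∀ᵐ ω ∂μ, Hh (x, ω) = H x.toNNReal ω := fun x => by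
    filter_upwards [hH.regular] with ω hω using rightInf_eq hω.1 (hω.2 _)
  have hYae : ∀ t : ℝ≥0, ∀ᵐ ω ∂μ, Yh (t, ω) = inverse H t ω := fun t => by
    filter_upwards [hH.ae_inverse_eq] with ω hω
    rw [hω t]; simp [hYh]
  obtain ⟨P, hP⟩ := exists_kernel_map_restrict (μ := μ) (D := {z | Hh z ≠ ∞})
    (hHm (measurableSet_singleton ∞)).compl hHm.ennreal_toReal
  obtain ⟨Q, hQ⟩ := exists_kernel_map_restrict (μ := μ) MeasurableSet.univ hYm
  have hQ' : ∀ t, Q t = μ.map fun ω => Yh (t, ω) := fun t => by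
    rw [hQ t, preimage_univ, Measure.restrict_univ]
  have hYt : ∀ t, Measurable fun ω => Yh (t, ω) := fun t => hYm.comp measurable_prodMk_left
  have hP' : ∀ x, P x = (μ.restrict {ω | H x.toNNReal ω ≠ ∞}).map
      fun ω => (H x.toNNReal ω).toReal := fun x => by
    have hset : (Prod.mk x ⁻¹' {z | Hh z ≠ ∞}) =ᵐ[μ] {ω | H x.toNNReal ω ≠ ∞} := by
      filter_upwards [hHae x] with ω hω
      change (Hh (x, ω) ≠ ∞) = (H x.toNNReal ω ≠ ∞)
      rw [hω]
    rw [hP x, Measure.restrict_congr_set hset]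
    refine Measure.map_congr (ae_restrict_of_ae ?_)
    filter_upwards [hHae x] with ω hω
    rw [hω]
  have hPapply : ∀ x (B : Set ℝ), MeasurableSet B →
      P x B = μ {ω | (H x.toNNReal ω).toReal ∈ B ∧ H x.toNNReal ω ≠ ∞} := fun x B hB => by
    have hm := (hH.measurable x.toNNReal).ennreal_toReal
    rw [hP', Measure.map_apply hm hB, Measure.restrict_apply (hm hB)]
    rfl
  have hQapply : ∀ (t : ℝ≥0) (B : Set ℝ), MeasurableSet B →
      Q t B = μ {ω | (inverse H t ω : ℝ) ∈ B} := fun t B hB => by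
    rw [hQ', Measure.map_apply (hYt t) hB]
    refine measure_congr ?_
    filter_upwards [hYae t] with ω hω
    change (Yh (t, ω) ∈ B) = ((inverse H t ω : ℝ) ∈ B)
    rw [hω]
  refine ⟨P, Q, ⟨fun t => ?_⟩, ⟨fun x => ?_, fun x => ?_, fun x s hx hs => ?_, fun t => ?_,
    fun t x ht hx => ?_, fun t x ht hx => ?_⟩, fun t => ?_⟩
  · rw [hQ']; exact Measure.isProbabilityMeasure_map (hYt t).aemeasurable
  · rw [hPapply x _ measurableSet_Iio]
    refine measure_mono_null (t := ∅) (fun ω hω => ?_) measure_empty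
    exact absurd ENNReal.toReal_nonneg (not_le.2 hω.1)
  · rw [hPapply x _ MeasurableSet.univ]; exact prob_le_one
  · rw [hP', hH.lap_map_restrict _ hs, Real.coe_toNNReal _ hx]
  · rw [hQ', Measure.map_apply (hYt t) measurableSet_Iio]
    refine measure_mono_null (t := ∅) (fun ω hω => ?_) measure_empty
    exact absurd (NNReal.coe_nonneg _) (not_le.2 hω)
  · lift t to ℝ≥0 using ht
    lift x to ℝ≥0 using hx
    rw [hQapply t _ measurableSet_Ioi, hPapply _ _ measurableSet_Iic, Real.toNNReal_coe]
    refine measure_mono fun ω hω => ?_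
    have h1 : ¬ (t : ℝ≥0∞) < H x ω := fun hlt => by
      have h2 : inverse H t ω ≤ x := csInf_le (OrderBot.bddBelow _) hlt
      exact absurd (NNReal.coe_le_coe.2 h2) (not_le.2 hω)
    rw [not_lt] at h1
    exact ⟨ENNReal.toReal_le_coe_of_le_coe h1, (h1.trans_lt ENNReal.coe_lt_top).ne⟩
  · lift t to ℝ≥0 using ht
    lift x to ℝ≥0 using hx
    rw [hQapply t _ measurableSet_Ioi, hPapply _ _ measurableSet_Iio, Real.toNNReal_coe]
    refine measure_mono_ae ?_
    filter_upwards [hH.regular, hH.ae_exists_lt (hf.fn_pos one_pos) t] with ω hreg hex hω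
    have hlt : H x ω < t := by
      have h1 : (H x ω).toReal < t := hω.1
      rw [← ENNReal.ofReal_toReal hω.2]
      rw [← ENNReal.ofReal_coe_nnreal]
      exact (ENNReal.ofReal_lt_ofReal_iff_of_nonneg ENNReal.toReal_nonneg).2 h1
    -- Right-continuity keeps H below t up to some y > x, hence Y(t) ≥ y. Bounding the infimum from
    -- below also needs the level to be passed at all, which is `ae_exists_lt`.
    have h1 : ∀ᶠ s in 𝓝[>] x, H s ω < t :=
      ((hreg.2 x).mono Ioi_subset_Ici_self).eventually (gt_mem_nhds hlt)
    obtain ⟨y, hy, hy'⟩ := (h1.and self_mem_nhdsWithin).exists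
    have h2 : y ≤ inverse H t ω := le_csInf hex fun s hs => by
      by_contra hlt'
      exact lt_asymm hs (lt_of_le_of_lt (hreg.1 (not_le.1 hlt').le) hy)
    change (x : ℝ) < inverse H t ω
    exact_mod_cast lt_of_lt_of_le hy' h2
  · rw [hQ', inverseLaw]
    exact Measure.map_congr (hYae t)

end IsSubordinator

end InverseSubordinator

/-! ### Poisson mixtures of bounded sequences. -/

section PoissonMixture

theorem summable_expSeries_mul {a : ℕ → ℝ} (ha : ∀ n, |a n| ≤ 1) (x : ℝ) :
    Summable fun n => x ^ n / (n.factorial : ℝ) * a n := by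
  refine Summable.of_norm_bounded (g := fun n => |x| ^ n / (n.factorial : ℝ))
    (Real.summable_pow_div_factorial |x|) fun n => ?_
  rw [norm_mul, norm_div, norm_pow, Real.norm_eq_abs, Real.norm_eq_abs, Real.norm_eq_abs,
    abs_of_pos (a := (n.factorial : ℝ)) (by positivity)]
  exact mul_le_of_le_one_right (by positivity) (ha n)

/-- Termwise differentiation, with the derivatives dominated on the ball of radius |x| + 1; n
x^{n-1}/n! = x^{n-1}/(n-1)! produces the index shift. -/
theorem hasDerivAt_tsum_expSeries_mul {a : ℕ → ℝ} (ha : ∀ n, |a n| ≤ 1) (x : ℝ) :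
    HasDerivAt (fun x => ∑' n, x ^ n / (n.factorial : ℝ) * a n)
      (∑' n, x ^ n / (n.factorial : ℝ) * a (n + 1)) x := by
  set R := |x| + 1 with hR
  have hsplit : ∀ (n : ℕ) (y : ℝ), ((n + 1 : ℕ) : ℝ) * y ^ n / ((n + 1).factorial : ℝ) =
      y ^ n / (n.factorial : ℝ) := fun n y => by
    rw [Nat.factorial_succ, Nat.cast_mul, mul_div_mul_left _ _ (by positivity)]
  have hsum : Summable fun n : ℕ => (n : ℝ) * R ^ (n - 1) / (n.factorial : ℝ) := by
    rw [← summable_nat_add_iff 1]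
    refine (Real.summable_pow_div_factorial R).congr fun n => ?_
    rw [Nat.add_sub_cancel, hsplit]
  have hx : x ∈ Metric.ball (0 : ℝ) R := by
    rw [mem_ball_zero_iff, Real.norm_eq_abs]; linarith
  have key := hasDerivAt_tsum_of_isPreconnected (t := Metric.ball (0 : ℝ) R)
    (g := fun n x => x ^ n / (n.factorial : ℝ) * a n)
    (g' := fun n x => (n : ℝ) * x ^ (n - 1) / (n.factorial : ℝ) * a n)
    hsum Metric.isOpen_ball (convex_ball (0 : ℝ) R).isPreconnected
    (fun n y _ => ((hasDerivAt_pow n y).div_const _).mul_const _)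
    (fun n y hy => by
      rw [mem_ball_zero_iff, Real.norm_eq_abs] at hy
      rw [norm_mul, norm_div, norm_mul, norm_pow, Real.norm_eq_abs, Real.norm_eq_abs,
        Real.norm_eq_abs, Real.norm_eq_abs, abs_of_pos (a := (n.factorial : ℝ)) (by positivity),
        Nat.abs_cast]
      refine (mul_le_of_le_one_right (by positivity) (ha n)).trans ?_
      gcongr) hx (summable_expSeries_mul ha x) hx
  refine key.congr_deriv ?_
  have hs : Summable fun n : ℕ => ((n : ℝ) * x ^ (n - 1) / (n.factorial : ℝ) * a n) := by
    rw [← summable_nat_add_iff 1]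
    refine (summable_expSeries_mul (a := fun n => a (n + 1)) (fun n => ha _) x).congr fun n => ?_
    rw [Nat.add_sub_cancel, hsplit]
  rw [hs.tsum_eq_zero_add]
  simp only [Nat.cast_zero, zero_mul, zero_div, zero_add]
  refine tsum_congr fun n => ?_
  rw [Nat.add_sub_cancel, hsplit]

/-- The mixture of a sequence with the Poisson weights of mean `lam y`. -/
def poissonMix (lam : ℝ) (a : ℕ → ℝ) (y : ℝ) : ℝ :=
  Real.exp (-(lam * y)) * ∑' n, (lam * y) ^ n / (n.factorial : ℝ) * a n

/-- Kolmogorov's equation: at rate `lam` one more jump shifts the sequence. -/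
theorem hasDerivAt_poissonMix (lam : ℝ) {a : ℕ → ℝ} (ha : ∀ n, |a n| ≤ 1) (y : ℝ) :
    HasDerivAt (poissonMix lam a)
      (lam * poissonMix lam (fun n => a (n + 1)) y - lam * poissonMix lam a y) y := by
  have h1 : HasDerivAt (fun y => lam * y) lam y := by
    simpa using (hasDerivAt_id y).const_mul lam
  have h2 := (hasDerivAt_tsum_expSeries_mul ha (lam * y)).comp y h1
  refine (h1.fun_neg.exp.mul h2).congr_deriv ?_
  simp only [poissonMix, Function.comp]
  ring

theorem poissonMix_sum (lam : ℝ) {ι : Type*} (s : Finset ι) (q : ι → ℝ) {a : ι → ℕ → ℝ}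
    (ha : ∀ i n, |a i n| ≤ 1) (y : ℝ) :
    poissonMix lam (fun n => ∑ i ∈ s, q i * a i n) y = ∑ i ∈ s, q i * poissonMix lam (a i) y := by
  have h1 : ∀ n : ℕ, (lam * y) ^ n / (n.factorial : ℝ) * ∑ i ∈ s, q i * a i n =
      ∑ i ∈ s, q i * ((lam * y) ^ n / (n.factorial : ℝ) * a i n) := fun n => by
    rw [Finset.mul_sum]
    exact Finset.sum_congr rfl fun i _ => by ring
  simp only [poissonMix]
  simp_rw [h1]
  rw [Summable.tsum_finsetSum fun i _ => (summable_expSeries_mul (ha i) _).mul_left _,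
    Finset.mul_sum]
  refine Finset.sum_congr rfl fun i _ => ?_
  rw [tsum_mul_left]
  ring

/-- The Poisson generating function; the factor `lam * (1 - r)` is where the Laplace exponent ψ
arises. -/
theorem poissonMix_pow (lam r y : ℝ) :
    poissonMix lam (fun n => r ^ n) y = Real.exp (-(lam * (1 - r) * y)) := by
  have h : ∑' n : ℕ, (lam * y) ^ n / (n.factorial : ℝ) * r ^ n = Real.exp (lam * y * r) := by
    rw [Real.exp_eq_exp_ℝ, NormedSpace.exp_eq_tsum_div]
    refine tsum_congr fun n => ?_
    rw [mul_pow (lam * y) r]; ring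
  rw [poissonMix, h, ← Real.exp_add]
  congr 1; ring

theorem poissonMix_nonneg {lam : ℝ} (hlam : 0 ≤ lam) {a : ℕ → ℝ} (ha : ∀ n, 0 ≤ a n) {y : ℝ}
    (hy : 0 ≤ y) : 0 ≤ poissonMix lam a y :=
  mul_nonneg (Real.exp_pos _).le (tsum_nonneg fun n => mul_nonneg (by positivity) (ha n))

theorem poissonMix_le_one {lam : ℝ} (hlam : 0 ≤ lam) {a : ℕ → ℝ} (ha : ∀ n, 0 ≤ a n)
    (ha1 : ∀ n, a n ≤ 1) {y : ℝ} (hy : 0 ≤ y) : poissonMix lam a y ≤ 1 := by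
  have h1 := poissonMix_pow lam 1 y
  simp only [one_pow, sub_self, mul_zero, zero_mul, neg_zero, Real.exp_zero] at h1
  rw [← h1]
  unfold poissonMix
  gcongr with n
  · exact summable_expSeries_mul (fun n => abs_le.2 ⟨by linarith [ha n], ha1 n⟩) _
  · exact summable_expSeries_mul (fun n => by simp) _
  · exact ha1 n

theorem poissonMix_eq_tsum (lam : ℝ) (a : ℕ → ℝ) (y : ℝ) :
    poissonMix lam a y =
      ∑' n, Real.exp (-(lam * y)) * (lam * y) ^ n / (n.factorial : ℝ) * a n := by
  rw [poissonMix, ← tsum_mul_left]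
  exact tsum_congr fun n => by ring

end PoissonMixture

/-! ### Poisson weights and their Gamma mixtures. -/

section PoissonWeight

/-- The Poisson weight `e^{-v g} (v g)^k / k!`. -/
def poissonWeight (v : ℝ) (k : ℕ) (g : ℝ) : ℝ :=
  Real.exp (-(v * g)) * (v * g) ^ k / (k.factorial : ℝ)

@[fun_prop]
theorem continuous_poissonWeight (v : ℝ) (k : ℕ) : Continuous (poissonWeight v k) := by
  unfold poissonWeight; fun_prop

theorem poissonWeight_nonneg {v g : ℝ} (hv : 0 ≤ v) (hg : 0 ≤ g) (k : ℕ) :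
    0 ≤ poissonWeight v k g := by
  unfold poissonWeight; positivity

theorem poissonWeight_le_one {v g : ℝ} (hv : 0 ≤ v) (hg : 0 ≤ g) (k : ℕ) :
    poissonWeight v k g ≤ 1 := by
  have h := Real.pow_div_factorial_le_exp (v * g) (mul_nonneg hv hg) k
  rw [poissonWeight, mul_div_assoc, Real.exp_neg, inv_mul_le_iff₀ (Real.exp_pos _), mul_one]
  exact h

theorem poissonWeight_zero (v g : ℝ) : poissonWeight v 0 g = Real.exp (-(v * g)) := by
  simp [poissonWeight]

/-- Binomial theorem: the counts over two disjoint stretches of lengths g and h add up to k. -/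
theorem poissonWeight_add (v : ℝ) (k : ℕ) (g h : ℝ) :
    poissonWeight v k (g + h) =
      ∑ j ∈ Finset.range (k + 1), poissonWeight v j g * poissonWeight v (k - j) h := by
  simp only [poissonWeight]
  rw [mul_add, add_pow, neg_add, Real.exp_add, Finset.mul_sum, Finset.sum_div]
  refine Finset.sum_congr rfl fun j hj => ?_
  have hjk : j ≤ k := Nat.lt_succ_iff.1 (Finset.mem_range.1 hj)
  rw [Nat.cast_choose ℝ hjk]
  have h1 : (j.factorial : ℝ) ≠ 0 := by positivity
  have h2 : ((k - j).factorial : ℝ) ≠ 0 := by positivity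
  have h3 : (k.factorial : ℝ) ≠ 0 := by positivity
  field_simp

/-- The negative binomial weights, obtained by mixing the Poisson weights with a Gamma law. -/
def gammaMix (α β v : ℝ) (m : ℕ) : ℝ :=
  β ^ α / (v + β) ^ α * (v ^ m / (v + β) ^ m * (Real.Gamma (m + α) / (m.factorial * Real.Gamma α)))

theorem integral_poissonWeight_gammaMeasure {α β v : ℝ} (hα : 0 < α) (hβ : 0 < β) (hv : 0 < v)
    (m : ℕ) : ∫ x, poissonWeight v m x ∂(gammaMeasure α β) = gammaMix α β v m := by
  have hnn : ∀ x, 0 ≤ gammaPDFReal α β x := gammaPDFReal_nonneg hα hβ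
  have hvb : 0 < v + β := by linarith
  have hm : Measurable (gammaPDF α β) := (measurable_gammaPDFReal α β).ennreal_ofReal
  have hfin : ∀ᵐ x, gammaPDF α β x < ∞ := ae_of_all _ fun x => ENNReal.ofReal_lt_top
  rw [gammaMeasure, integral_withDensity_eq_integral_toReal_smul hm hfin]
  have h1 : ∀ x, (gammaPDF α β x).toReal • poissonWeight v m x =
      (Ici (0 : ℝ)).indicator (fun x => β ^ α / Real.Gamma α * v ^ m / m.factorial *
        (x ^ (m + α - 1) * Real.exp (-((v + β) * x)))) x := by
    intro x
    rw [gammaPDF, ENNReal.toReal_ofReal (hnn x), gammaPDFReal, smul_eq_mul, poissonWeight]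
    by_cases hx : 0 ≤ x
    · rw [indicator_of_mem (mem_Ici.2 hx), if_pos hx]
      -- The splitting x^{m+α-1} = x^m x^{α-1} requires x > 0; at 0 the conventions for real powers
      -- are checked directly.
      rcases hx.eq_or_lt with rfl | hx0
      · rcases Nat.eq_zero_or_pos m with rfl | hm
        · simp
        · have hne : (m : ℝ) + α - 1 ≠ 0 := by
            have : (1 : ℝ) ≤ m := by exact_mod_cast hm
            linarith
          simp [hm.ne', Real.zero_rpow hne]
      · have e : x ^ ((m : ℝ) + α - 1) = x ^ m * x ^ (α - 1) := by
          rw [← Real.rpow_natCast, ← Real.rpow_add hx0]; congr 1; ring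
        have e2 : Real.exp (-((v + β) * x)) = Real.exp (-(β * x)) * Real.exp (-(v * x)) := by
          rw [← Real.exp_add]; congr 1; ring
        rw [e, e2, mul_pow]
        ring
    · rw [indicator_of_notMem (by simpa using hx), if_neg hx, zero_mul]
  simp_rw [h1]
  rw [integral_indicator measurableSet_Ici, integral_Ici_eq_integral_Ioi, integral_const_mul,
    Real.integral_rpow_mul_exp_neg_mul_Ioi (by positivity) hvb, gammaMix,
    Real.div_rpow zero_le_one hvb.le, Real.one_rpow, Real.rpow_add hvb, Real.rpow_natCast]
  have := (Real.Gamma_pos_of_pos hα).ne'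
  field_simp

end PoissonWeight

/-! ### Evaluation at independent random times. -/

section RandomTime

variable {Ω : Type*}

theorem measurable_pathSigma {E : Type*} [MeasurableSpace E] (X : ℝ≥0 → Ω → E) (t : ℝ≥0) :
    Measurable[pathSigma X] (X t) :=
  (measurable_pi_apply t).comp (comap_measurable fun ω t => X t ω)

theorem pathSigma_le {mΩ : MeasurableSpace Ω} {E : Type*} [MeasurableSpace E] {X : ℝ≥0 → Ω → E}
    (hX : ∀ t, Measurable (X t)) : pathSigma X ≤ mΩ :=
  (measurable_pi_iff.2 hX).comap_le

/-- A regular version of an integer-valued path. -/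
def regCount (p : ℝ≥0 → ℕ) (x : ℝ≥0) : ℕ :=
  ⌊(rightInf (fun s => (p s : ℝ≥0∞)) x).toReal⌋₊

theorem measurable_regCount {β : Type*} [MeasurableSpace β] {X : ℝ≥0 → β → ℕ} {S : β → ℝ≥0}
    (hX : ∀ s, Measurable (X s)) (hS : Measurable S) :
    Measurable fun z => regCount (fun s => X s z) (S z) :=
  Nat.measurable_floor.comp (measurable_rightInf (X := fun s z => (X s z : ℝ≥0∞))
    (fun s => (measurable_of_countable fun n : ℕ => (n : ℝ≥0∞)).comp (hX s)) hS).ennreal_toReal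

theorem regCount_eq {X : ℝ≥0 → Ω → ℕ} {ω : Ω} (h : RegularPath X ω) (x : ℝ≥0) :
    regCount (fun s => X s ω) x = X x ω := by
  rw [regCount, rightInf_eq (fun s t hst => Nat.cast_le.2 (h.1 hst))]
  · simp
  · exact (continuous_of_discreteTopology (f := fun n : ℕ => (n : ℝ≥0∞))).continuousAt
      |>.comp_continuousWithinAt (h.2 x)

/-- The law of an integer-valued process evaluated at an independent random time. -/
theorem measure_randomTime_eq {m mΩ : MeasurableSpace Ω} {μ : Measure Ω} [IsProbabilityMeasure μ]
    {X : ℝ≥0 → Ω → ℕ}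
    (hX : ∀ t, Measurable (X t)) (hreg : ∀ᵐ ω ∂μ, RegularPath X ω)
    (hm : m ≤ mΩ) {S : Ω → ℝ≥0} (hS : Measurable[m] S)
    (hind : Indep (pathSigma X) m μ) (k : ℕ) :
    μ {ω | X (S ω) ω = k} = ∫⁻ ω, μ {ω' | X (S ω) ω' = k} ∂μ := by
  have hS' : Measurable S := hS.mono hm le_rfl
  have hpath : Measurable fun ω s => X s ω := measurable_pi_iff.2 hX
  have hI : IndepFun (fun ω s => X s ω) S μ :=
    (IndepFun_iff_Indep _ _ _).2 (indep_of_indep_of_le_right hind hS.comap_le)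
  -- Evaluating an arbitrary path at an arbitrary time is not measurable on the product space, so
  -- `regCount`, which agrees with it on regular paths, stands in and Fubini applies.
  have hA : MeasurableSet {z : (ℝ≥0 → ℕ) × ℝ≥0 | regCount z.1 z.2 = k} :=
    measurable_regCount (X := fun s (z : (ℝ≥0 → ℕ) × ℝ≥0) => z.1 s)
      (fun s => (measurable_pi_apply s).comp measurable_fst) measurable_snd
      (measurableSet_singleton k)
  have h1 : μ {ω | X (S ω) ω = k} =
      μ.map (fun ω => ((fun s => X s ω), S ω)) {z | regCount z.1 z.2 = k} := by
    rw [Measure.map_apply (hpath.prodMk hS') hA]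
    refine measure_congr ?_
    filter_upwards [hreg] with ω hω
    change (X (S ω) ω = k) = (regCount (fun s => X s ω) (S ω) = k)
    rw [regCount_eq hω]
  have := Measure.isProbabilityMeasure_map (μ := μ) hpath.aemeasurable
  have := Measure.isProbabilityMeasure_map (μ := μ) hS'.aemeasurable
  rw [h1, (indepFun_iff_map_prod_eq_prod_map_map hpath.aemeasurable hS'.aemeasurable).1 hI,
    Measure.prod_apply_symm hA, lintegral_map (measurable_measure_prodMk_right hA) hS']
  refine lintegral_congr fun ω => ?_
  rw [Measure.map_apply hpath (measurable_prodMk_right hA)]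
  refine measure_congr ?_
  filter_upwards [hreg] with ω' hω'
  change (regCount (fun s => X s ω') (S ω) = k) = (X (S ω) ω' = k)
  rw [regCount_eq hω']

/-- Conditioning a sequence on an independent index. -/
theorem lintegral_randomIndex {mZ m mΩ : MeasurableSpace Ω} {μ : Measure Ω} {E : Type*}
    [MeasurableSpace E] {Z : ℕ → Ω → E} (hmZ : mZ ≤ mΩ) (hm : m ≤ mΩ)
    (hZ : ∀ n, Measurable[mZ] (Z n)) {M : Ω → ℕ} (hM : Measurable[m] M) (hind : Indep mZ m μ)
    {h : E → ℝ≥0∞} (hh : Measurable h) :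
    ∫⁻ ω, h (Z (M ω) ω) ∂μ = ∑' n, μ {ω | M ω = n} * ∫⁻ ω, h (Z n ω) ∂μ := by
  have h1 : ∀ ω, h (Z (M ω) ω) =
      ∑' n, {ω | M ω = n}.indicator (fun _ => (1 : ℝ≥0∞)) ω * h (Z n ω) := fun ω => by
    rw [tsum_eq_single (M ω)]
    · simp
    · intro n hn
      simp [hn.symm]
  have hset : ∀ n, MeasurableSet[m] {ω | M ω = n} := fun n => hM (measurableSet_singleton n)
  have hi : ∀ n, Measurable[m] ({ω | M ω = n}.indicator fun _ => (1 : ℝ≥0∞)) := fun n =>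
    measurable_const.indicator (hset n)
  have hz : ∀ n, Measurable[mZ] fun ω => h (Z n ω) := fun n => hh.comp (hZ n)
  simp_rw [h1]
  rw [lintegral_tsum fun n => by exact (((hi n).mono hm le_rfl).mul ((hz n).mono hmZ le_rfl)).aemeasurable]
  refine tsum_congr fun n => ?_
  rw [lintegral_mul_eq_lintegral_mul_lintegral_of_independent_measurableSpace hm hmZ hind.symm
    (hi n) (hz n), lintegral_indicator_const (hm _ (hset n)), one_mul]

theorem IsPoissonProcess.measure_eq [MeasurableSpace Ω] {μ : Measure Ω} {N : ℝ≥0 → Ω → ℕ} {rate : ℝ} (hN : IsPoissonProcess N rate μ)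
    (hrate : 0 ≤ rate) (y : ℝ≥0) (n : ℕ) :
    μ {ω | N y ω = n} = ENNReal.ofReal (poissonWeight rate n y) := by
  have h1 := hN.law 0 y zero_le
  have hm : Measurable fun ω => N y ω - N 0 ω := (hN.measurable y).sub (hN.measurable 0)
  have h2 : μ {ω | N y ω = n} = μ.map (fun ω => N y ω - N 0 ω) {n} := by
    rw [Measure.map_apply hm (measurableSet_singleton n)]
    refine measure_congr ?_
    filter_upwards [hN.zero] with ω hω
    change (N y ω = n) = (N y ω - N 0 ω = n)
    rw [hω, Nat.sub_zero]
  rw [h2, h1, poissonMeasure_singleton, poissonWeight]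
  simp [Real.coe_toNNReal _ hrate]

end RandomTime

/-! ### The composite process N₁(G(N(Y(t)))). -/

section CompositeProcess

variable {Ω : Type*} [MeasurableSpace Ω] {μ : Measure Ω} [IsProbabilityMeasure μ]

/-- S is a measurable version of G(N(Y(t))) built from G, N and H alone, hence independent of N₁;
the composition is unwound by conditioning from the outside in. The function h is kept general so as
to serve both for Poisson weights and for e^{-vS}. -/
theorem exists_composite {lam₁ lam : ℝ} (hlam₁ : 0 < lam₁) (hlam : 0 < lam)
    {N₁ : ℝ≥0 → Ω → ℕ} {G : ℝ≥0 → Ω → ℝ≥0} {N : ℝ≥0 → Ω → ℕ} {H : ℝ≥0 → Ω → ℝ≥0∞} {φ : ℝ → ℝ}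
    (hN₁ : IsPoissonProcess N₁ lam₁ μ) (hG : ∀ t, Measurable (G t))
    (hN : IsPoissonProcess N lam μ) (hH : IsSubordinator H φ μ)
    (hindep : iIndep ![pathSigma N₁, pathSigma G, pathSigma N, pathSigma H] μ) (t : ℝ≥0) :
    ∃ S : Ω → ℝ≥0, Measurable S ∧
      (∀ k, stateProb N₁ G N H μ k t = ∫ ω, poissonWeight lam₁ k (S ω) ∂μ) ∧
      ∀ h : ℝ → ℝ, Measurable h → (∀ g, 0 ≤ g → 0 ≤ h g) → (∀ g, 0 ≤ g → h g ≤ 1) →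
        ∫ ω, h (S ω) ∂μ =
          ∫ ω, poissonMix lam (fun n => ∫ ω', h (G n ω') ∂μ) (inverse H t ω) ∂μ := by
  set m : Fin 4 → MeasurableSpace Ω :=
    ![pathSigma N₁, pathSigma G, pathSigma N, pathSigma H] with hmdef
  have hle : ∀ i, m i ≤ ‹MeasurableSpace Ω› := by
    intro i
    fin_cases i
    · exact pathSigma_le hN₁.measurable
    · exact pathSigma_le hG
    · exact pathSigma_le hN.measurable
    · exact pathSigma_le hH.measurable
  have hT : ∀ T : Set (Fin 4), ⨆ j ∈ T, m j ≤ ‹MeasurableSpace Ω› := fun T =>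
    iSup₂_le fun j _ => hle j
  -- Indices 0, 1, 2, 3 stand for N₁, G, N, H. It is used with T the set of processes further inside
  -- the composition.
  have hI : ∀ (i : Fin 4) (T : Set (Fin 4)), i ∉ T → Indep (m i) (⨆ j ∈ T, m j) μ :=
    fun i T hi => indep_of_indep_of_le_left
      (indep_iSup_of_disjoint hle hindep (S := {i}) (disjoint_singleton_left.2 hi))
      (le_biSup m (mem_singleton i))
  set Y : Ω → ℝ≥0 := fun ω => (ratInverse (fun s => H s ω) t).toNNReal with hYdef
  set M : Ω → ℕ := fun ω => regCount (fun s => N s ω) (Y ω) with hMdef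
  set S : Ω → ℝ≥0 := fun ω => G (M ω) ω with hSdef
  have hY : ∀ T : Set (Fin 4), 3 ∈ T → Measurable[⨆ j ∈ T, m j] Y := fun T h3 =>
    (@measurable_ratInverse Ω (⨆ j ∈ T, m j) H (fun _ => t)
      (fun s => (measurable_pathSigma H s).mono (le_biSup m h3) le_rfl)
      measurable_const).ennreal_toNNReal
  have hM : ∀ T : Set (Fin 4), 2 ∈ T → 3 ∈ T → Measurable[⨆ j ∈ T, m j] M := fun T h2 h3 =>
    @measurable_regCount Ω (⨆ j ∈ T, m j) N Y
      (fun s => (measurable_pathSigma N s).mono (le_biSup m h2) le_rfl) (hY T h3)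
  have hS : Measurable[⨆ j ∈ ({1, 2, 3} : Set (Fin 4)), m j] S :=
    Measurable.comp (g := fun p : ℕ × Ω => G p.1 p.2)
      (measurable_from_prod_countable_right fun n =>
        (measurable_pathSigma G n).mono
          (le_biSup m (show (1 : Fin 4) ∈ ({1, 2, 3} : Set (Fin 4)) by simp)) le_rfl)
      ((hM _ (by simp) (by simp)).prodMk measurable_id)
  have hYae : ∀ᵐ ω ∂μ, inverse H t ω = Y ω := by
    filter_upwards [hH.ae_inverse_eq] with ω hω using hω t
  have hYm : Measurable Y := (hY univ (mem_univ _)).mono (hT _) le_rfl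
  have hMm : Measurable M := (hM univ (mem_univ _) (mem_univ _)).mono (hT _) le_rfl
  have hSm : Measurable S := hS.mono (hT _) le_rfl
  have hMlaw : ∀ n, μ {ω | M ω = n} = ∫⁻ ω, ENNReal.ofReal (poissonWeight lam n (Y ω)) ∂μ := by
    intro n
    have h1 : μ {ω | M ω = n} = μ {ω | N (Y ω) ω = n} := by
      refine measure_congr ?_
      filter_upwards [hN.regular] with ω hω
      change (M ω = n) = (N (Y ω) ω = n)
      rw [hMdef, ← regCount_eq hω]
    rw [h1, measure_randomTime_eq hN.measurable hN.regular (hT {3}) (hY _ (mem_singleton _))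
      (hI 2 {3} (by simp))]
    exact lintegral_congr fun ω => hN.measure_eq hlam.le _ _
  refine ⟨S, hSm, fun k => ?_, fun h hh hh0 hh1 => ?_⟩
  · have h1 : μ {ω | N₁ (G (N (inverse H t ω) ω : ℝ≥0) ω) ω = k} = μ {ω | N₁ (S ω) ω = k} := by
      refine measure_congr ?_
      filter_upwards [hN.regular, hYae] with ω hω hω'
      change (N₁ (G (N (inverse H t ω) ω : ℝ≥0) ω) ω = k) = (N₁ (S ω) ω = k)
      rw [hω', ← regCount_eq hω]
    rw [stateProb, measureReal_def, h1, measure_randomTime_eq hN₁.measurable hN₁.regular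
      (hT {1, 2, 3}) hS (hI 0 _ (by simp)), integral_eq_lintegral_of_nonneg_ae
      (ae_of_all _ fun ω => poissonWeight_nonneg hlam₁.le (NNReal.coe_nonneg (S ω)) k) (by fun_prop)]
    congr 1
    exact lintegral_congr fun ω => hN₁.measure_eq hlam₁.le _ _
  · have hGm : ∀ n : ℕ, Measurable fun ω => h (G n ω) := fun n =>
      hh.comp (hG n).coe_nnreal_real
    have hint : ∀ n : ℕ, Integrable (fun ω => h (G n ω)) μ := fun n =>
      Integrable.of_bound (hGm n).aestronglyMeasurable 1 (ae_of_all _ fun ω => by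
        rw [Real.norm_of_nonneg (hh0 _ (NNReal.coe_nonneg (G n ω)))]; exact hh1 _ (NNReal.coe_nonneg (G n ω)))
    set a : ℕ → ℝ := fun n => ∫ ω', h (G n ω') ∂μ with hadef
    have ha0 : ∀ n, 0 ≤ a n := fun n => integral_nonneg fun ω => hh0 _ (NNReal.coe_nonneg (G n ω))
    have ha1 : ∀ n, a n ≤ 1 := fun n => by
      calc a n ≤ ∫ _, (1 : ℝ) ∂μ := integral_mono (hint n) (integrable_const _)
            fun ω => hh1 _ (NNReal.coe_nonneg (G n ω))
        _ = 1 := by simp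
    have haabs : ∀ n, |a n| ≤ 1 := fun n => abs_le.2 ⟨by linarith [ha0 n], ha1 n⟩
    have hcont : Continuous (poissonMix lam a) :=
      continuous_iff_continuousAt.2 fun y => (hasDerivAt_poissonMix lam haabs y).continuousAt
    have hmix : ∫ ω, poissonMix lam a (inverse H t ω) ∂μ = ∫ ω, poissonMix lam a (Y ω) ∂μ :=
      integral_congr_ae (by filter_upwards [hYae] with ω hω; rw [hω])
    rw [hmix, integral_eq_lintegral_of_nonneg_ae (ae_of_all _ fun ω => hh0 _ (NNReal.coe_nonneg (S ω)))
      (hh.comp hSm.coe_nnreal_real).aestronglyMeasurable,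
      integral_eq_lintegral_of_nonneg_ae
        (ae_of_all _ fun ω => poissonMix_nonneg hlam.le ha0 (NNReal.coe_nonneg (Y ω)))
        (hcont.measurable.comp hYm.coe_nnreal_real).aestronglyMeasurable]
    congr 1
    rw [lintegral_randomIndex (Z := fun n : ℕ => G n) (h := fun g : ℝ≥0 => ENNReal.ofReal (h g))
      (hle 1) (hT {2, 3}) (fun n => measurable_pathSigma G n) (hM _ (by simp) (by simp))
      (hI 1 _ (by simp)) (hh.comp measurable_coe_nnreal_real).ennreal_ofReal]
    have h2 : ∀ n : ℕ, ∫⁻ ω, ENNReal.ofReal (h (G n ω)) ∂μ = ENNReal.ofReal (a n) := fun n =>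
      (ofReal_integral_eq_lintegral_ofReal (hint n) (ae_of_all _ fun ω => hh0 _ (NNReal.coe_nonneg (G n ω)))).symm
    have hpm : ∀ n, Measurable fun ω => ENNReal.ofReal (poissonWeight lam n (Y ω)) := fun n =>
      ((continuous_poissonWeight lam n).measurable.comp hYm.coe_nnreal_real).ennreal_ofReal
    simp_rw [h2, hMlaw]
    simp_rw [← lintegral_mul_const _ (hpm _)]
    rw [← lintegral_tsum fun n => ((hpm n).mul_const _).aemeasurable]
    refine lintegral_congr fun ω => ?_
    have h3 : ∀ n, 0 ≤ poissonWeight lam n (Y ω) := fun n => poissonWeight_nonneg hlam.le (NNReal.coe_nonneg (Y ω)) n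
    simp_rw [← ENNReal.ofReal_mul (h3 _)]
    rw [← ENNReal.ofReal_tsum_of_nonneg fun n => mul_nonneg (h3 n) (ha0 n), poissonMix_eq_tsum]
    · rfl
    · refine ((summable_expSeries_mul haabs (lam * Y ω)).mul_left
        (Real.exp (-(lam * Y ω)))).congr fun n => ?_
      rw [poissonWeight]; ring

namespace IsGammaSubordinator

variable {G : ℝ≥0 → Ω → ℝ≥0} {α β v : ℝ}

theorem integral_poissonWeight_zero (hG : IsGammaSubordinator G α β μ)
    (k : ℕ) : ∫ ω, poissonWeight v k (G (0 : ℕ) ω) ∂μ = if k = 0 then 1 else 0 := by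
  have h1 : ∫ ω, poissonWeight v k (G (0 : ℕ) ω) ∂μ = ∫ _, poissonWeight v k 0 ∂μ := by
    refine integral_congr_ae ?_
    filter_upwards [hG.zero] with ω hω
    rw [Nat.cast_zero, hω, NNReal.coe_zero]
  rw [h1]
  rcases eq_or_ne k 0 with rfl | hk
  · simp [poissonWeight]
  · simp [poissonWeight, hk]

/-- G(n+1) is G(n) plus an independent Gamma(α, β) increment, so Poisson weights convolve and the
increment contributes negative binomial weights. -/
theorem integral_poissonWeight_succ (hG : IsGammaSubordinator G α β μ) (hα : 0 < α) (hβ : 0 < β)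
    (hv : 0 < v) (n k : ℕ) :
    ∫ ω, poissonWeight v k (G (n + 1 : ℕ) ω) ∂μ =
      ∑ j ∈ Finset.range (k + 1),
        gammaMix α β v (k - j) * ∫ ω, poissonWeight v j (G n ω) ∂μ := by
  have hnn : (n : ℝ≥0) < (n + 1 : ℕ) := by exact_mod_cast n.lt_succ_self
  set D : Ω → ℝ := fun ω => (G (n + 1 : ℕ) ω : ℝ) - G n ω with hD
  have hDm : Measurable D :=
    (hG.measurable _).coe_nnreal_real.sub (hG.measurable _).coe_nnreal_real
  have hD0 : ∀ᵐ ω ∂μ, 0 ≤ D ω := by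
    filter_upwards [hG.regular] with ω hω
    exact sub_nonneg.2 (NNReal.coe_le_coe.2 (hω.1 hnn.le))
  have hind : IndepFun (fun ω => (G n ω : ℝ)) D μ :=
    hG.indep.indepFun_eval_sub (r := 0) zero_le hnn.le
      (by filter_upwards [hG.zero] with ω hω; rw [hω, NNReal.coe_zero])
  have hlaw : μ.map D = gammaMeasure α β := by
    have h := hG.law _ _ hnn
    rw [hD, h]; congr 1; push_cast; ring
  have hw : ∀ ω, poissonWeight v k (G (n + 1 : ℕ) ω) = ∑ j ∈ Finset.range (k + 1),
      poissonWeight v j (G n ω) * poissonWeight v (k - j) (D ω) := fun ω => by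
    rw [← poissonWeight_add]; congr 1; rw [hD]; ring
  have hgm : ∀ j, Measurable fun ω => poissonWeight v j (G n ω) := fun j =>
    (continuous_poissonWeight v j).measurable.comp (hG.measurable _).coe_nnreal_real
  have hdm : ∀ j, Measurable fun ω => poissonWeight v j (D ω) := fun j =>
    (continuous_poissonWeight v j).measurable.comp hDm
  simp_rw [hw]
  rw [integral_finsetSum]
  · refine Finset.sum_congr rfl fun j _ => ?_
    have hjk : IndepFun (fun ω => poissonWeight v j (G n ω))
        (fun ω => poissonWeight v (k - j) (D ω)) μ :=
      hind.comp (continuous_poissonWeight v j).measurable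
        (continuous_poissonWeight v (k - j)).measurable
    rw [IndepFun.integral_fun_mul_eq_mul_integral hjk (hgm j).aestronglyMeasurable (hdm _).aestronglyMeasurable, mul_comm,
      ← integral_poissonWeight_gammaMeasure hα hβ hv, ← hlaw,
      integral_map hDm.aemeasurable (continuous_poissonWeight v _).aestronglyMeasurable]
  · refine fun j _ => Integrable.of_bound ((hgm j).mul (hdm _)).aestronglyMeasurable 1 ?_
    filter_upwards [hD0] with ω hω
    have h1 := poissonWeight_nonneg hv.le (NNReal.coe_nonneg (G n ω)) j
    have h2 := poissonWeight_nonneg hv.le hω (k - j)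
    rw [Real.norm_of_nonneg (mul_nonneg h1 h2)]
    exact mul_le_one₀ (poissonWeight_le_one hv.le (NNReal.coe_nonneg (G n ω)) j) h2
      (poissonWeight_le_one hv.le hω _)

/-- The case k = 0 of the recursion, where only one term survives. -/
theorem integral_exp_neg (hG : IsGammaSubordinator G α β μ) (hα : 0 < α) (hβ : 0 < β)
    (hv : 0 < v) (n : ℕ) :
    ∫ ω, Real.exp (-(v * G n ω)) ∂μ = (β ^ α / (v + β) ^ α) ^ n := by
  simp_rw [← poissonWeight_zero]
  induction n with
  | zero => rw [hG.integral_poissonWeight_zero, pow_zero, if_pos rfl]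
  | succ n ih =>
    rw [hG.integral_poissonWeight_succ hα hβ hv, zero_add, Finset.sum_range_one, ih, gammaMix]
    simp [(Real.Gamma_pos_of_pos hα).ne', pow_succ']

end IsGammaSubordinator

end CompositeProcess

/-! ### State probabilities: derivative formula and governing equation. -/

section Composition

variable {Ω : Type*} [MeasurableSpace Ω] {μ : Measure Ω}

theorem IsSubordinator.aemeasurable_inverse {H : ℝ≥0 → Ω → ℝ≥0∞} {φ : ℝ → ℝ}
    (hH : IsSubordinator H φ μ) (t : ℝ≥0) : AEMeasurable (fun ω => (inverse H t ω : ℝ)) μ := by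
  refine ⟨fun ω => ((ratInverse (fun s => H s ω) t).toNNReal : ℝ),
    (measurable_ratInverse hH.measurable measurable_const).ennreal_toNNReal.coe_nnreal_real, ?_⟩
  filter_upwards [hH.ae_inverse_eq] with ω hω
  rw [hω t]

theorem IsSubordinator.integral_inverse {H : ℝ≥0 → Ω → ℝ≥0∞} {φ : ℝ → ℝ}
    (hH : IsSubordinator H φ μ) (t : ℝ≥0) {w : ℝ → ℝ} (hw : Continuous w) :
    ∫ ω, w (inverse H t ω) ∂μ = ∫ x, w x ∂(inverseLaw H μ t) :=
  (integral_map (hH.aemeasurable_inverse t) hw.aestronglyMeasurable).symm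

variable [IsProbabilityMeasure μ]

theorem IsSubordinator.inverseLaw_absolutelyContinuous {H : ℝ≥0 → Ω → ℝ≥0∞}
    {f : BernsteinTriplet} (hH : IsSubordinator H f.fn μ) (hf : f.ConditionI) {t : ℝ≥0}
    (ht : 0 < t) : inverseLaw H μ t ≪ volume := by
  obtain ⟨P, Q, hQM, h, hQ⟩ := hH.exists_isInversePair hf
  rw [← hQ]
  exact h.absolutelyContinuous_right hf (NNReal.coe_pos.2 ht)

theorem IsSubordinator.inverseLaplace_eq {H : ℝ≥0 → Ω → ℝ≥0∞}
    {f : BernsteinTriplet} (hH : IsSubordinator H f.fn μ) (hf : f.ConditionI) {t : ℝ≥0}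
    (ht : 0 < t) (θ : ℝ) :
    inverseLaplace H μ t θ =
      ∫ x in Ioi (0 : ℝ), Real.exp (-(θ * x)) * inverseDensity H μ t x := by
  have hac := hH.inverseLaw_absolutelyContinuous hf ht
  have hpr : IsProbabilityMeasure (inverseLaw H μ t) :=
    Measure.isProbabilityMeasure_map (hH.aemeasurable_inverse t)
  have hmem : ∀ᵐ x ∂(inverseLaw H μ t), x ∈ Ioi (0 : ℝ) := by
    have h0 : ∀ᵐ x ∂(inverseLaw H μ t), x ∈ Ici (0 : ℝ) :=
      (ae_map_iff (hH.aemeasurable_inverse t) measurableSet_Ici).2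
        (ae_of_all _ fun ω => NNReal.coe_nonneg _)
    have h1 : ∀ᵐ x ∂(inverseLaw H μ t), x ≠ 0 := hac.ae_le
      (Measure.ae_ne volume 0)
    filter_upwards [h0, h1] with x hx hx' using lt_of_le_of_ne hx hx'.symm
  rw [inverseLaplace, hH.integral_inverse t (w := fun x => Real.exp (-(θ * x))) (by fun_prop),
    ← Measure.restrict_eq_self_of_ae_mem hmem, ← setIntegral_rnDeriv_smul hac measurableSet_Ioi]
  simp only [inverseDensity, smul_eq_mul, mul_comm]

theorem psiGN_eq {lam α β v : ℝ} (hβ : 0 < β) (hv : 0 < v) :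
    psiGN lam α β v = lam * (1 - β ^ α / (v + β) ^ α) := by
  rw [psiGN, Real.rpow_neg hβ.le, Real.rpow_neg (by positivity), add_comm β v]
  have h1 : β ^ α ≠ 0 := by positivity
  field_simp

theorem psiGN_one_eq_psiE {lam β v : ℝ} (hβ : 0 < β) (hv : 0 < v) :
    psiGN lam 1 β v = psiE lam β v := by
  rw [psiGN_eq hβ hv, psiE, Real.rpow_one, Real.rpow_one]
  have : v + β ≠ 0 := by positivity
  rw [add_comm β v]
  field_simp
  ring

theorem scaledDeriv_congr {g₁ g₂ : ℝ → ℝ} {v : ℝ} (h : g₁ =ᶠ[𝓝 v] g₂) (k : ℕ) :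
    scaledDeriv k g₁ v = scaledDeriv k g₂ v := by
  rw [scaledDeriv, scaledDeriv, h.iteratedDeriv_eq k]

theorem mem_interior_integrableExpSet_neg {S : Ω → ℝ≥0} (hS : Measurable S) {v : ℝ} (hv : 0 < v) :
    v ∈ interior (integrableExpSet (fun ω => -(S ω : ℝ)) μ) := by
  refine mem_interior.2 ⟨Ioi 0, fun u hu => ?_, isOpen_Ioi, hv⟩
  have hm : Measurable fun ω => Real.exp (u * -(S ω : ℝ)) := by fun_prop
  refine Integrable.of_bound hm.aestronglyMeasurable 1 (ae_of_all _ fun ω => ?_)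
  rw [Real.norm_of_nonneg (Real.exp_pos _).le, Real.exp_le_one_iff]
  have := mul_nonneg (le_of_lt (mem_Ioi.1 hu)) (NNReal.coe_nonneg (S ω))
  linarith

/-- Each derivative in v brings down a factor -S, and (-v)^k (-S)^k = (vS)^k. -/
theorem integral_poissonWeight_eq_scaledDeriv {S : Ω → ℝ≥0} (hS : Measurable S) {v : ℝ}
    (hv : 0 < v) (k : ℕ) :
    ∫ ω, poissonWeight v k (S ω) ∂μ = scaledDeriv k (mgf (fun ω => -(S ω : ℝ)) μ) v := by
  rw [scaledDeriv, iteratedDeriv_mgf (mem_interior_integrableExpSet_neg hS hv), mul_div_assoc,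
    ← integral_div, ← integral_const_mul]
  refine integral_congr_ae (ae_of_all _ fun ω => ?_)
  have h1 : (-v) ^ k * (-(S ω : ℝ)) ^ k = (v * S ω) ^ k := by rw [← mul_pow, neg_mul_neg]
  have h2 : v * -(S ω : ℝ) = -(v * S ω) := by ring
  simp only [poissonWeight, h2]
  rw [← h1]
  ring

variable {lam₁ lam α β : ℝ} {N₁ : ℝ≥0 → Ω → ℕ} {G : ℝ≥0 → Ω → ℝ≥0} {N : ℝ≥0 → Ω → ℕ}
  {H : ℝ≥0 → Ω → ℝ≥0∞}

/-- For v > 0 the function v ↦ ℓ̃_f(t, ψ(v)) is the moment generating function of -S, with S from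
`exists_composite`. That function is analytic on v > 0, and agreement near `lam₁` suffices for
smoothness and derivatives. -/
theorem contDiffAt_and_stateProb_eq_scaledDeriv {φ : ℝ → ℝ} (hlam₁ : 0 < lam₁) (hlam : 0 < lam)
    (hα : 0 < α) (hβ : 0 < β) (hN₁ : IsPoissonProcess N₁ lam₁ μ)
    (hG : IsGammaSubordinator G α β μ) (hN : IsPoissonProcess N lam μ)
    (hH : IsSubordinator H φ μ)
    (hindep : iIndep ![pathSigma N₁, pathSigma G, pathSigma N, pathSigma H] μ) (k : ℕ)
    (t : ℝ≥0) :
    ContDiffAt ℝ (⊤ : ℕ∞) (fun v => inverseLaplace H μ t (psiGN lam α β v)) lam₁ ∧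
      stateProb N₁ G N H μ k t =
        scaledDeriv k (fun v => inverseLaplace H μ t (psiGN lam α β v)) lam₁ := by
  obtain ⟨S, hS, hp, hmix⟩ := exists_composite hlam₁ hlam hN₁ hG.measurable hN hH hindep t
  have heq : (fun v => inverseLaplace H μ t (psiGN lam α β v)) =ᶠ[𝓝 lam₁]
      mgf (fun ω => -(S ω : ℝ)) μ := by
    filter_upwards [lt_mem_nhds hlam₁] with v hv
    have h1 := hmix (fun g => Real.exp (-(v * g))) (by fun_prop) (fun g _ => (Real.exp_pos _).le)
      (fun g hg => Real.exp_le_one_iff.2 (by have := mul_nonneg hv.le hg; linarith))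
    simp_rw [hG.integral_exp_neg hα hβ hv, poissonMix_pow, ← psiGN_eq (lam := lam) (α := α) hβ hv]
      at h1
    rw [inverseLaplace, ← h1, mgf]
    refine integral_congr_ae (ae_of_all _ fun ω => ?_)
    simp only [mul_neg]
  refine ⟨ContDiffAt.congr_of_eventuallyEq
    (analyticAt_mgf (mem_interior_integrableExpSet_neg hS hlam₁)).contDiffAt heq, ?_⟩
  rw [hp k, scaledDeriv_congr heq, integral_poissonWeight_eq_scaledDeriv hS hlam₁]

/-- The probabilities of `k` points before the time change by the inverse subordinator. -/
def compoundProb (μ : Measure Ω) (G : ℝ≥0 → Ω → ℝ≥0) (lam₁ lam : ℝ) (k : ℕ) (y : ℝ) : ℝ :=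
  poissonMix lam (fun n => ∫ ω, poissonWeight lam₁ k (G n ω) ∂μ) y

theorem integral_poissonWeight_mem_Icc (hG : ∀ t, Measurable (G t)) (hlam₁ : 0 ≤ lam₁) (k : ℕ)
    (t : ℝ≥0) : ∫ ω, poissonWeight lam₁ k (G t ω) ∂μ ∈ Icc (0 : ℝ) 1 := by
  have h0 : ∀ ω, 0 ≤ poissonWeight lam₁ k (G t ω) := fun ω =>
    poissonWeight_nonneg hlam₁ (NNReal.coe_nonneg (G t ω)) k
  have h1 : ∀ ω, poissonWeight lam₁ k (G t ω) ≤ 1 := fun ω =>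
    poissonWeight_le_one hlam₁ (NNReal.coe_nonneg (G t ω)) k
  have hm : Measurable fun ω => poissonWeight lam₁ k (G t ω) :=
    (continuous_poissonWeight lam₁ k).measurable.comp (hG t).coe_nnreal_real
  refine ⟨integral_nonneg h0, ?_⟩
  calc ∫ ω, poissonWeight lam₁ k (G t ω) ∂μ ≤ ∫ _, (1 : ℝ) ∂μ :=
        integral_mono (Integrable.of_bound hm.aestronglyMeasurable 1 (ae_of_all _ fun ω => by
          rw [Real.norm_of_nonneg (h0 ω)]; exact h1 ω)) (integrable_const _) h1
    _ = 1 := by simp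

/-- The shift in `hasDerivAt_poissonMix` advances G by one unit, which `integral_poissonWeight_succ`
resolves into states j ≤ k; the outflow `lam` sits on the diagonal. -/
theorem hasDerivAt_compoundProb (hG : IsGammaSubordinator G α β μ) (hlam₁ : 0 < lam₁)
    (hα : 0 < α) (hβ : 0 < β) (k : ℕ) (y : ℝ) :
    HasDerivAt (compoundProb μ G lam₁ lam k)
      (∑ j ∈ Finset.range (k + 1), (lam * gammaMix α β lam₁ (k - j) - if j = k then lam else 0) *
        compoundProb μ G lam₁ lam j y) y := by
  have habs : ∀ k n : ℕ, |∫ ω, poissonWeight lam₁ k (G n ω) ∂μ| ≤ 1 := fun k n => by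
    obtain ⟨h0, h1⟩ := integral_poissonWeight_mem_Icc (μ := μ) hG.measurable hlam₁.le k n
    exact abs_le.2 ⟨by linarith, h1⟩
  refine (hasDerivAt_poissonMix lam (habs k) y).congr_deriv ?_
  simp_rw [hG.integral_poissonWeight_succ hα hβ hlam₁ _ k]
  rw [poissonMix_sum lam _ _ (fun j n => habs j n)]
  simp only [sub_mul, Finset.sum_sub_distrib, ite_mul, zero_mul, Finset.sum_ite_eq',
    Finset.self_mem_range_succ, if_true, Finset.mul_sum, mul_assoc]
  rfl

theorem convDeriv_stateProb_range {f : BernsteinTriplet} (hf : f.ConditionI)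
    (hlam₁ : 0 < lam₁) (hlam : 0 < lam)
    (hα : 0 < α) (hβ : 0 < β) (hN₁ : IsPoissonProcess N₁ lam₁ μ)
    (hG : IsGammaSubordinator G α β μ) (hN : IsPoissonProcess N lam μ)
    (hH : IsSubordinator H f.fn μ)
    (hindep : iIndep ![pathSigma N₁, pathSigma G, pathSigma N, pathSigma H] μ) (k : ℕ)
    {t : ℝ≥0} (ht : 0 < t) :
    f.ConvDifferentiableAt (fun r : ℝ => stateProb N₁ G N H μ k r.toNNReal) t ∧
      f.convDeriv (fun r : ℝ => stateProb N₁ G N H μ k r.toNNReal) t =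
        ∑ j ∈ Finset.range (k + 1),
          (lam * gammaMix α β lam₁ (k - j) - if j = k then lam else 0) *
            stateProb N₁ G N H μ j t := by
  obtain ⟨P, Q, hQM, h, hQ⟩ := hH.exists_isInversePair hf
  have hd := hasDerivAt_compoundProb (lam := lam) hG hlam₁ hα hβ
  have hcont : ∀ k, Continuous (compoundProb μ G lam₁ lam k) := fun k =>
    continuous_iff_continuousAt.2 fun y => (hd k y).continuousAt
  have hcoef := integral_poissonWeight_mem_Icc (μ := μ) (G := G) hG.measurable hlam₁.le
  -- Freezing the argument at 0 for y < 0 gives the bounds 0 ≤ w ≤ 1 on the whole line; Y(t) ≥ 0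
  -- never sees the change.
  set w : ℕ → ℝ → ℝ := fun k y => compoundProb μ G lam₁ lam k (max 0 y) with hwdef
  have hwc : ∀ k, Continuous (w k) := fun k =>
    (hcont k).comp (continuous_const.max continuous_id)
  have hweq : ∀ k y, 0 ≤ y → w k y = compoundProb μ G lam₁ lam k y := fun k y hy => by
    simp only [hwdef, max_eq_right hy]
  have hstate : ∀ (k : ℕ) (t : ℝ≥0), stateProb N₁ G N H μ k t = ∫ x, w k x ∂(Q t) := by
    intro k t
    obtain ⟨S, hS, hp, hmix⟩ := exists_composite hlam₁ hlam hN₁ hG.measurable hN hH hindep t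
    rw [hp k, hmix _ (continuous_poissonWeight lam₁ k).measurable
      (fun g hg => poissonWeight_nonneg hlam₁.le hg k)
      (fun g hg => poissonWeight_le_one hlam₁.le hg k), hQ t, ← hH.integral_inverse t (hwc k)]
    refine integral_congr_ae (ae_of_all _ fun ω => ?_)
    exact (hweq k _ (NNReal.coe_nonneg (inverse H t ω))).symm
  have key := h.convDeriv_integral_right hf (w := w)
    (c := fun k j => lam * gammaMix α β lam₁ (k - j) - if j = k then lam else 0) hwc
    (fun k x => poissonMix_nonneg hlam.le (fun n => (hcoef k n).1) (le_max_left 0 x))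
    (fun k x => poissonMix_le_one hlam.le (fun n => (hcoef k n).1) (fun n => (hcoef k n).2)
      (le_max_left 0 x))
    (fun k z hz => ?_) (u := fun r : ℝ => stateProb N₁ G N H μ k r.toNNReal) (k := k)
    (fun r hr => by rw [hstate, Real.coe_toNNReal _ hr]) (NNReal.coe_pos.2 ht)
  · refine ⟨key.1, key.2.trans ?_⟩
    simp only [hstate]
  · have hci : ∀ j, IntervalIntegrable (compoundProb μ G lam₁ lam j) volume 0 z := fun j =>
      (hcont j).intervalIntegrable _ _
    have hFTC := intervalIntegral.integral_eq_sub_of_hasDerivAt (a := 0) (b := z)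
      (fun y _ => hd k y) (Continuous.intervalIntegrable (by fun_prop) _ _)
    rw [intervalIntegral.integral_finsetSum fun j _ => (hci j).const_mul _] at hFTC
    rw [hweq k z hz, hweq k 0 le_rfl, eq_comm, ← eq_sub_iff_add_eq', ← hFTC]
    refine Finset.sum_congr rfl fun j _ => ?_
    rw [intervalIntegral.integral_const_mul]
    congr 1
    refine intervalIntegral.integral_congr fun y hy => ?_
    rw [uIcc_of_le hz] at hy
    exact hweq j y hy.1

/-- Reindexing by m = k - j; the diagonal term m = 0 is split off and gives the coefficient of p_k.
-/
theorem convDeriv_stateProb {f : BernsteinTriplet} (hf : f.ConditionI)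
    (hlam₁ : 0 < lam₁) (hlam : 0 < lam)
    (hα : 0 < α) (hβ : 0 < β) (hN₁ : IsPoissonProcess N₁ lam₁ μ)
    (hG : IsGammaSubordinator G α β μ) (hN : IsPoissonProcess N lam μ)
    (hH : IsSubordinator H f.fn μ)
    (hindep : iIndep ![pathSigma N₁, pathSigma G, pathSigma N, pathSigma H] μ) (k : ℕ)
    {t : ℝ≥0} (ht : 0 < t) :
    f.ConvDifferentiableAt (fun r : ℝ => stateProb N₁ G N H μ k r.toNNReal) t ∧
      f.convDeriv (fun r : ℝ => stateProb N₁ G N H μ k r.toNNReal) t =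
        (lam * β ^ α / (lam₁ + β) ^ α - lam) * stateProb N₁ G N H μ k t +
          lam * β ^ α / (lam₁ + β) ^ α *
            ∑ m ∈ Finset.Icc 1 k,
              lam₁ ^ m / (lam₁ + β) ^ m *
                (Real.Gamma ((m : ℝ) + α) / ((m.factorial : ℝ) * Real.Gamma α)) *
                stateProb N₁ G N H μ (k - m) t := by
  obtain ⟨h1, h2⟩ := convDeriv_stateProb_range hf hlam₁ hlam hα hβ hN₁ hG hN hH hindep k ht
  refine ⟨h1, ?_⟩
  have hsum : ∑ j ∈ Finset.range k, lam * gammaMix α β lam₁ (k - j) * stateProb N₁ G N H μ j t =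
      ∑ m ∈ Finset.Icc 1 k, lam * gammaMix α β lam₁ m * stateProb N₁ G N H μ (k - m) t := by
    refine Finset.sum_nbij' (fun j => k - j) (fun m => k - m) ?_ ?_ ?_ ?_ ?_
    · intro j hj
      rw [Finset.mem_range] at hj
      rw [Finset.mem_Icc]; omega
    · intro m hm
      rw [Finset.mem_Icc] at hm
      rw [Finset.mem_range]; omega
    · intro j hj
      rw [Finset.mem_range] at hj; omega
    · intro m hm
      rw [Finset.mem_Icc] at hm; omega
    · intro j hj
      rw [Finset.mem_range] at hj
      rw [Nat.sub_sub_self hj.le]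
  have h0 : gammaMix α β lam₁ 0 = β ^ α / (lam₁ + β) ^ α := by
    simp [gammaMix, (Real.Gamma_pos_of_pos hα).ne']
  have hlt : ∀ j ∈ Finset.range k, (lam * gammaMix α β lam₁ (k - j) - if j = k then lam else 0) *
      stateProb N₁ G N H μ j t = lam * gammaMix α β lam₁ (k - j) * stateProb N₁ G N H μ j t :=
    fun j hj => by rw [if_neg (Finset.mem_range.1 hj).ne, sub_zero]
  rw [h2, Finset.sum_range_succ, Finset.sum_congr rfl hlt, hsum, Nat.sub_self, if_pos rfl, h0,
    add_comm, Finset.mul_sum]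
  congr 1
  · ring
  · refine Finset.sum_congr rfl fun m _ => ?_
    rw [gammaMix]; ring

theorem convDeriv_stateProb_one {f : BernsteinTriplet} (hf : f.ConditionI)
    (hlam₁ : 0 < lam₁) (hlam : 0 < lam) (hβ : 0 < β) (hN₁ : IsPoissonProcess N₁ lam₁ μ)
    (hG : IsGammaSubordinator G 1 β μ) (hN : IsPoissonProcess N lam μ)
    (hH : IsSubordinator H f.fn μ)
    (hindep : iIndep ![pathSigma N₁, pathSigma G, pathSigma N, pathSigma H] μ) (k : ℕ)
    {t : ℝ≥0} (ht : 0 < t) :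
    f.convDeriv (fun r : ℝ => stateProb N₁ G N H μ k r.toNNReal) t =
      -lam * (lam₁ / (lam₁ + β)) * stateProb N₁ G N H μ k t +
        lam * β / (lam₁ + β) *
          ∑ m ∈ Finset.Icc 1 k,
            (lam₁ / (lam₁ + β)) ^ m * stateProb N₁ G N H μ (k - m) t := by
  rw [(convDeriv_stateProb hf hlam₁ hlam one_pos hβ hN₁ hG hN hH hindep k ht).2]
  have hne : lam₁ + β ≠ 0 := by positivity
  have hc : lam * β / (lam₁ + β) - lam = -lam * (lam₁ / (lam₁ + β)) := by
    field_simp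
    ring
  simp only [Real.rpow_one, hc, Real.Gamma_one, mul_one, Real.Gamma_nat_eq_factorial]
  congr 2
  refine Finset.sum_congr rfl fun m _ => ?_
  rw [div_self (by positivity), mul_one, div_pow]

end Composition

end ConvCounting
end

theorem mainTheorem6 {Ω : Type*} [MeasurableSpace Ω] (μ : Measure Ω) [IsProbabilityMeasure μ]
    (f : ConvCounting.BernsteinTriplet) (hf : f.ConditionI)
    (lam₁ lam α β : ℝ) (hlam₁ : 0 < lam₁) (hlam : 0 < lam) (hα : 0 < α) (hβ : 0 < β)
    (N₁ : ℝ≥0 → Ω → ℕ) (G : ℝ≥0 → Ω → ℝ≥0) (N : ℝ≥0 → Ω → ℕ) (H : ℝ≥0 → Ω → ℝ≥0∞)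
    (hN₁ : ConvCounting.IsPoissonProcess N₁ lam₁ μ)
    (hG : ConvCounting.IsGammaSubordinator G α β μ)
    (hN : ConvCounting.IsPoissonProcess N lam μ)
    (hH : ConvCounting.IsSubordinator H f.fn μ)
    (hindep : iIndep ![ConvCounting.pathSigma N₁, ConvCounting.pathSigma G,
      ConvCounting.pathSigma N, ConvCounting.pathSigma H] μ) :
    -- for `t > 0`, `Y(t)` has a density, and `ℓ̃_f(t, ·)` is its Laplace transform
    (∀ t : ℝ≥0, 0 < t → ConvCounting.inverseLaw H μ t ≪ volume ∧
      ∀ θ : ℝ, 0 ≤ θ → ConvCounting.inverseLaplace H μ t θ =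
        ∫ x in Ioi (0 : ℝ), Real.exp (-(θ * x)) * ConvCounting.inverseDensity H μ t x) ∧
    -- the distribution of `N₁(G_N(Y(t)))`
    (∀ (k : ℕ) (t : ℝ≥0),
      ContDiffAt ℝ (⊤ : ℕ∞)
        (fun v => ConvCounting.inverseLaplace H μ t (ConvCounting.psiGN lam α β v)) lam₁ ∧
      ConvCounting.stateProb N₁ G N H μ k t =
        ConvCounting.scaledDeriv k
          (fun v => ConvCounting.inverseLaplace H μ t (ConvCounting.psiGN lam α β v)) lam₁) ∧
    -- the governing equation
    (∀ (k : ℕ) (t : ℝ≥0), 0 < t →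
      f.ConvDifferentiableAt
        (fun r : ℝ => ConvCounting.stateProb N₁ G N H μ k r.toNNReal) t ∧
      f.convDeriv (fun r : ℝ => ConvCounting.stateProb N₁ G N H μ k r.toNNReal) t =
        (lam * β ^ α / (lam₁ + β) ^ α - lam) * ConvCounting.stateProb N₁ G N H μ k t +
          lam * β ^ α / (lam₁ + β) ^ α *
            ∑ m ∈ Finset.Icc 1 k,
              lam₁ ^ m / (lam₁ + β) ^ m *
                (Real.Gamma ((m : ℝ) + α) / ((m.factorial : ℝ) * Real.Gamma α)) *
                ConvCounting.stateProb N₁ G N H μ (k - m) t) ∧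
    -- the compound Poisson-exponential case
    (α = 1 →
      (∀ (k : ℕ) (t : ℝ≥0),
        ContDiffAt ℝ (⊤ : ℕ∞)
          (fun v => ConvCounting.inverseLaplace H μ t (ConvCounting.psiE lam β v)) lam₁ ∧
        ConvCounting.stateProb N₁ G N H μ k t =
          ConvCounting.scaledDeriv k
            (fun v => ConvCounting.inverseLaplace H μ t (ConvCounting.psiE lam β v)) lam₁) ∧
      (∀ (k : ℕ) (t : ℝ≥0), 0 < t →
        f.convDeriv (fun r : ℝ => ConvCounting.stateProb N₁ G N H μ k r.toNNReal) t =
          -lam * (lam₁ / (lam₁ + β)) * ConvCounting.stateProb N₁ G N H μ k t +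
            lam * β / (lam₁ + β) *
              ∑ m ∈ Finset.Icc 1 k,
                (lam₁ / (lam₁ + β)) ^ m * ConvCounting.stateProb N₁ G N H μ (k - m) t)) := by
  refine ⟨fun t ht => ⟨hH.inverseLaw_absolutelyContinuous hf ht,
    fun θ _ => hH.inverseLaplace_eq hf ht θ⟩, fun k t =>
    ConvCounting.contDiffAt_and_stateProb_eq_scaledDeriv hlam₁ hlam hα hβ hN₁ hG hN hH hindep k t,
    fun k t ht => ConvCounting.convDeriv_stateProb hf hlam₁ hlam hα hβ hN₁ hG hN hH hindep k ht,
    ?_⟩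
  rintro rfl
  refine ⟨fun k t => ?_, fun k t ht =>
    ConvCounting.convDeriv_stateProb_one hf hlam₁ hlam hβ hN₁ hG hN hH hindep k ht⟩
  obtain ⟨h1, h2⟩ :=
    ConvCounting.contDiffAt_and_stateProb_eq_scaledDeriv hlam₁ hlam hα hβ hN₁ hG hN hH hindep k t
  -- The two exponents are identified only for v > 0, which is enough as the claims are local at
  -- `lam₁`.
  have heq : (fun v => ConvCounting.inverseLaplace H μ t (ConvCounting.psiE lam β v)) =ᶠ[nhds lam₁]
      fun v => ConvCounting.inverseLaplace H μ t (ConvCounting.psiGN lam 1 β v) := by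
    filter_upwards [lt_mem_nhds hlam₁] with v hv
    rw [ConvCounting.psiGN_one_eq_psiE hβ hv]
  exact ⟨h1.congr_of_eventuallyEq heq, h2.trans (ConvCounting.scaledDeriv_congr heq k).symm⟩
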